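/- **Theorem (Hamiltonian structure for GP).** Let $d\ge 1$, $\kappa\in\{1,-1\}$. *Spaces.* An operator $A\in\mathcal L(\mathcal S(\mathbb R^{dk}),\mathcal S'(\mathbb R^{dk}))$ has Schwartz kernel $K_A\in\mathcal S'(\mathbb R^{dk}\times\mathbb R^{dk})$, $\langle Af,g\rangle=\langle K_A,g\otimes f\rangle$. It has the *good mapping property* if for every $\alpha\le k$ the distribution $$\int A(f)(x_1,\dots,x_k)\,g(x_1,\dots,x_{\alpha-1},x_\alpha',x_{\alpha+1},\dots,x_k)\,dx_1\cdots dx_{\alpha-1}dx_{\alpha+1}\cdots dx_k$$ is a Schwartz function of $(x_\alpha,x_\alpha')\in\mathbb R^{2d}$ depending bilinearly and continuously on $f,g\in\mathcal S(\mathbb R^{dk})$. Let $\mathfrak G_\infty$ be the space of sequences $A=(A^{(k)})_{k\ge1}$ with finitely many nonzero terms, where $A^{(k)}:\mathcal S_s(\mathbb R^{dk})\to\mathcal S_s'(\mathbb R^{dk})$ is continuous, has the good mapping property (bosonic operators being identified with $A^{(k)}\circ\mathrm{Sym}_k$) and satisfies $(A^{(k)})^*=-A^{(k)}$. Let $\mathfrak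 G_\infty^*$ be the real topological vector space (product topology) of sequences $\Gamma=(\gamma^{(k)})_{k\ge1}$ of self-adjoint integral operators with Schwartz kernels $\gamma^{(k)}(\underline x_k;\underline x_k')$ that are symmetric in $\underline x_k$ and, separately, in $\underline x_k'$. Put $\mathrm{Tr}(A^{(k)}\gamma^{(k)})=\langle K_{A^{(k)}},(\gamma^{(k)})^t\rangle$, where $\gamma^t(\underline x;\underline x')=\gamma(\underline x';\underline x)$, and $\mathrm{Tr}(A\cdot\Gamma)=\sum_k\mathrm{Tr}(A^{(k)}\gamma^{(k)})$. *Bracket.* On $\mathfrak G_\infty$ let $$[A,B]^{(k)}=\mathrm{Sym}_k\sum_{\ell+j-1=k}\ \sum_{\alpha\le\ell,\ \beta\le j}\bigl(A^{(\ell)}\circ_\alpha^\beta B^{(j)}-B^{(j)}\circ_\beta^\alpha A^{(\ell)}\bigr),$$ where $\mathrm{Sym}_k$ is the average over all simultaneous relabellings of the $k$ particles (the result being regarded as an operator $\mathcal S_s\to\mathcal S_s'$) and $A^{(\ell)}\circ_\alpha^\beta B^{(j)}=A^{(\ell)}_{(1,\dots,\ell)}B^{(j)}_{\beta\to\alpha}$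 is defined by $$\langle(A^{(\ell)}\circ_\alpha^\beta B^{(j)})f,g\rangle=\langle K_{A^{(\ell)}},\Phi(f,g)^t\rangle,\qquad \Phi(f,g)(\underline x_\ell;\underline x_\ell')=\int (B^{(j)}_{\beta\to\alpha}f)(\underline x_\ell,z)\,g(\underline x'_\ell,z)\,dz,\quad z\in\mathbb R^{d(j-1)};$$ here $B^{(j)}_{\beta\to\alpha}$ acts through its $\beta$-th variable on $x_\alpha$ and through its other $j-1$ variables on the last $j-1$ variables $z$. *Poisson structure.* Let $\mathcal A_\infty$ be the algebra of real functionals on $\mathfrak G_\infty^*$ generated by the constants and the functionals $\Gamma\mapsto i\,\mathrm{Tr}(A\cdot\Gamma)$, $A\in\mathfrak G_\infty$. For $F\in\mathcal A_\infty$ the Gâteaux derivative $dF[\Gamma]$ is identified with an element of $\mathfrak G_\infty$ through $dF[\Gamma](v)=i\,\mathrm{Tr}(dF[\Gamma]\cdot v)$, and $$\{F,G\}(\Gamma)=i\,\mathrm{Tr}\bigl([dF[\Gamma],dG[\Gamma]]\cdot\Gamma\bigr),\qquad F,G\in\mathcal A_\infty .$$ A *Hamiltonian vector field* of $H\in\mathcal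 A_\infty$ is a smooth (in the Gâteaux sense: all iterated directional derivatives exist and are jointly continuous) map $X:\mathfrak G_\infty^*\to\mathfrak G_\infty^*$ with $dF[\Gamma](X(\Gamma))=\{F,H\}(\Gamma)$ for all $F\in\mathcal A_\infty$ and $\Gamma\in\mathfrak G_\infty^*$. *Gross–Pitaevskii.* Let $$H_{GP}(\Gamma)=\mathrm{Tr}(\mathbf W_{GP}\cdot\Gamma)=\mathrm{Tr}(-\Delta_{x_1}\gamma^{(1)})+\kappa\,\mathrm{Tr}(\delta(X_1-X_2)\gamma^{(2)}),\qquad \mathbf W_{GP}=(-\Delta_{x_1},\kappa\,\delta(X_1-X_2),0,\dots).$$ The cubic Gross–Pitaevskii hierarchy is $$i\partial_t\gamma^{(k)}=-\Bigl[\sum_{j=1}^k\Delta_{x_j},\gamma^{(k)}\Bigr]+2\kappa\sum_{j=1}^k\bigl(B^+_{j;k+1}-B^-_{j;k+1}\bigr)\gamma^{(k+1)},\qquad k\ge1,$$ where $(B^+_{j;k+1}\gamma^{(k+1)})(\underline x_k;\underline x_k')=\gamma^{(k+1)}(\underline x_k,x_j;\underline x_k',x_j)$ and $(B^-_{j;k+1}\gamma^{(k+1)})(\underline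 x_k;\underline x_k')=\gamma^{(k+1)}(\underline x_k,x_j';\underline x_k',x_j')$. *Claim.* $H_{GP}$ is real-valued and belongs to $\mathcal A_\infty$; it has exactly one Hamiltonian vector field $X_{H_{GP}}$; and for every compact interval $I=[a,b]$ with $a<b$ and every $\Gamma\in C^\infty(I;\mathfrak G_\infty^*)$ (one-sided derivatives at the end points), $\Gamma$ solves the cubic Gross–Pitaevskii hierarchy on $I$ if and only if $$\Bigl(\frac{d}{dt}\Gamma\Bigr)(t)=X_{H_{GP}}(\Gamma(t))\qquad\text{for all }t\in I .$$ -/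

import Mathlib

open SchwartzMap MeasureTheory Filter Topology

noncomputable section

namespace GPHierarchy

/-! ### Configuration spaces, density kernels and distribution-valued operators

Throughout, the index `n : ℕ` labels the component with `n + 1` particles, so that the
hierarchies `(γ^(k))` with `k ≥ 1` are indexed by `n = k - 1`. -/

/-- The one-particle space `ℝ^d`. -/
abbrev E (d : ℕ) : Type := EuclideanSpace ℝ (Fin d)

/-- The `m`-particle configuration space `(ℝ^d)^m`. -/
abbrev X (d m : ℕ) : Type := Fin m → E d

/-- Schwartz functions `γ(x; x')` on `(ℝ^d)^(n+1) × (ℝ^d)^(n+1)`; these are the kernels of the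
elements of `L(𝓢', 𝓢)`. -/
abbrev Density (d n : ℕ) : Type := 𝓢(X d (n + 1) × X d (n + 1), ℂ)

/-- Tempered distributions on `(ℝ^d)^(n+1) × (ℝ^d)^(n+1)`; these are the Schwartz kernels of the
elements of `L(𝓢, 𝓢')`. The kernel `K` and its operator `A` determine each other through
`⟨A f, g⟩ = K (g ⊗ f)`, where `(g ⊗ f)(x, x') = g(x) f(x')`. -/
abbrev Ker (d n : ℕ) : Type := Density d n →L[ℂ] ℂ

/-- Transposition of a kernel, `γ^t(x; x') = γ(x'; x)`. -/
def transpose {d n : ℕ} : Density d n →L[ℂ] Density d n :=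
  compCLMOfContinuousLinearEquiv ℂ
    (ContinuousLinearEquiv.prodComm ℝ (X d (n + 1)) (X d (n + 1)))

/-- Relabelling of the particles in a configuration, `x ↦ (x_{π 1}, …, x_{π k})`. -/
def relabel {d m : ℕ} (π : Equiv.Perm (Fin m)) : X d m ≃L[ℝ] X d m :=
  (LinearEquiv.funCongrLeft ℝ (E d) π).toContinuousLinearEquiv

/-- The action `Θ(x; x') ↦ Θ(x ∘ π; x' ∘ σ)` of a pair of permutations on kernels. -/
def permAct {d n : ℕ} (π σ : Equiv.Perm (Fin (n + 1))) : Density d n →L[ℂ] Density d n :=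
  compCLMOfContinuousLinearEquiv ℂ ((relabel (d := d) π).prodCongr (relabel (d := d) σ))

/-- The generalized trace `Tr (A γ) = ⟨K_A, γ^t⟩`. -/
def trace {d n : ℕ} (K : Ker d n) (γ : Density d n) : ℂ := K (transpose γ)

/-! ### Observable hierarchies -/

/-- `K` is the kernel of an operator from bosonic Schwartz functions to bosonic tempered
distributions (such an operator `A` being identified with its extension `A ∘ Sym`): the kernel is
invariant under permutations of each of its two groups of variables. -/
def IsBosonicKer {d n : ℕ} (K : Ker d n) : Prop :=
  ∀ (π σ : Equiv.Perm (Fin (n + 1))) (Θ : Density d n), K (permAct π σ Θ) = K Θ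

/-- Skew-adjointness `A* = -A`, where `⟨A* g, conj f⟩ = conj ⟨A f, conj g⟩`; in terms of kernels,
`K(x; x') = - conj K(x'; x)`. -/
def IsSkewAdjoint {d n : ℕ} (K : Ker d n) : Prop :=
  ∀ Θ Θ' : Density d n, (∀ x x', Θ' (x, x') = starRingEnd ℂ (Θ (x', x))) →
    K Θ' = - starRingEnd ℂ (K Θ)

/-- The good mapping property. For every particle label `α`, the distribution in `u ∈ ℝ^d`
depending on the parameter `y ∈ ℝ^d`
`∫ (A f)(x_1, …, u, …, x_k) g(x_1, …, y, …, x_k) dx_1 … dx_{α-1} dx_{α+1} … dx_k`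
is given by a Schwartz function `Φ f g` of `(u, y) ∈ ℝ^d × ℝ^d` which depends bilinearly and
continuously on `(f, g)`. The pairing of this distribution with a test function `φ` is the value
of the kernel on the function `(v, w) ↦ φ(v_α) g(v_1, …, y, …, v_k) f(w)`, which is always a
Schwartz function; it is called `Θ` below. -/
def GoodMapping {d n : ℕ} (K : Ker d n) : Prop :=
  ∀ α : Fin (n + 1),
    ∃ Φ : 𝓢(X d (n + 1), ℂ) →ₗ[ℂ] 𝓢(X d (n + 1), ℂ) →ₗ[ℂ] 𝓢(E d × E d, ℂ),
      Continuous (fun p : 𝓢(X d (n + 1), ℂ) × 𝓢(X d (n + 1), ℂ) => Φ p.1 p.2) ∧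
      ∀ (f g : 𝓢(X d (n + 1), ℂ)) (φ : 𝓢(E d, ℂ)) (y : E d) (Θ : Density d n),
        (∀ v w, Θ (v, w) = φ (v α) * g (Function.update v α y) * f w) →
        K Θ = ∫ u, Φ f g (u, y) * φ u

/-- The elements of `𝔊_∞`: finite sequences of skew-adjoint bosonic operators in `L(𝓢_s, 𝓢_s')`
with the good mapping property. -/
def IsObservable {d : ℕ} (A : ∀ n, Ker d n) : Prop :=
  {n | A n ≠ 0}.Finite ∧ ∀ n, IsBosonicKer (A n) ∧ IsSkewAdjoint (A n) ∧ GoodMapping (A n)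

/-- The trace `Tr (A · Γ) = ∑_k Tr (A^(k) γ^(k))` of a finite sequence `A` against a
hierarchy `Γ`. -/
def hierTrace {d : ℕ} (A : ∀ n, Ker d n) (Γ : ∀ n, Density d n) : ℂ :=
  ∑ᶠ n, trace (A n) (Γ n)

/-! ### The Lie bracket of observable hierarchies -/

/-- The configuration `(x, z)` of `n + 1` particles, where `x` has `a + 1` particles, `z` has `b`
particles and `n = a + b`. -/
def join {d a b n : ℕ} (h : a + b = n) (x : X d (a + 1)) (z : X d b) : X d (n + 1) :=
  fun i => Fin.append x z (Fin.cast (by omega) i)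

/-- `Φ` is the function `Φ_{B,α,β}(f, g)` of `(x; x') ∈ (ℝ^d)^(a+1) × (ℝ^d)^(a+1)`,
`Φ(x; x') = ∫ (B_{(α, a+2, …, a+b+1)} f)(x, z) g(x', z) dz`,
in which the distribution-valued operator `B` acts on the `α`-th variable (through its own
`β`-th variable) and on the last `b` variables. As the good mapping property of `B` shows, this
distribution in `x_α` is a function; the equality is tested against `φ(x_α)`. -/
def IsSymbol {d a b n : ℕ} (h : a + b = n) (B : Ker d b) (α : Fin (a + 1)) (β : Fin (b + 1))
    (f g : 𝓢(X d (n + 1), ℂ)) (Φ : Density d a) : Prop :=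
  ∀ (φ : 𝓢(E d, ℂ)) (x x' : X d (a + 1)) (Θ : Density d b),
    (∀ v w, Θ (v, w) = φ (v β) * g (join h x' (β.removeNth v)) *
      f (join h (Function.update x α (w β)) (β.removeNth w))) →
    B Θ = ∫ u, Φ (Function.update x α u, x') * φ u

/-- `C` is the kernel of the contraction `A ∘_α^β B`:
`⟨(A ∘_α^β B) f, g⟩ = ⟨K_A, Φ_{B,α,β}(f, g)^t⟩` for all Schwartz functions `f` and `g`. (When `B`
has the good mapping property, there is exactly one `Φ` for given `f` and `g`.) -/
def IsContraction {d a b n : ℕ} (h : a + b = n) (A : Ker d a) (B : Ker d b)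
    (α : Fin (a + 1)) (β : Fin (b + 1)) (C : Ker d n) : Prop :=
  ∀ (f g : 𝓢(X d (n + 1), ℂ)) (Φ : Density d a), IsSymbol h B α β f g Φ →
    ∀ Θ : Density d n, (∀ x x', Θ (x, x') = g x * f x') → C Θ = A (transpose Φ)

open Classical in
/-- The contraction `A ∘_α^β B` (it exists, uniquely, when `B` has the good mapping property). -/
def contraction {d a b n : ℕ} (h : a + b = n) (A : Ker d a) (B : Ker d b)
    (α : Fin (a + 1)) (β : Fin (b + 1)) : Ker d n :=
  if hC : ∃ C, IsContraction h A B α β C then hC.choose else 0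

/-- `[A, B]_1 = ∑_{α, β} (A ∘_α^β B - B ∘_β^α A)`. -/
def oneBracket {d a b n : ℕ} (h : a + b = n) (A : Ker d a) (B : Ker d b) : Ker d n :=
  ∑ α : Fin (a + 1), ∑ β : Fin (b + 1),
    (contraction h A B α β - contraction ((Nat.add_comm b a).trans h) B A β α)

/-- The symmetrization `Sym_k (C) = (1/k!) ∑_π C_(π(1), …, π(k))`, as an operator from bosonic
Schwartz functions to bosonic tempered distributions: it is the operator `Sym_k ∘ C ∘ Sym_k`,
whose kernel is averaged over the permutations of both groups of variables. -/
def symmetrize {d n : ℕ} (C : Ker d n) : Ker d n :=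
  (((n + 1).factorial : ℂ)⁻¹ ^ 2) •
    ∑ π : Equiv.Perm (Fin (n + 1)), ∑ σ : Equiv.Perm (Fin (n + 1)), C.comp (permAct π σ)

/-- The bracket of `𝔊_∞`: `[A, B]^(k) = Sym_k (∑_{ℓ + j - 1 = k} [A^(ℓ), B^(j)]_1)`. -/
def lieBracket {d : ℕ} (A B : ∀ n, Ker d n) : ∀ n, Ker d n := fun n =>
  symmetrize (∑ i : Fin (n + 1), oneBracket (Nat.add_sub_of_le i.is_le) (A i) (B (n - i)))

/-! ### Density matrix hierarchies -/

/-- The real topological vector space `𝔊_∞^*` of density matrix hierarchies: sequences of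
self-adjoint operators with Schwartz kernels that are invariant under permutations of `x` and,
separately, of `x'`. It carries the product topology. -/
def DensityHierarchy (d : ℕ) : Submodule ℝ (∀ n, Density d n) where
  carrier := {Γ | ∀ n, (∀ π σ, permAct π σ (Γ n) = Γ n) ∧
    ∀ x x', Γ n (x, x') = starRingEnd ℂ (Γ n (x', x))}
  add_mem' := by
    intro Γ Γ' h h' n
    refine ⟨fun π σ => ?_, fun x x' => ?_⟩
    · simp [(h n).1 π σ, (h' n).1 π σ]
    · simp only [Pi.add_apply, add_apply, map_add]
      rw [(h n).2 x x', (h' n).2 x x']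
  zero_mem' := by
    intro n
    exact ⟨fun π σ => by simp, fun x x' => by simp⟩
  smul_mem' := by
    intro c Γ h n
    refine ⟨fun π σ => ?_, fun x x' => ?_⟩
    · rw [Pi.smul_apply, ← Complex.coe_smul, map_smul, (h n).1 π σ]
    · simp only [Pi.smul_apply, smul_apply, Complex.real_smul, map_mul,
        Complex.conj_ofReal]
      rw [(h n).2 x x']

/-! ### The weak Lie–Poisson structure -/

/-- The algebra `𝒜_∞` of real functionals on `𝔊_∞^*` generated, under pointwise operations, by the
constants and the trace functionals `Γ ↦ i Tr (A · Γ)`, `A ∈ 𝔊_∞`. (A subalgebra contains the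
constants, and trace functionals are continuous and linear, hence smooth.) -/
def admissible (d : ℕ) : Subalgebra ℝ (DensityHierarchy d → ℝ) :=
  Algebra.adjoin ℝ {F | ∃ A : ∀ n, Ker d n, IsObservable A ∧
    ∀ Γ : DensityHierarchy d, (F Γ : ℂ) = Complex.I * hierTrace A Γ.1}

open Classical in
/-- The Gâteaux derivative `dF[Γ]`, identified with an observable hierarchy through the trace
pairing: `dF[Γ](v) = i Tr (dF[Γ] · v)` for all `v ∈ 𝔊_∞^*`. For `F ∈ 𝒜_∞` there is exactly one
such hierarchy. -/
def gradient {d : ℕ} (F : DensityHierarchy d → ℝ) (Γ : DensityHierarchy d) : ∀ n, Ker d n :=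
  if h : ∃ A : ∀ n, Ker d n, IsObservable A ∧
      ∀ v : DensityHierarchy d, ((lineDeriv ℝ F Γ v : ℝ) : ℂ) = Complex.I * hierTrace A v.1
    then h.choose else 0

/-- The Lie–Poisson bracket `{F, G}(Γ) = i Tr ([dF[Γ], dG[Γ]] · Γ)` for `F, G ∈ 𝒜_∞`. -/
def poissonBracket {d : ℕ} (F G : DensityHierarchy d → ℝ) (Γ : DensityHierarchy d) : ℂ :=
  Complex.I * hierTrace (lieBracket (gradient F Γ) (gradient G Γ)) Γ.1

/-- Smoothness in the sense of Gâteaux of a map between real topological vector spaces: the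
iterated directional derivatives `D r x (v_1, …, v_r)` of all orders exist and are jointly
continuous. -/
def GateauxSmooth {V W : Type*} [AddCommGroup V] [Module ℝ V] [TopologicalSpace V]
    [AddCommGroup W] [Module ℝ W] [TopologicalSpace W] (f : V → W) : Prop :=
  ∃ D : ∀ r : ℕ, V → (Fin r → V) → W, (∀ x v, D 0 x v = f x) ∧
    (∀ r, Continuous fun p : V × (Fin r → V) => D r p.1 p.2) ∧
    ∀ (r : ℕ) (x : V) (v : Fin r → V) (w : V),
      Tendsto (fun t : ℝ => t⁻¹ • (D r (x + t • w) v - D r x v)) (𝓝[≠] 0)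
        (𝓝 (D (r + 1) x (Fin.snoc v w)))

/-- `Y` is a Hamiltonian vector field of `H` with respect to the weak Lie–Poisson structure: a
smooth vector field on `𝔊_∞^*` with `dF[Γ](Y(Γ)) = {F, H}(Γ)` for all `F ∈ 𝒜_∞`. -/
def IsHamiltonianVectorField {d : ℕ} (H : DensityHierarchy d → ℝ)
    (Y : DensityHierarchy d → DensityHierarchy d) : Prop :=
  GateauxSmooth Y ∧ ∀ F ∈ admissible d, ∀ Γ,
    ((lineDeriv ℝ F Γ (Y Γ) : ℝ) : ℂ) = poissonBracket F H Γ

/-! ### The Gross–Pitaevskii Hamiltonian -/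

/-- The diagonal embedding `x ↦ ((x, …, x), (x, …, x))`. -/
def diag (d n : ℕ) : E d →L[ℝ] X d (n + 1) × X d (n + 1) :=
  (ContinuousLinearMap.pi fun _ => ContinuousLinearMap.id ℝ (E d)).prod
    (ContinuousLinearMap.pi fun _ => ContinuousLinearMap.id ℝ (E d))

theorem antilipschitz_diag (d n : ℕ) : AntilipschitzWith 1 (diag d n) := by
  refine AddMonoidHomClass.antilipschitz_of_bound (diag d n) fun x => ?_
  have h1 : ‖(diag d n x).1‖ ≤ ‖diag d n x‖ := norm_fst_le _
  have h2 : ‖(diag d n x).1 0‖ ≤ ‖(diag d n x).1‖ := norm_le_pi_norm _ _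
  rw [NNReal.coe_one, one_mul]
  exact h2.trans h1

/-- `Θ ↦ ∫ Θ(x, …, x; x, …, x) dx`. -/
def diagIntegral (d n : ℕ) : Ker d n :=
  (integralCLM ℂ (volume : Measure (E d))).comp
    (compCLMOfAntilipschitz ℂ (diag d n).hasTemperateGrowth (antilipschitz_diag d n))

/-- The `i`-th coordinate direction of the variable `x'` of a one-particle kernel `Θ(x; x')`. -/
def inputDir (d : ℕ) (i : Fin d) : X d (0 + 1) × X d (0 + 1) :=
  (0, fun _ => EuclideanSpace.single i 1)

/-- The kernel of the one-particle operator `-Δ`, i.e. `-Δ_{x'} δ(x - x')`, so that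
`⟨-Δ f, g⟩ = - ∫ g(x) (Δ f)(x) dx`. -/
def negLaplacian (d : ℕ) : Ker d 0 :=
  - ∑ i : Fin d, (diagIntegral d 0).comp
      (LineDeriv.lineDerivOpCLM ℂ (Density d 0) (inputDir d i) ∘L
        LineDeriv.lineDerivOpCLM ℂ (Density d 0) (inputDir d i))

/-- The kernel of the two-particle multiplication operator `δ(X_1 - X_2)`:
`⟨δ(X_1 - X_2) f, g⟩ = ∫ g(x, x) f(x, x) dx`. -/
def delta (d : ℕ) : Ker d 1 := diagIntegral d 1

/-- `W_GP = (-Δ_{x_1}, κ δ(X_1 - X_2), 0, …)`. -/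
def gpGenerator (d : ℕ) (κ : ℝ) : ∀ n, Ker d n
  | 0 => negLaplacian d
  | 1 => (κ : ℂ) • delta d
  | _ + 2 => 0

/-- The Gross–Pitaevskii Hamiltonian
`H_GP(Γ) = Tr(-Δ γ^(1)) + κ Tr(δ(X_1 - X_2) γ^(2))` (these traces are real on `𝔊_∞^*`). -/
def gpHamiltonian (d : ℕ) (κ : ℝ) (Γ : DensityHierarchy d) : ℝ :=
  (trace (negLaplacian d) (Γ.1 0) + κ * trace (delta d) (Γ.1 1)).re

/-! ### Smooth curves and the Gross–Pitaevskii hierarchy -/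

/-- The curve `Γ` in a topological vector space has derivative `Γ'` at `t` within `I`. -/
def HasCurveDeriv {V : Type*} [AddCommGroup V] [Module ℝ V] [TopologicalSpace V]
    (Γ : ℝ → V) (Γ' : V) (I : Set ℝ) (t : ℝ) : Prop :=
  Tendsto (slope Γ t) (𝓝[I \ {t}] t) (𝓝 Γ')

/-- `Γ ∈ C^∞(I; V)`, with one-sided derivatives at the end points of the interval `I`. -/
def SmoothCurveOn {V : Type*} [AddCommGroup V] [Module ℝ V] [TopologicalSpace V]
    (Γ : ℝ → V) (I : Set ℝ) : Prop :=
  ∃ D : ℕ → ℝ → V, (∀ t ∈ I, D 0 t = Γ t) ∧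
    ∀ r, ∀ t ∈ I, HasCurveDeriv (D r) (D (r + 1) t) I t

open Laplacian in
/-- The kernel of `[Δ_{x_1} + ⋯ + Δ_{x_k}, γ^(k)]`, that is
`∑_j (Δ_{x_j} - Δ_{x_j'}) γ^(k)(x; x')`. -/
def laplaceCommutator {d n : ℕ} (γ : Density d n) (x x' : X d (n + 1)) : ℂ :=
  ∑ j : Fin (n + 1),
    ((Δ fun y : E d => γ (Function.update x j y, x')) (x j) -
      (Δ fun y : E d => γ (x, Function.update x' j y)) (x' j))

/-- The kernel of `B_{k+1} γ^(k+1) = ∑_j (B_{j;k+1}^+ - B_{j;k+1}^-) γ^(k+1)`, where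
`(B_{j;k+1}^+ γ)(x; x') = γ(x, x_j; x', x_j)` and `(B_{j;k+1}^- γ)(x; x') = γ(x, x_j'; x', x_j')`. -/
def collision {d n : ℕ} (γ : Density d (n + 1)) (x x' : X d (n + 1)) : ℂ :=
  ∑ j : Fin (n + 1),
    (γ ((Fin.snoc x (x j) : X d (n + 2)), (Fin.snoc x' (x j) : X d (n + 2))) -
      γ ((Fin.snoc x (x' j) : X d (n + 2)), (Fin.snoc x' (x' j) : X d (n + 2))))

/-- `Γ` solves the Gross–Pitaevskii hierarchy
`i ∂_t γ^(k) = -[Δ_{x_1} + ⋯ + Δ_{x_k}, γ^(k)] + 2 κ B_{k+1} γ^(k+1)`, `k ≥ 1`, on `I`. -/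
def SolvesGP {d : ℕ} (κ : ℝ) (I : Set ℝ) (Γ : ℝ → DensityHierarchy d) : Prop :=
  ∀ t ∈ I, ∀ (n : ℕ) (x x' : X d (n + 1)),
    HasDerivWithinAt (fun s => Complex.I * (Γ s).1 n (x, x'))
      (- laplaceCommutator ((Γ t).1 n) x x' + 2 * κ * collision ((Γ t).1 (n + 1)) x x') I t

end GPHierarchy

end

/-!
The contraction `A ∘_α^β B` is determined by the partial kernels of `B` provided by the good mapping
property, because finite sums of tensors are dense in Schwartz space. This gives closed formulas for
the contractions with `-Δ` and with `δ(X_1 - X_2)`, on either side: the former differentiates in one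
variable, the latter restricts to a diagonal. On a kernel that is symmetric in each group of
variables, summing these formulas over `α` and `β` turns `i Tr ([A, -i W_GP] · Γ)` into
`i Tr (A · Y(Γ))`, where `Y` is the right-hand side of the hierarchy. So `Y`, which is linear and
continuous, is a Hamiltonian vector field. It is the only one since the observables contain the
Hilbert–Schmidt operators `i η`, and `Tr (i η η)` is nonzero when `η` is a nonzero self-adjoint
kernel.
-/

noncomputable section

namespace GPHierarchy

section

open scoped ContDiff

/-! ### Seminorms on Schwartz spaces -/

section Seminorms

variable {V W U F G H : Type*} [NormedAddCommGroup V] [NormedSpace ℝ V]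
  [NormedAddCommGroup W] [NormedSpace ℝ W] [NormedAddCommGroup U] [NormedSpace ℝ U]
  [NormedAddCommGroup F] [NormedSpace ℝ F] [NormedSpace ℂ F] [SMulCommClass ℝ ℂ F]
  [NormedAddCommGroup G] [NormedSpace ℝ G] [NormedSpace ℂ G] [SMulCommClass ℝ ℂ G]
  [NormedAddCommGroup H] [NormedSpace ℝ H] [NormedSpace ℂ H] [SMulCommClass ℝ ℂ H]

/-- The largest of the Schwartz seminorms with both indices at most `m`. These seminorms increase
with `m` and define the topology, so that a single index controls every estimate. -/
def supSeminorm (m : ℕ) : Seminorm ℂ 𝓢(V, F) :=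
  (Finset.Iic (m, m)).sup (schwartzSeminormFamily ℂ V F)

theorem seminorm_le_supSeminorm {k n m : ℕ} (hk : k ≤ m) (hn : n ≤ m) (f : 𝓢(V, F)) :
    SchwartzMap.seminorm ℂ k n f ≤ supSeminorm m f :=
  (Finset.le_sup (f := schwartzSeminormFamily ℂ V F)
    (Finset.mem_Iic.2 (Prod.mk_le_mk.2 ⟨hk, hn⟩)) :
      schwartzSeminormFamily ℂ V F (k, n) ≤ supSeminorm m) f

theorem supSeminorm_le {m : ℕ} {f : 𝓢(V, F)} {C : ℝ} (hC : 0 ≤ C)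
    (h : ∀ k n, k ≤ m → n ≤ m → SchwartzMap.seminorm ℂ k n f ≤ C) : supSeminorm m f ≤ C :=
  Seminorm.finset_sup_apply_le hC fun i hi =>
    have hi := Prod.mk_le_mk.1 (Finset.mem_Iic.1 hi)
    h i.1 i.2 hi.1 hi.2

theorem supSeminorm_mono {m m' : ℕ} (h : m ≤ m') (f : 𝓢(V, F)) :
    supSeminorm m f ≤ supSeminorm m' f :=
  supSeminorm_le (apply_nonneg _ _) fun _ _ hk hn =>
    seminorm_le_supSeminorm (hk.trans h) (hn.trans h) f

theorem exists_finset_sup_le_supSeminorm (s : Finset (ℕ × ℕ)) :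
    ∃ m, ∀ f : 𝓢(V, F), s.sup (schwartzSeminormFamily ℂ V F) f ≤ supSeminorm m f := by
  refine ⟨s.sup fun i => max i.1 i.2, fun f => ?_⟩
  refine Seminorm.finset_sup_apply_le (apply_nonneg _ _) fun i hi => ?_
  have h := Finset.le_sup (f := fun i : ℕ × ℕ => max i.1 i.2) hi
  exact seminorm_le_supSeminorm ((le_max_left _ _).trans h) ((le_max_right _ _).trans h) f

theorem continuous_supSeminorm (m : ℕ) :
    Continuous (supSeminorm m : Seminorm ℂ 𝓢(V, F)) :=
  Seminorm.continuous' (r := 1) <| ((schwartz_withSeminorms ℂ V F).mem_nhds_iff _ _).2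
    ⟨Finset.Iic (m, m), 1, one_pos, Seminorm.ball_subset_closedBall _ _ _⟩

theorem mem_nhds_zero_iff_supSeminorm {s : Set 𝓢(V, F)} :
    s ∈ 𝓝 (0 : 𝓢(V, F)) ↔ ∃ m, ∃ r > 0, ∀ f, supSeminorm m f < r → f ∈ s := by
  rw [(schwartz_withSeminorms ℂ V F).mem_nhds_iff]
  constructor
  · rintro ⟨t, r, hr, h⟩
    obtain ⟨m, hm⟩ := exists_finset_sup_le_supSeminorm (V := V) (F := F) t
    refine ⟨m, r, hr, fun f hf => h ?_⟩
    rw [Seminorm.mem_ball_zero]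
    exact (hm f).trans_lt hf
  · rintro ⟨m, r, hr, h⟩
    refine ⟨Finset.Iic (m, m), r, hr, fun f hf => h f ?_⟩
    rwa [Seminorm.mem_ball_zero] at hf

theorem exists_le_supSeminorm (q : Seminorm ℂ 𝓢(V, F)) (hq : Continuous q) :
    ∃ m, ∃ C, 0 ≤ C ∧ ∀ f, q f ≤ C * supSeminorm m f := by
  obtain ⟨s, C, -, h⟩ := Seminorm.bound_of_continuous (schwartz_withSeminorms ℂ V F) q hq
  obtain ⟨m, hm⟩ := exists_finset_sup_le_supSeminorm (V := V) (F := F) s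
  exact ⟨m, C, C.2, fun f => (h f).trans (mul_le_mul_of_nonneg_left (hm f) C.2)⟩

theorem exists_norm_le_supSeminorm {G : Type*} [NormedAddCommGroup G] [NormedSpace ℂ G]
    (T : 𝓢(V, F) →L[ℂ] G) : ∃ m, ∃ C, 0 ≤ C ∧ ∀ f, ‖T f‖ ≤ C * supSeminorm m f :=
  exists_le_supSeminorm ((normSeminorm ℂ G).comp T.toLinearMap) (continuous_norm.comp T.continuous)

theorem tendsto_nhds_iff_supSeminorm {X : Type*} {l : Filter X} {u : X → 𝓢(V, F)} {f : 𝓢(V, F)} :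
    Tendsto u l (𝓝 f) ↔ ∀ m, Tendsto (fun x => supSeminorm m (u x - f)) l (𝓝 0) := by
  refine ⟨fun h m => ?_, fun h => ?_⟩
  · simpa [Function.comp_def] using ((continuous_supSeminorm m).tendsto _).comp (h.sub_const f)
  · rw [← tendsto_sub_nhds_zero_iff]
    refine tendsto_def.2 fun s hs => ?_
    obtain ⟨m, r, hr, hm⟩ := mem_nhds_zero_iff_supSeminorm.1 hs
    filter_upwards [(h m).eventually (gt_mem_nhds hr)] with x hx using hm _ hx

theorem le_mul_of_forall_lt_imp_le {M : Type*} [AddCommGroup M] [Module ℂ M]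
    (p q : Seminorm ℂ M) {r c : ℝ} (hr : 0 < r) (h : ∀ f, p f < r → q f ≤ c) (f : M) :
    q f ≤ c * r⁻¹ * p f := by
  have hscaled : ∀ a ∈ Set.Ioi (p f), q f ≤ c * r⁻¹ * a := by
    intro a ha
    have ha0 : 0 < a := (apply_nonneg p f).trans_lt ha
    have hnorm : ‖((r / a : ℝ) : ℂ)‖ = r / a := by
      rw [Complex.norm_real, Real.norm_of_nonneg (by positivity)]
    have := h (((r / a : ℝ) : ℂ) • f) <| by
      rw [map_smul_eq_mul, hnorm, div_mul_eq_mul_div, div_lt_iff₀ ha0]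
      exact mul_lt_mul_of_pos_left ha hr
    rw [map_smul_eq_mul, hnorm, ← le_div_iff₀' (by positivity)] at this
    exact this.trans_eq (by field_simp)
  exact ge_of_tendsto (((continuous_const_mul _).tendsto (p f)).mono_left nhdsWithin_le_nhds)
    (eventually_mem_nhdsWithin.mono hscaled)

theorem exists_bilin_supSeminorm_le (B : 𝓢(V, F) →ₗ[ℂ] 𝓢(W, G) →ₗ[ℂ] 𝓢(U, H))
    (hB : Continuous fun p : 𝓢(V, F) × 𝓢(W, G) => B p.1 p.2) (m : ℕ) :
    ∃ m', ∃ C, 0 ≤ C ∧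
      ∀ f g, supSeminorm m (B f g) ≤ C * supSeminorm m' f * supSeminorm m' g := by
  have hnhds : {p : 𝓢(V, F) × 𝓢(W, G) | supSeminorm m (B p.1 p.2) < 1} ∈ 𝓝 (0, 0) :=
    (isOpen_lt ((continuous_supSeminorm m).comp hB) continuous_const).mem_nhds (by simp)
  rw [nhds_prod_eq, Filter.mem_prod_iff] at hnhds
  obtain ⟨s, hs, t, ht, hst⟩ := hnhds
  obtain ⟨m₁, r₁, hr₁, hs⟩ := mem_nhds_zero_iff_supSeminorm.1 hs
  obtain ⟨m₂, r₂, hr₂, ht⟩ := mem_nhds_zero_iff_supSeminorm.1 ht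
  refine ⟨max m₁ m₂, 1 * r₁⁻¹ * r₂⁻¹, by positivity, fun f g => ?_⟩
  have hleft : ∀ g, supSeminorm m₂ g < r₂ → ∀ f,
      supSeminorm m (B f g) ≤ 1 * r₁⁻¹ * supSeminorm m₁ f := fun g hg =>
    le_mul_of_forall_lt_imp_le _ ((supSeminorm m).comp (B.flip g)) hr₁ fun f hf =>
      (hst (Set.mk_mem_prod (hs f hf) (ht g hg)) : supSeminorm m (B f g) < 1).le
  calc supSeminorm m (B f g)
      ≤ 1 * r₁⁻¹ * supSeminorm m₁ f * r₂⁻¹ * supSeminorm m₂ g :=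
        le_mul_of_forall_lt_imp_le _ ((supSeminorm m).comp (B f)) hr₂ (fun g hg => hleft g hg f) g
    _ ≤ 1 * r₁⁻¹ * supSeminorm (max m₁ m₂) f * r₂⁻¹ * supSeminorm (max m₁ m₂) g := by
        gcongr
        · exact supSeminorm_mono (le_max_left m₁ m₂) f
        · exact supSeminorm_mono (le_max_right m₁ m₂) g
    _ = _ := by ring

theorem continuous_bilin_of_supSeminorm_le (B : 𝓢(V, F) →ₗ[ℂ] 𝓢(W, G) →ₗ[ℂ] 𝓢(U, H))
    (h : ∀ m, ∃ m', ∃ C, ∀ f g,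
      supSeminorm m (B f g) ≤ C * supSeminorm m' f * supSeminorm m' g) :
    Continuous fun p : 𝓢(V, F) × 𝓢(W, G) => B p.1 p.2 := by
  refine continuous_iff_continuousAt.2 fun ⟨f₀, g₀⟩ => tendsto_nhds_iff_supSeminorm.2 fun m => ?_
  obtain ⟨m', C, hC⟩ := h m
  have hp := continuous_supSeminorm (V := V) (F := F) m'
  have hq := continuous_supSeminorm (V := W) (F := G) m'
  have hlim : Tendsto (fun p : 𝓢(V, F) × 𝓢(W, G) =>
      C * supSeminorm m' (p.1 - f₀) * supSeminorm m' p.2 +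
        C * supSeminorm m' f₀ * supSeminorm m' (p.2 - g₀)) (𝓝 (f₀, g₀)) (𝓝 0) := by
    have : Continuous fun p : 𝓢(V, F) × 𝓢(W, G) =>
        C * supSeminorm m' (p.1 - f₀) * supSeminorm m' p.2 +
          C * supSeminorm m' f₀ * supSeminorm m' (p.2 - g₀) := by fun_prop
    simpa using this.tendsto (f₀, g₀)
  refine squeeze_zero (fun _ => apply_nonneg _ _) (fun p => ?_) hlim
  have hsplit : B p.1 p.2 - B f₀ g₀ = B (p.1 - f₀) p.2 + B f₀ (p.2 - g₀) := by
    simp only [map_sub, LinearMap.sub_apply, sub_add_sub_cancel]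
  calc supSeminorm m (B p.1 p.2 - B f₀ g₀)
      ≤ supSeminorm m (B (p.1 - f₀) p.2) + supSeminorm m (B f₀ (p.2 - g₀)) :=
        hsplit ▸ map_add_le_add _ _ _
    _ ≤ _ := add_le_add (hC _ _) (hC _ _)

theorem one_add_norm_pow_mul_le (f : 𝓢(V, F)) (k n : ℕ) (x : V) :
    (1 + ‖x‖) ^ k * ‖iteratedFDeriv ℝ n f x‖ ≤ 2 ^ k * supSeminorm (max k n) f := by
  refine (one_add_le_sup_seminorm_apply (𝕜 := ℂ) (m := (k, n)) le_rfl le_rfl f x).trans ?_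
  gcongr
  refine Seminorm.finset_sup_apply_le (apply_nonneg _ _) fun i hi => ?_
  have hi := Prod.mk_le_mk.1 (Finset.mem_Iic.1 hi)
  exact seminorm_le_supSeminorm (hi.1.trans (le_max_left _ _)) (hi.2.trans (le_max_right _ _)) f

theorem one_add_norm_pow_mul_apply_le (f : 𝓢(V, F)) (k : ℕ) (x : V) :
    (1 + ‖x‖) ^ k * ‖f x‖ ≤ 2 ^ k * supSeminorm k f := by
  simpa using one_add_norm_pow_mul_le f k 0 x

end Seminorms

/-! ### Tensor products of Schwartz functions -/

section Tensor

variable {V W F : Type*} [NormedAddCommGroup V] [NormedSpace ℝ V]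
  [NormedAddCommGroup W] [NormedSpace ℝ W] [NormedAddCommGroup F] [NormedSpace ℝ F]

theorem norm_iteratedFDeriv_comp_clm_le {a : W → F} (ha : ContDiff ℝ ∞ a) {L : V →L[ℝ] W}
    (hL : ‖L‖ ≤ 1) (n : ℕ) (z : V) :
    ‖iteratedFDeriv ℝ n (fun z => a (L z)) z‖ ≤ ‖iteratedFDeriv ℝ n a (L z)‖ := by
  change ‖iteratedFDeriv ℝ n (a ∘ L) z‖ ≤ _
  rw [L.iteratedFDeriv_comp_right (i := n) ha z (mod_cast le_top)]
  refine (ContinuousMultilinearMap.norm_compContinuousLinearMap_le _ _).trans ?_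
  exact mul_le_of_le_one_right (norm_nonneg _)
    (Finset.prod_le_one (fun _ _ => norm_nonneg _) fun _ _ => hL)

theorem norm_pow_le_add {V W : Type*} [NormedAddCommGroup V] [NormedAddCommGroup W]
    (z : V × W) (k : ℕ) : ‖z‖ ^ k ≤ ‖z.1‖ ^ k + ‖z.2‖ ^ k := by
  rcases le_total ‖z.1‖ ‖z.2‖ with h | h
  · rw [Prod.norm_def, max_eq_right h]
    exact le_add_of_nonneg_left (by positivity)
  · rw [Prod.norm_def, max_eq_left h]
    exact le_add_of_nonneg_right (by positivity)

theorem norm_pow_mul_norm_iteratedFDeriv_mul_le (a : 𝓢(V, ℂ)) (b : 𝓢(W, ℂ)) {k i j m : ℕ}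
    (hk : k ≤ m) (hi : i ≤ m) (hj : j ≤ m) (z : V × W) :
    ‖z‖ ^ k * (‖iteratedFDeriv ℝ i a z.1‖ * ‖iteratedFDeriv ℝ j b z.2‖) ≤
      2 * supSeminorm m a * supSeminorm m b := by
  have ha := (norm_iteratedFDeriv_le_seminorm ℂ a i z.1).trans
    (seminorm_le_supSeminorm (Nat.zero_le m) hi a)
  have hka := (le_seminorm ℂ k i a z.1).trans (seminorm_le_supSeminorm hk hi a)
  have hb := (norm_iteratedFDeriv_le_seminorm ℂ b j z.2).trans
    (seminorm_le_supSeminorm (Nat.zero_le m) hj b)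
  have hkb := (le_seminorm ℂ k j b z.2).trans (seminorm_le_supSeminorm hk hj b)
  calc _ ≤ (‖z.1‖ ^ k + ‖z.2‖ ^ k) *
        (‖iteratedFDeriv ℝ i a z.1‖ * ‖iteratedFDeriv ℝ j b z.2‖) := by
        gcongr
        exact norm_pow_le_add z k
    _ = ‖z.1‖ ^ k * ‖iteratedFDeriv ℝ i a z.1‖ * ‖iteratedFDeriv ℝ j b z.2‖ +
        ‖iteratedFDeriv ℝ i a z.1‖ * (‖z.2‖ ^ k * ‖iteratedFDeriv ℝ j b z.2‖) := by ring
    _ ≤ supSeminorm m a * supSeminorm m b + supSeminorm m a * supSeminorm m b := by gcongr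
    _ = _ := by ring

theorem norm_pow_mul_iteratedFDeriv_tensor_le (a : 𝓢(V, ℂ)) (b : 𝓢(W, ℂ)) {k n m : ℕ}
    (hk : k ≤ m) (hn : n ≤ m) (z : V × W) :
    ‖z‖ ^ k * ‖iteratedFDeriv ℝ n (fun z : V × W => a z.1 * b z.2) z‖ ≤
      2 ^ n * (2 * supSeminorm m a * supSeminorm m b) := by
  calc _ ≤ ‖z‖ ^ k * ∑ i ∈ Finset.range (n + 1),
        (n.choose i : ℝ) * ‖iteratedFDeriv ℝ i (fun z : V × W => a z.1) z‖ *
          ‖iteratedFDeriv ℝ (n - i) (fun z : V × W => b z.2) z‖ := by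
        gcongr
        exact norm_iteratedFDeriv_mul_le ((a.smooth ⊤).comp contDiff_fst)
          ((b.smooth ⊤).comp contDiff_snd) z (mod_cast le_top)
    _ ≤ ‖z‖ ^ k * ∑ i ∈ Finset.range (n + 1), (n.choose i : ℝ) *
          ‖iteratedFDeriv ℝ i a z.1‖ * ‖iteratedFDeriv ℝ (n - i) b z.2‖ := by
        gcongr with i
        · exact norm_iteratedFDeriv_comp_clm_le (a.smooth ⊤)
            (ContinuousLinearMap.norm_fst_le ℝ V W) i z
        · exact norm_iteratedFDeriv_comp_clm_le (b.smooth ⊤)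
            (ContinuousLinearMap.norm_snd_le ℝ V W) (n - i) z
    _ = ∑ i ∈ Finset.range (n + 1), (n.choose i : ℝ) *
          (‖z‖ ^ k * (‖iteratedFDeriv ℝ i a z.1‖ * ‖iteratedFDeriv ℝ (n - i) b z.2‖)) := by
        rw [Finset.mul_sum]
        exact Finset.sum_congr rfl fun i _ => by ring
    _ ≤ ∑ i ∈ Finset.range (n + 1), (n.choose i : ℝ) *
          (2 * supSeminorm m a * supSeminorm m b) := by
        refine Finset.sum_le_sum fun i hi => mul_le_mul_of_nonneg_left ?_ (Nat.cast_nonneg _)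
        exact norm_pow_mul_norm_iteratedFDeriv_mul_le a b hk
          ((Finset.mem_range_succ_iff.1 hi).trans hn) ((Nat.sub_le _ _).trans hn) z
    _ = _ := by
        rw [← Finset.sum_mul]
        congr 1
        exact_mod_cast Nat.sum_range_choose n

/-- The tensor product `(a ⊗ b)(v, w) = a(v) b(w)` of Schwartz functions. -/
def tensor : 𝓢(V, ℂ) →ₗ[ℂ] 𝓢(W, ℂ) →ₗ[ℂ] 𝓢(V × W, ℂ) :=
  LinearMap.mk₂ ℂ
    (fun a b =>
      { toFun := fun z => a z.1 * b z.2
        smooth' := ((a.smooth ⊤).comp contDiff_fst).mul ((b.smooth ⊤).comp contDiff_snd)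
        decay' := fun _ _ => ⟨_, fun z =>
          norm_pow_mul_iteratedFDeriv_tensor_le a b (le_max_left _ _) (le_max_right _ _) z⟩ })
    (fun a a' b => by ext z; exact add_mul _ _ _)
    (fun c a b => by ext z; exact mul_assoc _ _ _)
    (fun a b b' => by ext z; exact mul_add _ _ _)
    (fun c a b => by ext z; exact mul_left_comm _ _ _)

@[simp]
theorem tensor_apply (a : 𝓢(V, ℂ)) (b : 𝓢(W, ℂ)) (z : V × W) : tensor a b z = a z.1 * b z.2 := rfl

theorem supSeminorm_tensor_le (m : ℕ) (a : 𝓢(V, ℂ)) (b : 𝓢(W, ℂ)) :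
    supSeminorm m (tensor a b) ≤ 2 ^ m * 2 * supSeminorm m a * supSeminorm m b := by
  refine supSeminorm_le (by positivity) fun k n hk hn => ?_
  refine SchwartzMap.seminorm_le_bound ℂ k n _ (by positivity) fun z => ?_
  calc _ ≤ 2 ^ n * (2 * supSeminorm m a * supSeminorm m b) :=
        norm_pow_mul_iteratedFDeriv_tensor_le a b hk hn z
    _ ≤ 2 ^ m * (2 * supSeminorm m a * supSeminorm m b) := by
        gcongr
        exact one_le_two
    _ = _ := by ring

theorem continuous_tensor : Continuous fun p : 𝓢(V, ℂ) × 𝓢(W, ℂ) => tensor p.1 p.2 :=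
  continuous_bilin_of_supSeminorm_le tensor fun m =>
    ⟨m, _, fun a b => supSeminorm_tensor_le m a b⟩

/-- Tensor product with a fixed first factor. -/
def tensorLeft (a : 𝓢(V, ℂ)) : 𝓢(W, ℂ) →L[ℂ] 𝓢(V × W, ℂ) :=
  ⟨tensor a, continuous_tensor.comp (Continuous.prodMk_right a)⟩

/-- Tensor product with a fixed second factor. -/
def tensorRight (b : 𝓢(W, ℂ)) : 𝓢(V, ℂ) →L[ℂ] 𝓢(V × W, ℂ) :=
  ⟨tensor.flip b, continuous_tensor.comp (Continuous.prodMk_left b)⟩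

end Tensor

end

section

open scoped ContDiff BoundedContinuousFunction

/-! ### Slices and partial integrals of Schwartz functions -/

section Slice

variable {P V F : Type*} [NormedAddCommGroup P] [NormedSpace ℝ P]
  [NormedAddCommGroup V] [NormedSpace ℝ V]
  [NormedAddCommGroup F] [NormedSpace ℝ F] [NormedSpace ℂ F] [SMulCommClass ℝ ℂ F]

theorem hasTemperateGrowth_prodMk_left (p : P) :
    Function.HasTemperateGrowth fun v : V => (p, v) := by
  have : (fun v : V => (p, v)) =
      (fun _ => (p, 0)) + (ContinuousLinearMap.inr ℝ P V : V → P × V) := by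
    ext v <;> simp
  exact this ▸ (Function.HasTemperateGrowth.const _).add (ContinuousLinearMap.hasTemperateGrowth _)

/-- The slice `v ↦ H(p, v)` of a Schwartz function `H` on a product. -/
def slice (p : P) : 𝓢(P × V, F) →L[ℂ] 𝓢(V, F) :=
  compCLMOfAntilipschitz (K := 1) ℂ (hasTemperateGrowth_prodMk_left p) fun v w => by
    rw [ENNReal.coe_one, one_mul, Prod.edist_eq]
    exact le_max_right _ _

@[simp]
theorem slice_apply (p : P) (H : 𝓢(P × V, F)) (v : V) : slice p H v = H (p, v) := rfl

theorem iteratedFDeriv_slice (p : P) (H : 𝓢(P × V, F)) (n : ℕ) (v : V) :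
    iteratedFDeriv ℝ n (slice p H) v =
      (iteratedFDeriv ℝ n H (p, v)).compContinuousLinearMap
        fun _ => ContinuousLinearMap.inr ℝ P V := by
  have hcomp : (slice p H : V → F) =
      (fun z : P × V => H ((p, 0) + z)) ∘ ContinuousLinearMap.inr ℝ P V := by
    ext v
    simp
  have hsmooth : ContDiff ℝ ∞ fun z : P × V => H ((p, 0) + z) :=
    (H.smooth ⊤).comp (contDiff_const.add contDiff_id)
  rw [hcomp, ContinuousLinearMap.iteratedFDeriv_comp_right (i := n) _ hsmooth v (mod_cast le_top),
    iteratedFDeriv_comp_add_left]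
  simp

theorem norm_compContinuousLinearMap_inr_le {P V F : Type*} [NormedAddCommGroup P]
    [NormedSpace ℝ P] [NormedAddCommGroup V] [NormedSpace ℝ V] [NormedAddCommGroup F]
    [NormedSpace ℝ F] {n : ℕ} (M : ContinuousMultilinearMap ℝ (fun _ : Fin n => P × V) F) :
    ‖M.compContinuousLinearMap fun _ => ContinuousLinearMap.inr ℝ P V‖ ≤ ‖M‖ :=
  (ContinuousMultilinearMap.norm_compContinuousLinearMap_le _ _).trans <|
    mul_le_of_le_one_right (norm_nonneg _) <| Finset.prod_le_one (fun _ _ => norm_nonneg _)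
      fun _ _ => ContinuousLinearMap.norm_inr_le_one _ _ _

theorem continuous_iteratedFDeriv_slice (H : 𝓢(P × V, F)) (n : ℕ) (v : V) :
    Continuous fun p => iteratedFDeriv ℝ n (slice p H) v := by
  simp_rw [iteratedFDeriv_slice]
  exact (ContinuousMultilinearMap.compContinuousLinearMapL
    fun _ : Fin n => ContinuousLinearMap.inr ℝ P V).continuous.comp
    (((H.smooth ⊤).continuous_iteratedFDeriv (mod_cast le_top)).comp (Continuous.prodMk_left v))

theorem one_add_norm_pow_mul_seminorm_slice_le (p : P) (H : 𝓢(P × V, F)) (N k n : ℕ) :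
    (1 + ‖p‖) ^ N * SchwartzMap.seminorm ℂ k n (slice p H) ≤
      2 ^ (N + k) * supSeminorm (max (N + k) n) H := by
  rw [← le_div_iff₀' (by positivity)]
  refine SchwartzMap.seminorm_le_bound ℂ k n _ (by positivity) fun v => ?_
  rw [le_div_iff₀' (by positivity), iteratedFDeriv_slice]
  have hp : ‖p‖ ≤ ‖(p, v)‖ := norm_fst_le (p, v)
  have hv : ‖v‖ ≤ 1 + ‖(p, v)‖ := (norm_snd_le (p, v)).trans (by linarith)
  calc _ ≤ (1 + ‖(p, v)‖) ^ N * ((1 + ‖(p, v)‖) ^ k * ‖iteratedFDeriv ℝ n H (p, v)‖) := by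
        gcongr
        exact norm_compContinuousLinearMap_inr_le _
    _ = (1 + ‖(p, v)‖) ^ (N + k) * ‖iteratedFDeriv ℝ n H (p, v)‖ := by ring
    _ ≤ _ := one_add_norm_pow_mul_le H (N + k) n (p, v)

theorem supSeminorm_slice_le (p : P) (H : 𝓢(P × V, F)) (m : ℕ) :
    supSeminorm m (slice p H) ≤ 2 ^ m * supSeminorm m H := by
  refine supSeminorm_le (by positivity) fun k n hk hn => ?_
  calc _ ≤ 2 ^ k * supSeminorm (max k n) H := by
        simpa using one_add_norm_pow_mul_seminorm_slice_le p H 0 k n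
    _ ≤ 2 ^ m * supSeminorm m H := by
        gcongr
        exacts [one_le_two, supSeminorm_mono (max_le hk hn) H]

theorem seminorm_slice_le_rpow (p : P) (H : 𝓢(P × V, F)) (N k n : ℕ) :
    SchwartzMap.seminorm ℂ k n (slice p H) ≤
      2 ^ (N + k) * supSeminorm (max (N + k) n) H * (1 + ‖p‖) ^ (-(N : ℝ)) := by
  rw [Real.rpow_neg (by positivity), Real.rpow_natCast, ← div_eq_mul_inv,
    le_div_iff₀' (by positivity)]
  exact one_add_norm_pow_mul_seminorm_slice_le p H N k n

theorem norm_iteratedFDeriv_slice_le_rpow (p : P) (H : 𝓢(P × V, F)) (N n : ℕ) (v : V) :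
    ‖iteratedFDeriv ℝ n (slice p H) v‖ ≤
      2 ^ N * supSeminorm (max N n) H * (1 + ‖p‖) ^ (-(N : ℝ)) :=
  (norm_iteratedFDeriv_le_seminorm ℂ _ n v).trans (seminorm_slice_le_rpow p H N 0 n)

theorem norm_pow_mul_norm_iteratedFDeriv_sub_le (p q : P) (v : V) (H : 𝓢(P × V, F)) (k n : ℕ) :
    ‖v‖ ^ k * ‖iteratedFDeriv ℝ n H (p, v) - iteratedFDeriv ℝ n H (q, v)‖ ≤
      SchwartzMap.seminorm ℂ k (n + 1) H * ‖p - q‖ := by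
  have hderiv : ∀ s ∈ Set.univ, HasFDerivWithinAt
      (fun s => ‖v‖ ^ k • iteratedFDeriv ℝ n H (s, v))
      (‖v‖ ^ k • (fderiv ℝ (iteratedFDeriv ℝ n H) (s, v)).comp (ContinuousLinearMap.inl ℝ P V))
      Set.univ s := fun s _ =>
    ((((H.smooth ⊤).differentiable_iteratedFDeriv (m := n)
      (mod_cast WithTop.coe_lt_top _)).differentiableAt.hasFDerivAt.comp s
        (hasFDerivAt_prodMk_left s v)).const_smul (‖v‖ ^ k)).hasFDerivWithinAt
  have hbound : ∀ s ∈ Set.univ,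
      ‖‖v‖ ^ k • (fderiv ℝ (iteratedFDeriv ℝ n H) (s, v)).comp (ContinuousLinearMap.inl ℝ P V)‖ ≤
        SchwartzMap.seminorm ℂ k (n + 1) H := fun s _ => by
    calc _ ≤ ‖‖v‖ ^ k‖ * ‖_‖ := ContinuousLinearMap.opNorm_smul_le _ _
      _ ≤ ‖(s, v)‖ ^ k * (‖fderiv ℝ (iteratedFDeriv ℝ n H) (s, v)‖ * 1) := by
          rw [norm_pow, norm_norm]
          gcongr
          · exact norm_snd_le (s, v)
          · refine (ContinuousLinearMap.opNorm_comp_le _ _).trans ?_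
            gcongr
            exact ContinuousLinearMap.norm_inl_le_one _ _ _
      _ ≤ _ := by
          rw [mul_one, norm_fderiv_iteratedFDeriv]
          exact le_seminorm ℂ k (n + 1) H (s, v)
  simpa only [← smul_sub, norm_smul, norm_pow, norm_norm] using
    convex_univ.norm_image_sub_le_of_norm_hasFDerivWithin_le hderiv hbound
      (Set.mem_univ q) (Set.mem_univ p)

theorem seminorm_slice_sub_le (p q : P) (H : 𝓢(P × V, F)) (k n : ℕ) :
    SchwartzMap.seminorm ℂ k n (slice p H - slice q H) ≤
      SchwartzMap.seminorm ℂ k (n + 1) H * ‖p - q‖ := by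
  refine SchwartzMap.seminorm_le_bound ℂ k n _ (by positivity) fun v => ?_
  have hcoe : (⇑(slice p H - slice q H) : V → F) = ⇑(slice p H) - ⇑(slice q H) := by
    ext
    simp
  rw [hcoe, iteratedFDeriv_sub_apply ((slice p H).contDiffAt n) ((slice q H).contDiffAt n),
    iteratedFDeriv_slice, iteratedFDeriv_slice]
  refine le_trans ?_ (norm_pow_mul_norm_iteratedFDeriv_sub_le p q v H k n)
  gcongr
  exact norm_compContinuousLinearMap_inr_le
    (iteratedFDeriv ℝ n H (p, v) - iteratedFDeriv ℝ n H (q, v))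

theorem continuous_slice (H : 𝓢(P × V, F)) : Continuous fun p : P => slice p H := by
  refine continuous_iff_continuousAt.2 fun q =>
    ((schwartz_withSeminorms ℂ V F).tendsto_nhds _ _).2 fun ⟨k, n⟩ ε hε => ?_
  have hlim : Tendsto (fun p : P => SchwartzMap.seminorm ℂ k (n + 1) H * ‖p - q‖) (𝓝 q) (𝓝 0) := by
    have : Continuous fun p : P => SchwartzMap.seminorm ℂ k (n + 1) H * ‖p - q‖ := by fun_prop
    simpa using this.tendsto q
  filter_upwards [hlim.eventually (gt_mem_nhds hε)] with p hp
  exact (seminorm_slice_sub_le p q H k n).trans_lt hp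

end Slice

section ParametricIntegral

variable {α V F : Type*} [MeasurableSpace α] {μ : Measure α}
  [NormedAddCommGroup V] [NormedSpace ℝ V] [NormedAddCommGroup F] [NormedSpace ℝ F]

theorem hasFDerivAt_integral_of_isometryEquiv {G G' : Type*} [NormedAddCommGroup G]
    [NormedSpace ℝ G] [NormedAddCommGroup G'] [NormedSpace ℝ G'] (e : (V →L[ℝ] G) ≃ₗᵢ[ℝ] G')
    {g : α → V → G} {g' : α → V → G'} {b b' : α → ℝ} (hd : ∀ a x, DifferentiableAt ℝ (g a) x)
    (he : ∀ a x, g' a x = e (fderiv ℝ (g a) x))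
    (hm : ∀ x, AEStronglyMeasurable (fun a => g a x) μ)
    (hm' : ∀ x, AEStronglyMeasurable (fun a => g' a x) μ)
    (hb : ∀ a x, ‖g a x‖ ≤ b a) (hb' : ∀ a x, ‖g' a x‖ ≤ b' a)
    (hi : Integrable b μ) (hi' : Integrable b' μ) (x : V) :
    HasFDerivAt (fun x => ∫ a, g a x ∂μ) (e.symm (∫ a, g' a x ∂μ)) x := by
  have hfderiv : ∀ a x, fderiv ℝ (g a) x = e.symm (g' a x) := fun a x => by
    rw [he, LinearIsometryEquiv.symm_apply_apply]
  have hcomm : e.symm (∫ a, g' a x ∂μ) = ∫ a, fderiv ℝ (g a) x ∂μ := by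
    simp_rw [hfderiv]
    exact (e.symm.toContinuousLinearEquiv.integral_comp_comm fun a => g' a x).symm
  rw [hcomm]
  refine hasFDerivAt_integral_of_dominated_of_fderiv_le (s := Set.univ) (bound := b')
    (F := fun x a => g a x) (F' := fun x a => fderiv ℝ (g a) x)
    Filter.univ_mem (.of_forall hm) (hi.mono' (hm x) (.of_forall fun a => hb a x))
    ?_ (.of_forall fun a y _ => ?_) hi' (.of_forall fun a y _ => (hd a y).hasFDerivAt)
  · simp_rw [hfderiv]
    exact e.symm.continuous.comp_aestronglyMeasurable (hm' x)
  · rw [hfderiv, LinearIsometryEquiv.norm_map]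
    exact hb' a y

theorem hasFDerivAt_integral_iteratedFDeriv {f : α → V → F} {b : ℕ → α → ℝ}
    (hf : ∀ a, ContDiff ℝ ∞ (f a))
    (hm : ∀ n x, AEStronglyMeasurable (fun a => iteratedFDeriv ℝ n (f a) x) μ)
    (hb : ∀ n a x, ‖iteratedFDeriv ℝ n (f a) x‖ ≤ b n a) (hi : ∀ n, Integrable (b n) μ)
    (n : ℕ) (x : V) :
    HasFDerivAt (fun x => ∫ a, iteratedFDeriv ℝ n (f a) x ∂μ)
      ((continuousMultilinearCurryLeftEquiv ℝ (fun _ : Fin (n + 1) => V) F)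
        (∫ a, iteratedFDeriv ℝ (n + 1) (f a) x ∂μ)) x := by
  refine hasFDerivAt_integral_of_isometryEquiv
    (continuousMultilinearCurryLeftEquiv ℝ (fun _ : Fin (n + 1) => V) F).symm
    (g := fun a => iteratedFDeriv ℝ n (f a)) (g' := fun a => iteratedFDeriv ℝ (n + 1) (f a))
    (fun a x => ?_) (fun a x => ?_) (hm n) (hm (n + 1)) (hb n) (hb (n + 1)) (hi n) (hi (n + 1)) x
  · exact ((hf a).differentiable_iteratedFDeriv (m := n)
      (mod_cast WithTop.coe_lt_top _)).differentiableAt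
  · rw [iteratedFDeriv_succ_eq_comp_left, Function.comp_apply]

theorem iteratedFDeriv_integral {f : α → V → F} {b : ℕ → α → ℝ}
    (hf : ∀ a, ContDiff ℝ ∞ (f a))
    (hm : ∀ n x, AEStronglyMeasurable (fun a => iteratedFDeriv ℝ n (f a) x) μ)
    (hb : ∀ n a x, ‖iteratedFDeriv ℝ n (f a) x‖ ≤ b n a) (hi : ∀ n, Integrable (b n) μ)
    (n : ℕ) : iteratedFDeriv ℝ n (fun x => ∫ a, f a x ∂μ) =
      fun x => ∫ a, iteratedFDeriv ℝ n (f a) x ∂μ := by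
  induction n with
  | zero =>
    ext1 x
    simp only [iteratedFDeriv_zero_eq_comp, Function.comp_apply]
    exact ((continuousMultilinearCurryFin0 ℝ V F).symm.toContinuousLinearEquiv.integral_comp_comm
      _).symm
  | succ n ih =>
    ext1 x
    rw [iteratedFDeriv_succ_eq_comp_left, Function.comp_apply, ih,
      (hasFDerivAt_integral_iteratedFDeriv hf hm hb hi n x).fderiv,
      LinearIsometryEquiv.symm_apply_apply]

theorem contDiff_integral {f : α → V → F} {b : ℕ → α → ℝ}
    (hf : ∀ a, ContDiff ℝ ∞ (f a))
    (hm : ∀ n x, AEStronglyMeasurable (fun a => iteratedFDeriv ℝ n (f a) x) μ)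
    (hb : ∀ n a x, ‖iteratedFDeriv ℝ n (f a) x‖ ≤ b n a) (hi : ∀ n, Integrable (b n) μ) :
    ContDiff ℝ ∞ fun x => ∫ a, f a x ∂μ := by
  refine contDiff_of_differentiable_iteratedFDeriv fun n _ => ?_
  rw [iteratedFDeriv_integral hf hm hb hi n]
  exact fun x => (hasFDerivAt_integral_iteratedFDeriv hf hm hb hi n x).differentiableAt

end ParametricIntegral

section PartialIntegral

variable {P V F : Type*} [NormedAddCommGroup P] [NormedSpace ℝ P] [FiniteDimensional ℝ P]
  [MeasurableSpace P] [BorelSpace P] [NormedAddCommGroup V] [NormedSpace ℝ V]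
  [NormedAddCommGroup F] [NormedSpace ℝ F] [NormedSpace ℂ F] [SMulCommClass ℝ ℂ F]
  (μ : Measure P) [μ.HasTemperateGrowth]

theorem integrable_slice_apply (H : 𝓢(P × V, F)) (v : V) : Integrable (fun p => H (p, v)) μ :=
  ((Measure.integrable_pow_neg_integrablePower μ).const_mul _).mono'
    (H.continuous.comp (Continuous.prodMk_left v)).aestronglyMeasurable
    (.of_forall fun p => by simpa using norm_iteratedFDeriv_slice_le_rpow p H μ.integrablePower 0 v)

theorem iteratedFDeriv_integral_slice (H : 𝓢(P × V, F)) (n : ℕ) :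
    iteratedFDeriv ℝ n (fun v => ∫ p, H (p, v) ∂μ) =
      fun v => ∫ p, iteratedFDeriv ℝ n (slice p H) v ∂μ :=
  iteratedFDeriv_integral (f := fun p v => slice p H v) (fun p => (slice p H).smooth ⊤)
    (fun n v => (continuous_iteratedFDeriv_slice H n v).aestronglyMeasurable)
    (fun n p v => norm_iteratedFDeriv_slice_le_rpow p H μ.integrablePower n v)
    (fun _ => (Measure.integrable_pow_neg_integrablePower μ).const_mul _) n

theorem norm_pow_mul_norm_iteratedFDeriv_integral_slice_le (H : 𝓢(P × V, F)) (k n : ℕ) (v : V) :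
    ‖v‖ ^ k * ‖iteratedFDeriv ℝ n (fun v => ∫ p, H (p, v) ∂μ) v‖ ≤
      (2 ^ (μ.integrablePower + k) * ∫ p, (1 + ‖p‖) ^ (-(μ.integrablePower : ℝ)) ∂μ) *
        supSeminorm (max (μ.integrablePower + k) n) H := by
  set N := μ.integrablePower
  have hslice : ∀ p, ‖‖v‖ ^ k • iteratedFDeriv ℝ n (slice p H) v‖ ≤
      2 ^ (N + k) * supSeminorm (max (N + k) n) H * (1 + ‖p‖) ^ (-(N : ℝ)) := fun p => by
    rw [norm_smul, norm_pow, norm_norm]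
    exact (le_seminorm ℂ k n _ v).trans (seminorm_slice_le_rpow p H N k n)
  have hint := norm_integral_le_of_norm_le
    ((Measure.integrable_pow_neg_integrablePower μ).const_mul _) (.of_forall hslice)
  rw [integral_smul, norm_smul, norm_pow, norm_norm, integral_const_mul] at hint
  rw [iteratedFDeriv_integral_slice]
  exact hint.trans_eq (by ring)

/-- Partial integration `H ↦ (v ↦ ∫ H(p, v) dp)` of Schwartz functions on a product. -/
def partialIntegral : 𝓢(P × V, F) →L[ℂ] 𝓢(V, F) :=
  mkCLM (fun H v => ∫ p, H (p, v) ∂μ)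
    (fun H H' v => integral_add (integrable_slice_apply μ H v) (integrable_slice_apply μ H' v))
    (fun c H v => integral_smul c fun p => H (p, v))
    (fun H => contDiff_integral (f := fun p v => slice p H v) (fun p => (slice p H).smooth ⊤)
      (fun n v => (continuous_iteratedFDeriv_slice H n v).aestronglyMeasurable)
      (fun n p v => norm_iteratedFDeriv_slice_le_rpow p H μ.integrablePower n v)
      (fun _ => (Measure.integrable_pow_neg_integrablePower μ).const_mul _))
    (fun i => ⟨Finset.Iic (max (μ.integrablePower + i.1) i.2, max (μ.integrablePower + i.1) i.2), _,
      mul_nonneg (by positivity) (integral_nonneg fun _ => by positivity),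
      fun H v => norm_pow_mul_norm_iteratedFDeriv_integral_slice_le μ H i.1 i.2 v⟩)

@[simp]
theorem partialIntegral_apply (H : 𝓢(P × V, F)) (v : V) :
    partialIntegral μ H v = ∫ p, H (p, v) ∂μ := rfl

end PartialIntegral

section Distribution

variable {V : Type*} [NormedAddCommGroup V] [NormedSpace ℝ V]

/-- Bounded continuous functions with values in the `n`-linear forms: the Banach space in which
the weighted `n`-th derivatives of Schwartz functions live. -/
def BoundedForms (V : Type*) [NormedAddCommGroup V] [NormedSpace ℝ V] (n : ℕ) : Type _ :=
  V →ᵇ ContinuousMultilinearMap ℝ (fun _ : Fin n => V) ℂ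

namespace BoundedForms

variable {n : ℕ}

instance : NormedAddCommGroup (BoundedForms V n) :=
  inferInstanceAs (NormedAddCommGroup (V →ᵇ ContinuousMultilinearMap ℝ (fun _ : Fin n => V) ℂ))

instance : NormedSpace ℂ (BoundedForms V n) :=
  inferInstanceAs (NormedSpace ℂ (V →ᵇ ContinuousMultilinearMap ℝ (fun _ : Fin n => V) ℂ))

instance : CompleteSpace (BoundedForms V n) :=
  inferInstanceAs (CompleteSpace (V →ᵇ ContinuousMultilinearMap ℝ (fun _ : Fin n => V) ℂ))

/-- Evaluation of a bounded family of forms at a point. -/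
def evalAt (x : V) : BoundedForms V n →L[ℂ] ContinuousMultilinearMap ℝ (fun _ : Fin n => V) ℂ :=
  let e : (V →ᵇ ContinuousMultilinearMap ℝ (fun _ : Fin n => V) ℂ) →L[ℂ]
      ContinuousMultilinearMap ℝ (fun _ : Fin n => V) ℂ := BoundedContinuousFunction.evalCLM ℂ x
  e

theorem ext_evalAt {f g : BoundedForms V n} (h : ∀ x, evalAt x f = evalAt x g) : f = g :=
  BoundedContinuousFunction.ext h

theorem norm_le {f : BoundedForms V n} {C : ℝ} (hC : 0 ≤ C) (h : ∀ x, ‖evalAt x f‖ ≤ C) :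
    ‖f‖ ≤ C :=
  (BoundedContinuousFunction.norm_le (f := f) hC).2 h

theorem norm_evalAt_le (f : BoundedForms V n) (x : V) : ‖evalAt x f‖ ≤ ‖f‖ :=
  BoundedContinuousFunction.norm_coe_le_norm f x

end BoundedForms

open BoundedForms

/-- The weighted derivative `x ↦ ‖x‖ ^ k D^n f(x)` of a Schwartz function, for `(k, n) = i`. -/
def weightedDerivFun (i : ℕ × ℕ) (f : 𝓢(V, ℂ)) : BoundedForms V i.2 :=
  BoundedContinuousFunction.ofNormedAddCommGroup
    (fun x => ‖x‖ ^ i.1 • iteratedFDeriv ℝ i.2 f x)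
    ((continuous_norm.pow _).smul ((f.smooth ⊤).continuous_iteratedFDeriv (mod_cast le_top)))
    (SchwartzMap.seminorm ℂ i.1 i.2 f)
    (fun x => by
      rw [norm_smul, norm_pow, norm_norm]
      exact le_seminorm ℂ i.1 i.2 f x)

theorem evalAt_weightedDerivFun (i : ℕ × ℕ) (f : 𝓢(V, ℂ)) (x : V) :
    evalAt x (weightedDerivFun i f) = ‖x‖ ^ i.1 • iteratedFDeriv ℝ i.2 f x := rfl

theorem norm_weightedDerivFun (i : ℕ × ℕ) (f : 𝓢(V, ℂ)) :
    ‖weightedDerivFun i f‖ = SchwartzMap.seminorm ℂ i.1 i.2 f := by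
  refine le_antisymm (norm_le (apply_nonneg _ _) fun x => ?_)
    (SchwartzMap.seminorm_le_bound ℂ _ _ _ (norm_nonneg (weightedDerivFun i f)) fun x => ?_)
  · rw [evalAt_weightedDerivFun, norm_smul, norm_pow, norm_norm]
    exact le_seminorm ℂ i.1 i.2 f x
  · simpa only [evalAt_weightedDerivFun, norm_smul, norm_pow, norm_norm] using
      norm_evalAt_le (weightedDerivFun i f) x

/-- `weightedDerivFun` as a linear map into a Banach space whose norm restricts to the Schwartz
seminorm of index `i`. -/
def weightedDeriv (i : ℕ × ℕ) : 𝓢(V, ℂ) →L[ℂ] BoundedForms V i.2 :=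
  mkCLMtoNormedSpace (weightedDerivFun i)
    (fun f g => ext_evalAt fun x => by
      have hcoe : (⇑(f + g) : V → ℂ) = ⇑f + ⇑g := by ext; simp
      rw [map_add, evalAt_weightedDerivFun, evalAt_weightedDerivFun, evalAt_weightedDerivFun, hcoe,
        iteratedFDeriv_add_apply (f.contDiffAt _) (g.contDiffAt _), smul_add])
    (fun c f => ext_evalAt fun x => by
      have hcoe : (⇑(c • f) : V → ℂ) = c • ⇑f := by ext; simp
      rw [RingHom.id_apply, map_smul, evalAt_weightedDerivFun, evalAt_weightedDerivFun, hcoe,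
        iteratedFDeriv_const_smul_apply (f.contDiffAt _), smul_comm])
    ⟨{i}, 1, zero_le_one, fun f => by
      rw [one_mul, Finset.sup_singleton]
      exact (norm_weightedDerivFun i f).le⟩

theorem evalAt_weightedDeriv (i : ℕ × ℕ) (f : 𝓢(V, ℂ)) (x : V) :
    evalAt x (weightedDeriv i f) = ‖x‖ ^ i.1 • iteratedFDeriv ℝ i.2 f x := rfl

theorem norm_weightedDeriv (i : ℕ × ℕ) (f : 𝓢(V, ℂ)) :
    ‖weightedDeriv i f‖ = SchwartzMap.seminorm ℂ i.1 i.2 f :=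
  norm_weightedDerivFun i f

section Jet

variable {m : ℕ}

/-- All weighted derivatives with both indices at most `m`, so that `supSeminorm m` is the pullback
of a Banach space norm. -/
def jet (m : ℕ) : 𝓢(V, ℂ) →L[ℂ] ∀ i : Finset.Iic (m, m), BoundedForms V i.1.2 :=
  ContinuousLinearMap.pi fun i => weightedDeriv i.1

theorem supSeminorm_le_norm_jet (f : 𝓢(V, ℂ)) : supSeminorm m f ≤ ‖jet m f‖ :=
  supSeminorm_le (norm_nonneg _) fun k n hk hn => (norm_weightedDeriv (k, n) f).symm.trans_le <|
    norm_le_pi_norm (jet m f) ⟨(k, n), Finset.mem_Iic.2 (Prod.mk_le_mk.2 ⟨hk, hn⟩)⟩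

variable {P : Type*} [NormedAddCommGroup P] [NormedSpace ℝ P] [FiniteDimensional ℝ P]
  [MeasurableSpace P] [BorelSpace P] (μ : Measure P) [μ.HasTemperateGrowth]

theorem integrable_weightedDeriv_slice (i : ℕ × ℕ) (H : 𝓢(P × V, ℂ)) :
    Integrable (fun p => weightedDeriv i (slice p H)) μ :=
  ((Measure.integrable_pow_neg_integrablePower μ).const_mul _).mono'
    ((weightedDeriv i).continuous.comp (continuous_slice H)).aestronglyMeasurable
    (.of_forall fun p =>
      (norm_weightedDeriv i _).trans_le (seminorm_slice_le_rpow p H _ i.1 i.2))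

theorem weightedDeriv_partialIntegral (i : ℕ × ℕ) (H : 𝓢(P × V, ℂ)) :
    weightedDeriv i (partialIntegral μ H) = ∫ p, weightedDeriv i (slice p H) ∂μ := by
  refine ext_evalAt fun x => ?_
  rw [← (evalAt x).integral_comp_comm (integrable_weightedDeriv_slice μ i H)]
  simp only [evalAt_weightedDeriv, integral_smul]
  congr 1
  exact congrFun (iteratedFDeriv_integral_slice μ H i.2) x

theorem integrable_jet_slice (H : 𝓢(P × V, ℂ)) : Integrable (fun p => jet m (slice p H)) μ :=
  Integrable.of_eval fun i => integrable_weightedDeriv_slice μ i.1 H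

theorem jet_partialIntegral (H : 𝓢(P × V, ℂ)) :
    jet m (partialIntegral μ H) = ∫ p, jet m (slice p H) ∂μ := by
  ext1 i
  rw [eval_integral fun i => integrable_weightedDeriv_slice μ i.1 H]
  exact weightedDeriv_partialIntegral μ i.1 H

end Jet

theorem exists_dual_comp_eq {M G : Type*} [AddCommGroup M] [Module ℂ M] [NormedAddCommGroup G]
    [NormedSpace ℂ G] (J : M →ₗ[ℂ] G) (L : M →ₗ[ℂ] ℂ) {C : ℝ} (hL : ∀ f, ‖L f‖ ≤ C * ‖J f‖) :
    ∃ l : G →L[ℂ] ℂ, ∀ f, l (J f) = L f := by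
  have hker : LinearMap.ker J ≤ LinearMap.ker L := fun f hf => by
    have := hL f
    rw [LinearMap.mem_ker.1 hf, norm_zero, mul_zero] at this
    exact norm_le_zero_iff.1 this
  obtain ⟨ψ, hψ⟩ : L ∈ LinearMap.range J.dualMap := by
    rw [LinearMap.range_dualMap_eq_dualAnnihilator_ker]
    exact (Submodule.mem_dualAnnihilator _).2 hker
  have hψ' : ∀ f, ψ (J f) = L f := fun f => LinearMap.congr_fun hψ f
  let ψ₀ : LinearMap.range J →L[ℂ] ℂ := (ψ.domRestrict (LinearMap.range J)).mkContinuous C <| by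
    rintro ⟨_, f, rfl⟩
    exact (congrArg norm (hψ' f)).trans_le (hL f)
  obtain ⟨l, hl, -⟩ := exists_extension_norm_eq _ ψ₀
  exact ⟨l, fun f => (hl ⟨J f, f, rfl⟩).trans (hψ' f)⟩

theorem apply_partialIntegral {P : Type*} [NormedAddCommGroup P] [NormedSpace ℝ P]
    [FiniteDimensional ℝ P] [MeasurableSpace P] [BorelSpace P] (μ : Measure P)
    [μ.HasTemperateGrowth] (L : 𝓢(V, ℂ) →L[ℂ] ℂ) (H : 𝓢(P × V, ℂ)) :
    L (partialIntegral μ H) = ∫ p, L (slice p H) ∂μ := by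
  obtain ⟨m, C, hC, hm⟩ := exists_norm_le_supSeminorm L
  obtain ⟨l, hl⟩ := exists_dual_comp_eq (jet m).toLinearMap L.toLinearMap fun f =>
    (hm f).trans (mul_le_mul_of_nonneg_left (supSeminorm_le_norm_jet f) hC)
  calc L (partialIntegral μ H) = l (∫ p, jet m (slice p H) ∂μ) := by
        rw [← jet_partialIntegral]
        exact (hl _).symm
    _ = ∫ p, l (jet m (slice p H)) ∂μ := (l.integral_comp_comm (integrable_jet_slice μ H)).symm
    _ = ∫ p, L (slice p H) ∂μ := integral_congr_ae (.of_forall fun p => hl (slice p H))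

end Distribution
end

section

open scoped ContDiff FourierTransform RealInnerProductSpace

/-! ### Density of tensor products -/

section Cutoff

variable {V : Type*} [NormedAddCommGroup V] [NormedSpace ℝ V]

/-- The dilation `f ↦ f(c ·)`. -/
def dilate (c : ℝˣ) : 𝓢(V, ℂ) →L[ℂ] 𝓢(V, ℂ) :=
  compCLMOfContinuousLinearEquiv ℂ (ContinuousLinearEquiv.smulLeft c : V ≃L[ℝ] V)

@[simp]
theorem dilate_apply (c : ℝˣ) (f : 𝓢(V, ℂ)) (v : V) : dilate c f v = f ((c : ℝ) • v) := rfl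

theorem norm_iteratedFDeriv_dilate_le {c : ℝˣ} (hc : |(c : ℝ)| ≤ 1) (f : 𝓢(V, ℂ)) (n : ℕ) (v : V) :
    ‖iteratedFDeriv ℝ n (dilate c f) v‖ ≤ SchwartzMap.seminorm ℂ 0 n f := by
  have hnorm : ‖(c : ℝ) • ContinuousLinearMap.id ℝ V‖ ≤ 1 := by
    rw [norm_smul, Real.norm_eq_abs]
    exact mul_le_one₀ hc (norm_nonneg _) ContinuousLinearMap.norm_id_le
  exact (norm_iteratedFDeriv_comp_clm_le (f.smooth ⊤) hnorm n v).trans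
    (norm_iteratedFDeriv_le_seminorm ℂ f n _)

theorem norm_iteratedFDeriv_one_sub_dilate_le {c : ℝˣ} (hc : |(c : ℝ)| ≤ 1) (χ : 𝓢(V, ℂ))
    {n m : ℕ} (hn : n ≤ m) (v : V) :
    ‖iteratedFDeriv ℝ n (fun v => 1 - dilate c χ v) v‖ ≤ 1 + supSeminorm m χ := by
  have hcoe : (fun v => 1 - dilate c χ v) = (fun _ => (1 : ℂ)) - ⇑(dilate c χ) := rfl
  rw [hcoe, iteratedFDeriv_sub_apply contDiffAt_const ((dilate c χ).contDiffAt _)]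
  refine (norm_sub_le _ _).trans (add_le_add ?_ ?_)
  · rcases n.eq_zero_or_pos with rfl | hn0
    · simp
    · simp [iteratedFDeriv_const_of_ne hn0.ne']
  · exact (norm_iteratedFDeriv_dilate_le hc χ n v).trans
      (seminorm_le_supSeminorm (Nat.zero_le _) hn χ)

theorem iteratedFDeriv_one_sub_dilate_mul_eq_zero {χ : 𝓢(V, ℂ)} (hχ : ∀ v, ‖v‖ < 1 → χ v = 1)
    (θ : 𝓢(V, ℂ)) {c : ℝˣ} {x : V} (hx : ‖(c : ℝ) • x‖ < 1) (n : ℕ) :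
    iteratedFDeriv ℝ n (fun x => (1 - dilate c χ x) * θ x) x = 0 := by
  have hnear : ∀ᶠ y in 𝓝 x, ‖(c : ℝ) • y‖ < 1 :=
    (continuous_const_smul (c : ℝ)).norm.continuousAt.eventually_lt continuousAt_const hx
  have hzero : (fun x => (1 - dilate c χ x) * θ x) =ᶠ[𝓝 x] fun _ => 0 := by
    filter_upwards [hnear] with y hy
    rw [dilate_apply, hχ _ hy, sub_self, zero_mul]
  exact ((hzero.iteratedFDeriv ℝ n).eq_of_nhds).trans (congrFun iteratedFDeriv_fun_zero x)

-- Away from the region where the cutoff is one, a power of `‖x‖` can be traded for a factor `c`.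
theorem norm_pow_mul_iteratedFDeriv_one_sub_dilate_mul_le (χ θ : 𝓢(V, ℂ)) {c : ℝˣ}
    (hc : |(c : ℝ)| ≤ 1) {k n m : ℕ} (hk : k ≤ m) (hn : n ≤ m) {x : V} (hx : 1 ≤ ‖(c : ℝ) • x‖) :
    ‖x‖ ^ k * ‖iteratedFDeriv ℝ n (fun x => (1 - dilate c χ x) * θ x) x‖ ≤
      |(c : ℝ)| * (2 ^ n * ((1 + supSeminorm m χ) * supSeminorm (m + 1) θ)) := by
  have hpow : ‖x‖ ^ k ≤ |(c : ℝ)| * ‖x‖ ^ (k + 1) := by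
    rw [norm_smul, Real.norm_eq_abs] at hx
    calc ‖x‖ ^ k ≤ |(c : ℝ)| * ‖x‖ * ‖x‖ ^ k := le_mul_of_one_le_left (by positivity) hx
      _ = _ := by ring
  calc _ ≤ |(c : ℝ)| * ‖x‖ ^ (k + 1) * ∑ i ∈ Finset.range (n + 1), (n.choose i : ℝ) *
        ‖iteratedFDeriv ℝ i (fun x => 1 - dilate c χ x) x‖ * ‖iteratedFDeriv ℝ (n - i) θ x‖ := by
        gcongr
        exact norm_iteratedFDeriv_mul_le (contDiff_const.sub ((dilate c χ).smooth ⊤))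
          (θ.smooth ⊤) x (mod_cast le_top)
    _ = |(c : ℝ)| * ∑ i ∈ Finset.range (n + 1), (n.choose i : ℝ) *
          (‖iteratedFDeriv ℝ i (fun x => 1 - dilate c χ x) x‖ *
            (‖x‖ ^ (k + 1) * ‖iteratedFDeriv ℝ (n - i) θ x‖)) := by
        rw [mul_assoc, Finset.mul_sum]
        congr 1
        exact Finset.sum_congr rfl fun i _ => by ring
    _ ≤ |(c : ℝ)| * ∑ i ∈ Finset.range (n + 1), (n.choose i : ℝ) *
          ((1 + supSeminorm m χ) * supSeminorm (m + 1) θ) := by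
        gcongr with i hi
        · exact norm_iteratedFDeriv_one_sub_dilate_le hc χ
            ((Finset.mem_range_succ_iff.1 hi).trans hn) x
        · exact (le_seminorm ℂ (k + 1) (n - i) θ x).trans
            (seminorm_le_supSeminorm (by lia) (by lia) θ)
    _ = _ := by
        rw [← Finset.sum_mul]
        congr 2
        exact_mod_cast Nat.sum_range_choose n

theorem supSeminorm_sub_dilate_mul_le {χ : 𝓢(V, ℂ)} (hχ : ∀ v, ‖v‖ < 1 → χ v = 1) (θ : 𝓢(V, ℂ))
    {c : ℝˣ} (hc : |(c : ℝ)| ≤ 1) (m : ℕ) :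
    supSeminorm m (θ - smulLeftCLM ℂ (dilate c χ : V → ℂ) θ) ≤
      |(c : ℝ)| * (2 ^ m * ((1 + supSeminorm m χ) * supSeminorm (m + 1) θ)) := by
  refine supSeminorm_le (by positivity) fun k n hk hn => ?_
  refine SchwartzMap.seminorm_le_bound ℂ k n _ (by positivity) fun x => ?_
  have hcoe : (⇑(θ - smulLeftCLM ℂ (dilate c χ : V → ℂ) θ) : V → ℂ) =
      fun x => (1 - dilate c χ x) * θ x := by
    ext x
    rw [sub_apply, smulLeftCLM_apply_apply (SchwartzMap.hasTemperateGrowth _), smul_eq_mul]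
    ring
  rw [hcoe]
  rcases lt_or_ge ‖(c : ℝ) • x‖ 1 with hx | hx
  · rw [iteratedFDeriv_one_sub_dilate_mul_eq_zero hχ θ hx, norm_zero, mul_zero]
    positivity
  · refine (norm_pow_mul_iteratedFDeriv_one_sub_dilate_mul_le χ θ hc hk hn hx).trans ?_
    gcongr
    exact one_le_two

theorem exists_cutoff (V : Type*) [NormedAddCommGroup V] [NormedSpace ℝ V]
    [FiniteDimensional ℝ V] : ∃ χ : 𝓢(V, ℂ), ∀ v, ‖v‖ < 1 → χ v = 1 := by
  let b : ContDiffBump (0 : V) := ⟨1, 2, one_pos, one_lt_two⟩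
  have hsupp : HasCompactSupport fun v => ((b v : ℝ) : ℂ) :=
    b.hasCompactSupport.comp_left (g := fun r : ℝ => (r : ℂ)) Complex.ofReal_zero
  have hsmooth : ContDiff ℝ ∞ fun v => ((b v : ℝ) : ℂ) :=
    (Complex.ofRealCLM.contDiff (n := ∞)).comp b.contDiff
  refine ⟨hsupp.toSchwartzMap hsmooth, fun v hv => ?_⟩
  have hone : b v = 1 := b.one_of_mem_closedBall (mem_closedBall_zero_iff.2 hv.le)
  simp [hone]

end Cutoff

section FourierInversion

theorem iteratedDeriv_fourierChar (n : ℕ) :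
    iteratedDeriv n (fun t : ℝ => (Real.fourierChar t : ℂ)) =
      fun t => (2 * Real.pi * Complex.I) ^ n * Real.fourierChar t := by
  induction n with
  | zero => simp
  | succ n ih =>
    ext t
    rw [iteratedDeriv_succ, ih, ((Real.hasDerivAt_fourierChar t).const_mul _).deriv]
    ring

theorem hasTemperateGrowth_fourierChar :
    Function.HasTemperateGrowth fun t : ℝ => (Real.fourierChar t : ℂ) := by
  refine ⟨?_, fun n => ⟨0, (2 * Real.pi) ^ n, fun t => ?_⟩⟩
  · simp only [Real.fourierChar_apply]
    exact ((Complex.ofRealCLM.contDiff.comp (contDiff_const.mul contDiff_id)).mul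
      contDiff_const).cexp
  · rw [norm_iteratedFDeriv_eq_norm_iteratedDeriv, iteratedDeriv_fourierChar, norm_mul, norm_pow,
      Circle.norm_coe]
    simp [abs_of_pos Real.pi_pos]

theorem hasTemperateGrowth_fourierChar_comp {V : Type*} [NormedAddCommGroup V] [NormedSpace ℝ V]
    (l : V →L[ℝ] ℝ) : Function.HasTemperateGrowth fun v => (Real.fourierChar (l v) : ℂ) :=
  hasTemperateGrowth_fourierChar.comp l.hasTemperateGrowth

variable {E W : Type*} [NormedAddCommGroup E] [InnerProductSpace ℝ E]
  [NormedAddCommGroup W] [NormedSpace ℝ W]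

/-- The Fourier kernel `(ξ, w) ↦ exp(2πi ⟪ξ, e w⟫)` of a space `W` identified with an inner product
space through `e`. -/
def fourierKernel (e : W →L[ℝ] E) (z : E × W) : ℂ :=
  Real.fourierChar ⟪z.1, e z.2⟫

theorem hasTemperateGrowth_fourierKernel (e : W →L[ℝ] E) :
    (fourierKernel e).HasTemperateGrowth :=
  hasTemperateGrowth_fourierChar.comp <| (innerSL ℝ).bilinear_hasTemperateGrowth
    (ContinuousLinearMap.fst ℝ E W).hasTemperateGrowth
    (e.comp (ContinuousLinearMap.snd ℝ E W)).hasTemperateGrowth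

theorem smulLeftCLM_eq_partialIntegral [FiniteDimensional ℝ E] [MeasurableSpace E] [BorelSpace E]
    (e : W ≃L[ℝ] E) (χ θ : 𝓢(W, ℂ)) :
    smulLeftCLM ℂ χ θ = partialIntegral volume (smulLeftCLM ℂ
      (fourierKernel e.toContinuousLinearMap)
      (tensor (𝓕 (compCLMOfContinuousLinearEquiv ℂ e.symm θ)) χ)) := by
  ext w
  set θ' := compCLMOfContinuousLinearEquiv ℂ e.symm θ
  have hinv : θ w = 𝓕⁻ (𝓕 θ') (e w) := by
    rw [FourierTransform.fourierInv_fourier_eq]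
    simp [θ']
  rw [smulLeftCLM_apply_apply (SchwartzMap.hasTemperateGrowth _), partialIntegral_apply, hinv,
    fourierInv_coe, Real.fourierInv_eq, smul_eq_mul, ← integral_const_mul]
  refine integral_congr_ae (.of_forall fun ξ => ?_)
  simp only [smulLeftCLM_apply_apply (hasTemperateGrowth_fourierKernel _), tensor_apply,
    fourierKernel, smul_eq_mul, Circle.smul_def, ContinuousLinearEquiv.coe_coe]
  ring

-- A plane wave on a product is the tensor product of plane waves on the factors.
theorem slice_fourierKernel_tensor {P V : Type*} [NormedAddCommGroup P] [NormedSpace ℝ P]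
    [NormedAddCommGroup V] [NormedSpace ℝ V] (e : P × V →L[ℝ] E) (θ : 𝓢(E, ℂ)) (χ₁ : 𝓢(P, ℂ))
    (χ₂ : 𝓢(V, ℂ)) (ξ : E) :
    slice ξ (smulLeftCLM ℂ (fourierKernel e) (tensor θ (tensor χ₁ χ₂))) =
      θ ξ • tensor (smulLeftCLM ℂ (fun p => (Real.fourierChar ⟪ξ, e (p, 0)⟫ : ℂ)) χ₁)
        (smulLeftCLM ℂ (fun v => (Real.fourierChar ⟪ξ, e (0, v)⟫ : ℂ)) χ₂) := by
  ext ⟨p, v⟩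
  have hmul : fourierKernel e (ξ, p, v) =
      Real.fourierChar ⟪ξ, e (p, 0)⟫ * Real.fourierChar ⟪ξ, e (0, v)⟫ := by
    rw [← Circle.coe_mul, ← AddChar.map_add_eq_mul, ← inner_add_right, ← map_add, Prod.mk_add_mk,
      add_zero, zero_add, fourierKernel]
  have hp : Function.HasTemperateGrowth fun p => (Real.fourierChar ⟪ξ, e (p, 0)⟫ : ℂ) :=
    hasTemperateGrowth_fourierChar_comp
      ((innerSL ℝ ξ).comp (e.comp (ContinuousLinearMap.inl ℝ P V)))
  have hv : Function.HasTemperateGrowth fun v => (Real.fourierChar ⟪ξ, e (0, v)⟫ : ℂ) :=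
    hasTemperateGrowth_fourierChar_comp
      ((innerSL ℝ ξ).comp (e.comp (ContinuousLinearMap.inr ℝ P V)))
  rw [slice_apply, smulLeftCLM_apply_apply (hasTemperateGrowth_fourierKernel e), smul_apply,
    tensor_apply, tensor_apply, tensor_apply, smulLeftCLM_apply_apply hp,
    smulLeftCLM_apply_apply hv, hmul]
  simp only [smul_eq_mul]
  ring

end FourierInversion

section Density

variable {P V : Type*} [NormedAddCommGroup P] [NormedSpace ℝ P] [FiniteDimensional ℝ P]
  [NormedAddCommGroup V] [NormedSpace ℝ V] [FiniteDimensional ℝ V]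

theorem apply_tensor_smul_eq_zero (L : 𝓢(P × V, ℂ) →L[ℂ] ℂ) (hL : ∀ a b, L (tensor a b) = 0)
    (χ₁ : 𝓢(P, ℂ)) (χ₂ : 𝓢(V, ℂ)) (θ : 𝓢(P × V, ℂ)) :
    L (smulLeftCLM ℂ (tensor χ₁ χ₂ : P × V → ℂ) θ) = 0 := by
  rw [smulLeftCLM_eq_partialIntegral (toEuclidean (E := P × V)), apply_partialIntegral]
  refine integral_eq_zero_of_ae (.of_forall fun ξ => ?_)
  dsimp only
  rw [slice_fourierKernel_tensor, map_smul, hL, smul_zero, Pi.zero_apply]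

theorem eq_zero_of_tensor (L : 𝓢(P × V, ℂ) →L[ℂ] ℂ) (hL : ∀ a b, L (tensor a b) = 0) : L = 0 := by
  obtain ⟨χ₁, h₁⟩ := exists_cutoff P
  obtain ⟨χ₂, h₂⟩ := exists_cutoff V
  have hχ : ∀ z : P × V, ‖z‖ < 1 → tensor χ₁ χ₂ z = 1 := fun z hz => by
    rw [tensor_apply, h₁ _ ((norm_fst_le z).trans_lt hz), h₂ _ ((norm_snd_le z).trans_lt hz),
      one_mul]
  obtain ⟨m, C, hC, hm⟩ := exists_norm_le_supSeminorm L
  ext θ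
  rw [zero_apply]
  set B := 2 ^ m * ((1 + supSeminorm m (tensor χ₁ χ₂)) * supSeminorm (m + 1) θ)
  have hsmall : ∀ c : ℝ, 0 < c → c ≤ 1 → ‖L θ‖ ≤ C * (c * B) := fun c hc0 hc1 => by
    let u : ℝˣ := Units.mk0 c hc0.ne'
    have hcut : L θ = L (θ - smulLeftCLM ℂ (dilate u (tensor χ₁ χ₂) : P × V → ℂ) θ) := by
      have : dilate u (tensor χ₁ χ₂) = tensor (dilate u χ₁) (dilate u χ₂) := rfl
      rw [map_sub, this, apply_tensor_smul_eq_zero L hL, sub_zero]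
    have hu : |(u : ℝ)| = c := abs_of_pos hc0
    have hbound := supSeminorm_sub_dilate_mul_le hχ θ (hu.trans_le hc1) m
    rw [hu] at hbound
    rw [hcut]
    exact (hm _).trans (mul_le_mul_of_nonneg_left hbound hC)
  have hlim : Tendsto (fun c : ℝ => C * (c * B)) (𝓝[>] 0) (𝓝 0) := by
    have : Continuous fun c : ℝ => C * (c * B) := by fun_prop
    simpa using (this.tendsto 0).mono_left nhdsWithin_le_nhds
  refine norm_le_zero_iff.1 (ge_of_tendsto hlim ?_)
  filter_upwards [Ioc_mem_nhdsGT one_pos] with c hc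
  exact hsmall c hc.1 hc.2

end Density

end

section

open scoped ContDiff

/-! ### Integrals of bilinear maps along slices -/

theorem continuous_of_norm_le_supSeminorm {V W : Type*} [NormedAddCommGroup V] [NormedSpace ℝ V]
    [SeminormedAddCommGroup W] [NormedSpace ℂ W] (T : 𝓢(V, ℂ) →ₗ[ℂ] W) (m : ℕ) (C : ℝ)
    (h : ∀ f, ‖T f‖ ≤ C * supSeminorm m f) : Continuous T := by
  apply WithSeminorms.continuous_normedSpace_rng W (schwartz_withSeminorms ℂ V ℂ)
  refine ⟨Finset.Iic (m, m), C.toNNReal, fun f => (h f).trans ?_⟩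
  exact mul_le_mul_of_nonneg_right C.le_coe_toNNReal (apply_nonneg _ f)

theorem slice_tensor {P V : Type*} [NormedAddCommGroup P] [NormedSpace ℝ P]
    [NormedAddCommGroup V] [NormedSpace ℝ V] (a : 𝓢(P, ℂ)) (b : 𝓢(V, ℂ)) (p : P) :
    slice p (tensor a b) = a p • b := by
  ext v
  simp

section SliceIntegral

variable {P V P' V' U : Type*}
  [NormedAddCommGroup P] [NormedSpace ℝ P] [NormedAddCommGroup V] [NormedSpace ℝ V]
  [NormedAddCommGroup P'] [NormedSpace ℝ P'] [NormedAddCommGroup V'] [NormedSpace ℝ V']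
  [NormedAddCommGroup U] [NormedSpace ℝ U]
  {B : 𝓢(V, ℂ) →ₗ[ℂ] 𝓢(V', ℂ) →ₗ[ℂ] 𝓢(U, ℂ)}
  (hB : Continuous fun p : 𝓢(V, ℂ) × 𝓢(V', ℂ) => B p.1 p.2) (τ : U →L[ℝ] P) (τ' : U →L[ℝ] P')

include hB

theorem continuous_bilin_slice (f : 𝓢(P × V, ℂ)) (g : 𝓢(P' × V', ℂ)) :
    Continuous fun x => B (slice (τ x) f) (slice (τ' x) g) x := by
  have hslice : Continuous fun x => B (slice (τ x) f) (slice (τ' x) g) :=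
    hB.comp (((continuous_slice f).comp τ.continuous).prodMk
      ((continuous_slice g).comp τ'.continuous))
  have hbounded : Continuous fun x =>
      toBoundedContinuousFunctionCLM ℂ U ℂ (B (slice (τ x) f) (slice (τ' x) g)) :=
    (toBoundedContinuousFunctionCLM ℂ U ℂ).continuous.comp hslice
  exact continuous_eval.comp (hbounded.prodMk continuous_id)

theorem exists_norm_bilin_slice_le (N : ℕ) : ∃ m C,
    ∀ (f : 𝓢(P × V, ℂ)) (g : 𝓢(P' × V', ℂ)) (x : U),
      ‖B (slice (τ x) f) (slice (τ' x) g) x‖ ≤ C * supSeminorm m f *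
        supSeminorm m g * (1 + ‖x‖) ^ (-(N : ℝ)) := by
  obtain ⟨m, C, hC, h⟩ := exists_bilin_supSeminorm_le B hB N
  refine ⟨m, 2 ^ N * (C * 2 ^ m * 2 ^ m), fun f g x => ?_⟩
  rw [Real.rpow_neg (by positivity), Real.rpow_natCast, ← div_eq_mul_inv,
    le_div_iff₀' (by positivity)]
  refine (one_add_norm_pow_mul_apply_le _ N x).trans ?_
  calc _ ≤ 2 ^ N * (C * supSeminorm m (slice (τ x) f) * supSeminorm m (slice (τ' x) g)) := by
        gcongr
        exact h _ _
    _ ≤ 2 ^ N * (C * (2 ^ m * supSeminorm m f) *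
        (2 ^ m * supSeminorm m g)) := by
        gcongr
        · exact supSeminorm_slice_le _ _ _
        · exact supSeminorm_slice_le _ _ _
    _ = _ := by ring

variable [MeasurableSpace U] [BorelSpace U] (μ : Measure U)
  [μ.HasTemperateGrowth]

theorem integrable_bilin_slice (f : 𝓢(P × V, ℂ)) (g : 𝓢(P' × V', ℂ)) :
    Integrable (fun x => B (slice (τ x) f) (slice (τ' x) g) x) μ := by
  obtain ⟨m, C, h⟩ := exists_norm_bilin_slice_le hB τ τ' μ.integrablePower
  exact ((Measure.integrable_pow_neg_integrablePower μ).const_mul _).mono'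
    (continuous_bilin_slice hB τ τ' f g).aestronglyMeasurable
    (.of_forall fun x => h f g x)

/-- The integral of a bilinear map along slices, `∫ B(f(τ x, ·), g(τ' x, ·))(x) dx`. -/
def sliceIntegral : 𝓢(P × V, ℂ) →ₗ[ℂ] 𝓢(P' × V', ℂ) →ₗ[ℂ] ℂ :=
  LinearMap.mk₂ ℂ (fun f g => ∫ x, B (slice (τ x) f) (slice (τ' x) g) x ∂μ)
    (fun f f' g => by
      simp only [map_add, LinearMap.add_apply, add_apply]
      exact integral_add (integrable_bilin_slice hB τ τ' μ f g)
        (integrable_bilin_slice hB τ τ' μ f' g))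
    (fun c f g => by
      simp only [map_smul, LinearMap.smul_apply, smul_apply]
      exact integral_smul c _)
    (fun f g g' => by
      simp only [map_add, add_apply]
      exact integral_add (integrable_bilin_slice hB τ τ' μ f g)
        (integrable_bilin_slice hB τ τ' μ f g'))
    (fun c f g => by
      simp only [map_smul, smul_apply]
      exact integral_smul c _)

theorem sliceIntegral_apply (f : 𝓢(P × V, ℂ)) (g : 𝓢(P' × V', ℂ)) :
    sliceIntegral hB τ τ' μ f g = ∫ x, B (slice (τ x) f) (slice (τ' x) g) x ∂μ := rfl

theorem exists_norm_sliceIntegral_le : ∃ m C,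
    ∀ (f : 𝓢(P × V, ℂ)) (g : 𝓢(P' × V', ℂ)),
      ‖sliceIntegral hB τ τ' μ f g‖ ≤ C * supSeminorm m f * supSeminorm m g := by
  obtain ⟨m, C, h⟩ := exists_norm_bilin_slice_le hB τ τ' μ.integrablePower
  refine ⟨m, C * ∫ x, (1 + ‖x‖) ^ (-(μ.integrablePower : ℝ)) ∂μ,
    fun f g => ?_⟩
  rw [sliceIntegral_apply]
  calc _ ≤ ∫ x, C * supSeminorm m f * supSeminorm m g *
        (1 + ‖x‖) ^ (-(μ.integrablePower : ℝ)) ∂μ :=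
        norm_integral_le_of_norm_le ((Measure.integrable_pow_neg_integrablePower μ).const_mul _)
          (.of_forall fun x => h f g x)
    _ = _ := by
        rw [integral_const_mul]
        ring

theorem continuous_sliceIntegral_left (f : 𝓢(P × V, ℂ)) :
    Continuous (sliceIntegral hB τ τ' μ f) := by
  obtain ⟨m, C, h⟩ := exists_norm_sliceIntegral_le hB τ τ' μ
  exact continuous_of_norm_le_supSeminorm _ m (C * supSeminorm m f) (h f)

theorem continuous_sliceIntegral_right (g : 𝓢(P' × V', ℂ)) :
    Continuous ((sliceIntegral hB τ τ' μ).flip g) := by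
  obtain ⟨m, C, h⟩ := exists_norm_sliceIntegral_le hB τ τ' μ
  exact continuous_of_norm_le_supSeminorm _ m (C * supSeminorm m g)
    fun f => (h f g).trans_eq (mul_right_comm _ _ _)

theorem integral_bilin_slice_eq [FiniteDimensional ℝ P] [FiniteDimensional ℝ V]
    [FiniteDimensional ℝ P'] [FiniteDimensional ℝ V']
    (R : 𝓢(P × V, ℂ) →ₗ[ℂ] 𝓢(P' × V', ℂ) →ₗ[ℂ] ℂ) (hR : ∀ f, Continuous (R f))
    (hR' : ∀ g, Continuous (R.flip g))
    (h : ∀ f₁ f₂ g₁ g₂, ∫ x, f₁ (τ x) * g₁ (τ' x) * B f₂ g₂ x ∂μ =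
      R (tensor f₁ f₂) (tensor g₁ g₂))
    (f : 𝓢(P × V, ℂ)) (g : 𝓢(P' × V', ℂ)) :
    ∫ x, B (slice (τ x) f) (slice (τ' x) g) x ∂μ = R f g := by
  have hleft : ∀ f₁ f₂ g, sliceIntegral hB τ τ' μ (tensor f₁ f₂) g = R (tensor f₁ f₂) g := by
    intro f₁ f₂ g
    let L : 𝓢(P' × V', ℂ) →L[ℂ] ℂ :=
      ⟨sliceIntegral hB τ τ' μ (tensor f₁ f₂) - R (tensor f₁ f₂),
        (continuous_sliceIntegral_left hB τ τ' μ _).sub (hR _)⟩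
    have hL : L = 0 := eq_zero_of_tensor L fun g₁ g₂ => by
      change sliceIntegral hB τ τ' μ (tensor f₁ f₂) (tensor g₁ g₂) - R _ _ = 0
      rw [sliceIntegral_apply, sub_eq_zero, ← h]
      refine integral_congr_ae (.of_forall fun x => ?_)
      simp only [slice_tensor, map_smul, LinearMap.smul_apply, smul_apply, smul_eq_mul]
      ring
    exact sub_eq_zero.1 (DFunLike.congr_fun hL g)
  let L : 𝓢(P × V, ℂ) →L[ℂ] ℂ :=
    ⟨(sliceIntegral hB τ τ' μ).flip g - R.flip g,
      (continuous_sliceIntegral_right hB τ τ' μ _).sub (hR' _)⟩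
  have hL : L = 0 := eq_zero_of_tensor L fun f₁ f₂ => sub_eq_zero.2 (hleft f₁ f₂ g)
  exact sub_eq_zero.1 (DFunLike.congr_fun hL f)

end SliceIntegral

/-! ### Configurations -/

/-- Pullback of Schwartz functions under a linear equivalence. -/
abbrev pull {V W : Type*} [NormedAddCommGroup V] [NormedSpace ℝ V] [NormedAddCommGroup W]
    [NormedSpace ℝ W] (e : V ≃L[ℝ] W) : 𝓢(W, ℂ) →L[ℂ] 𝓢(V, ℂ) :=
  compCLMOfContinuousLinearEquiv ℂ e

theorem pull_symm_pull {V W : Type*} [NormedAddCommGroup V] [NormedSpace ℝ V]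
    [NormedAddCommGroup W] [NormedSpace ℝ W] (e : V ≃L[ℝ] W) (f : 𝓢(W, ℂ)) :
    pull e.symm (pull e f) = f := by
  ext x
  simp

theorem eq_zero_of_pull_tensor {P V W : Type*} [NormedAddCommGroup P] [NormedSpace ℝ P]
    [FiniteDimensional ℝ P] [NormedAddCommGroup V] [NormedSpace ℝ V] [FiniteDimensional ℝ V]
    [NormedAddCommGroup W] [NormedSpace ℝ W] (e : (P × V) ≃L[ℝ] W) (L : 𝓢(W, ℂ) →L[ℂ] ℂ)
    (hL : ∀ a b, L (pull e.symm (tensor a b)) = 0) : L = 0 := by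
  have hcomp : L.comp (pull e.symm) = 0 := eq_zero_of_tensor _ hL
  ext f
  simpa [pull_symm_pull] using DFunLike.congr_fun hcomp (pull e f)

variable {d : ℕ}

/-- Insertion of a particle at position `β`. -/
def insertEquiv {b : ℕ} (β : Fin (b + 1)) : (E d × X d b) ≃L[ℝ] X d (b + 1) :=
  LinearEquiv.toContinuousLinearEquiv
    (LinearEquiv.symm
      { toFun := fun v => (v β, β.removeNth v)
        map_add' := fun _ _ => rfl
        map_smul' := fun _ _ => rfl
        invFun := fun z => β.insertNth z.1 z.2
        left_inv := fun v => Fin.insertNth_self_removeNth β v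
        right_inv := fun z => by simp })

@[simp]
theorem insertEquiv_apply {b : ℕ} (β : Fin (b + 1)) (z : E d × X d b) :
    insertEquiv β z = (β.insertNth z.1 z.2 : X d (b + 1)) := rfl

/-- The equivalence given by `join`. -/
def joinEquiv {a b n : ℕ} (h : a + b = n) : (X d (a + 1) × X d b) ≃L[ℝ] X d (n + 1) :=
  LinearEquiv.toContinuousLinearEquiv
    (LinearEquiv.symm
      { toFun := fun y => (fun i => y (Fin.cast (by omega) (Fin.castAdd b i)),
          fun j => y (Fin.cast (by omega) (Fin.natAdd (a + 1) j)))
        map_add' := fun _ _ => rfl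
        map_smul' := fun _ _ => rfl
        invFun := fun z => join h z.1 z.2
        left_inv := fun y => by
          subst h
          funext i
          obtain ⟨i, rfl⟩ : ∃ i', i = Fin.cast (by omega) (i' : Fin (a + 1 + b)) :=
            ⟨Fin.cast (by omega) i, by simp⟩
          simp only [join, Fin.cast_cast, Fin.cast_eq_self]
          refine Fin.addCases (fun j => ?_) (fun j => ?_) i
          · rw [Fin.append_left]
          · rw [Fin.append_right]
        right_inv := fun z => by
          ext i : 2
          · simp [join]
          · simp [join] })

@[simp]
theorem joinEquiv_apply {a b n : ℕ} (h : a + b = n) (z : X d (a + 1) × X d b) :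
    joinEquiv h z = join h z.1 z.2 := rfl

/-- The configuration in which the particle `β` of the second group is put at position `α` of the
first group. -/
def moveEquiv {a b n : ℕ} (h : a + b = n) (α : Fin (a + 1)) (β : Fin (b + 1)) :
    (X d a × X d (b + 1)) ≃L[ℝ] X d (n + 1) :=
  ((ContinuousLinearEquiv.refl ℝ (X d a)).prodCongr (insertEquiv β).symm).trans
    ((ContinuousLinearEquiv.prodAssoc ℝ (X d a) (E d) (X d b)).symm.trans
      ((((ContinuousLinearEquiv.prodComm ℝ (X d a) (E d)).trans (insertEquiv α)).prodCongr
        (ContinuousLinearEquiv.refl ℝ (X d b))).trans (joinEquiv h)))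

@[simp]
theorem moveEquiv_apply {a b n : ℕ} (h : a + b = n) (α : Fin (a + 1)) (β : Fin (b + 1))
    (z : X d a × X d (b + 1)) :
    moveEquiv h α β z = join h (α.insertNth (z.2 β) z.1) (β.removeNth z.2) := rfl

/-- The function `v ↦ φ(v_β) G(v_1, …, v_{β-1}, v_{β+1}, …)`. -/
def insertTensor {b : ℕ} (β : Fin (b + 1)) (φ : 𝓢(E d, ℂ)) (G : 𝓢(X d b, ℂ)) :
    𝓢(X d (b + 1), ℂ) :=
  pull (insertEquiv β).symm (tensor φ G)

@[simp]
theorem insertTensor_apply {b : ℕ} (β : Fin (b + 1)) (φ : 𝓢(E d, ℂ)) (G : 𝓢(X d b, ℂ))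
    (v : X d (b + 1)) : insertTensor β φ G v = φ (v β) * G (β.removeNth v) := rfl

theorem eq_of_forall_integral_mul_eq {f g : E d → ℂ} (hf : Continuous f) (hg : Continuous g)
    (h : ∀ φ : 𝓢(E d, ℂ), ∫ u, f u * φ u = ∫ u, g u * φ u) : f = g := by
  have hae : f =ᵐ[volume] g := by
    refine ae_eq_of_integral_contDiff_smul_eq hf.locallyIntegrable hg.locallyIntegrable
      fun ψ hψ hs => ?_
    have hsupp : HasCompactSupport fun v => ((ψ v : ℝ) : ℂ) :=
      hs.comp_left (g := fun r : ℝ => (r : ℂ)) Complex.ofReal_zero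
    have hsmooth : ContDiff ℝ ∞ fun v => ((ψ v : ℝ) : ℂ) :=
      (Complex.ofRealCLM.contDiff (n := ∞)).comp hψ
    simpa [mul_comm] using h (hsupp.toSchwartzMap hsmooth)
  exact (Continuous.ae_eq_iff_eq volume hf hg).1 hae

-- The parameter `y` of the good mapping property is removed by testing at `y = 0` with a function
-- that equals `1` there in the variable `β`.
theorem GoodMapping.exists_bilin {b : ℕ} {K : Ker d b} (hK : GoodMapping K) (β : Fin (b + 1)) :
    ∃ B : 𝓢(X d (b + 1), ℂ) →ₗ[ℂ] 𝓢(X d b, ℂ) →ₗ[ℂ] 𝓢(E d, ℂ),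
      Continuous (fun p : 𝓢(X d (b + 1), ℂ) × 𝓢(X d b, ℂ) => B p.1 p.2) ∧
      ∀ F G φ, K (tensor (insertTensor β φ G) F) = ∫ u, B F G u * φ u := by
  obtain ⟨Φ, hΦ, h⟩ := hK β
  obtain ⟨χ, hχ⟩ := exists_cutoff (E d)
  have hχ0 : χ 0 = 1 := hχ 0 (by simp)
  let T : 𝓢(X d b, ℂ) →L[ℂ] 𝓢(X d (b + 1), ℂ) :=
    (pull (insertEquiv β).symm).comp (tensorLeft χ)
  let S : 𝓢(E d × E d, ℂ) →L[ℂ] 𝓢(E d, ℂ) :=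
    (slice (0 : E d)).comp (pull (ContinuousLinearEquiv.prodComm ℝ (E d) (E d)))
  refine ⟨(Φ.compl₂ T.toLinearMap).compr₂ S.toLinearMap, ?_, fun F G φ => ?_⟩
  · exact S.continuous.comp (hΦ.comp (continuous_fst.prodMk (T.continuous.comp continuous_snd)))
  · refine h F (T G) φ 0 _ fun v w => ?_
    have hT : T G (Function.update v β 0) = G (β.removeNth v) := by
      change χ (Function.update v β 0 β) * G (β.removeNth (Function.update v β 0)) = _
      rw [Function.update_self, hχ0, one_mul, Fin.removeNth_update]
    rw [hT, tensor_apply, insertTensor_apply]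

end

section

open scoped LineDeriv

variable {d : ℕ}

/-! ### Symbols and contractions -/

/-- The function `w ↦ f(x_1, …, w_β, …, x_{a+1}, w_1, …, w_{β-1}, w_{β+1}, …)`, with `w_β` at
position `α`. -/
def outSlice {a b n : ℕ} (h : a + b = n) (α : Fin (a + 1)) (β : Fin (b + 1))
    (f : 𝓢(X d (n + 1), ℂ)) (x : X d (a + 1)) : 𝓢(X d (b + 1), ℂ) :=
  slice (α.removeNth x) (pull (moveEquiv h α β) f)

/-- The function `z ↦ g(x', z)`. -/
def inSlice {a b n : ℕ} (h : a + b = n) (g : 𝓢(X d (n + 1), ℂ)) (x' : X d (a + 1)) :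
    𝓢(X d b, ℂ) :=
  slice x' (pull (joinEquiv h) g)

section Symbols

variable {a b n : ℕ} {h : a + b = n}

theorem outSlice_apply (α : Fin (a + 1)) (β : Fin (b + 1))
    (f : 𝓢(X d (n + 1), ℂ)) (x : X d (a + 1)) (w : X d (b + 1)) :
    outSlice h α β f x w = f (join h (Function.update x α (w β)) (β.removeNth w)) := by
  change f (moveEquiv h α β (α.removeNth x, w)) = _
  rw [moveEquiv_apply, Fin.insertNth_removeNth]

theorem inSlice_apply (g : 𝓢(X d (n + 1), ℂ)) (x' : X d (a + 1)) (z : X d b) :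
    inSlice h g x' z = g (join h x' z) := rfl

variable {B : Ker d b} {α : Fin (a + 1)} {β : Fin (b + 1)} {f g : 𝓢(X d (n + 1), ℂ)}

theorem isSymbol_iff {Φ : Density d a} : IsSymbol h B α β f g Φ ↔ ∀ φ x x',
    B (tensor (insertTensor β φ (inSlice h g x')) (outSlice h α β f x)) =
      ∫ u, Φ (Function.update x α u, x') * φ u := by
  constructor
  · intro hΦ φ x x'
    refine hΦ φ x x' _ fun v w => ?_
    rw [tensor_apply, insertTensor_apply, outSlice_apply, inSlice_apply]
  · intro hΦ φ x x' Θ hΘ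
    rw [← hΦ]
    congr 1
    ext ⟨v, w⟩
    rw [hΘ, tensor_apply, insertTensor_apply, outSlice_apply, inSlice_apply]

theorem continuous_update_apply (Φ : Density d a) (α : Fin (a + 1)) (x x' : X d (a + 1)) :
    Continuous fun u => Φ (Function.update x α u, x') :=
  Φ.continuous.comp (((continuous_const (y := x)).update α continuous_id).prodMk
    (continuous_const (y := x')))

theorem IsSymbol.unique {Φ Φ' : Density d a} (hΦ : IsSymbol h B α β f g Φ)
    (hΦ' : IsSymbol h B α β f g Φ') : Φ = Φ' := by
  ext ⟨x, x'⟩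
  have hcongr := eq_of_forall_integral_mul_eq (continuous_update_apply Φ α x x')
    (continuous_update_apply Φ' α x x')
    fun φ => (isSymbol_iff.1 hΦ φ x x').symm.trans (isSymbol_iff.1 hΦ' φ x x')
  simpa using congrFun hcongr (x α)

theorem IsSymbol.apply_update {Φ : Density d a} (hΦ : IsSymbol h B α β f g Φ)
    {T : 𝓢(X d (b + 1), ℂ) →ₗ[ℂ] 𝓢(X d b, ℂ) →ₗ[ℂ] 𝓢(E d, ℂ)}
    (hT : ∀ F G φ, B (tensor (insertTensor β φ G) F) = ∫ u, T F G u * φ u)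
    (x x' : X d (a + 1)) (u : E d) :
    Φ (Function.update x α u, x') = T (outSlice h α β f x) (inSlice h g x') u :=
  congrFun (eq_of_forall_integral_mul_eq (continuous_update_apply Φ α x x')
    (SchwartzMap.continuous _)
    fun φ => (isSymbol_iff.1 hΦ φ x x').symm.trans (hT _ _ _)) u

theorem isSymbol_tensor {T : 𝓢(X d (b + 1), ℂ) →ₗ[ℂ] 𝓢(X d b, ℂ) →ₗ[ℂ] 𝓢(E d, ℂ)}
    (hT : ∀ F G φ, B (tensor (insertTensor β φ G) F) = ∫ u, T F G u * φ u)
    (f₁ : 𝓢(X d a, ℂ)) (f₂ : 𝓢(X d (b + 1), ℂ)) (g₁ : 𝓢(X d (a + 1), ℂ)) (g₂ : 𝓢(X d b, ℂ)) :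
    IsSymbol h B α β (pull (moveEquiv h α β).symm (tensor f₁ f₂))
      (pull (joinEquiv h).symm (tensor g₁ g₂))
      (tensor (insertTensor α (T f₂ g₂) f₁) g₁) := by
  refine isSymbol_iff.2 fun φ x x' => ?_
  have hout : outSlice h α β (pull (moveEquiv h α β).symm (tensor f₁ f₂)) x =
      f₁ (α.removeNth x) • f₂ := by
    ext w
    simp only [outSlice, slice_apply, compCLMOfContinuousLinearEquiv_apply, Function.comp_apply,
      ContinuousLinearEquiv.symm_apply_apply, tensor_apply, smul_apply, smul_eq_mul]
  have hin : inSlice h (pull (joinEquiv h).symm (tensor g₁ g₂)) x' = g₁ x' • g₂ := by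
    ext w
    simp only [inSlice, slice_apply, compCLMOfContinuousLinearEquiv_apply, Function.comp_apply,
      ContinuousLinearEquiv.symm_apply_apply, tensor_apply, smul_apply, smul_eq_mul]
  rw [hout, hin, hT]
  refine integral_congr_ae (.of_forall fun u => ?_)
  simp only [map_smul, LinearMap.smul_apply, smul_apply, smul_eq_mul, tensor_apply,
    insertTensor_apply, Function.update_self, Fin.removeNth_update]
  ring

theorem IsContraction.unique (hB : GoodMapping B) {A : Ker d a} {C C' : Ker d n}
    (hC : IsContraction h A B α β C) (hC' : IsContraction h A B α β C') : C = C' := by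
  obtain ⟨T, -, hT⟩ := hB.exists_bilin β
  rw [← sub_eq_zero]
  refine eq_zero_of_tensor _ fun g f => ?_
  have hright : ∀ g₁ g₂, (C - C') (tensor (pull (joinEquiv h).symm (tensor g₁ g₂)) f) = 0 := by
    intro g₁ g₂
    refine DFunLike.congr_fun (eq_zero_of_pull_tensor (moveEquiv h α β) ((C - C').comp
      (tensorLeft (pull (joinEquiv h).symm (tensor g₁ g₂)))) fun f₁ f₂ => ?_) f
    have hΦ := isSymbol_tensor (h := h) (α := α) hT f₁ f₂ g₁ g₂
    exact sub_eq_zero.2 <| (hC _ _ _ hΦ _ fun _ _ => tensor_apply _ _ _).trans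
      (hC' _ _ _ hΦ _ fun _ _ => tensor_apply _ _ _).symm
  exact DFunLike.congr_fun (eq_zero_of_pull_tensor (joinEquiv h) ((C - C').comp
    (tensorRight f)) hright) g

theorem contraction_eq (hB : GoodMapping B) {A : Ker d a} {C : Ker d n}
    (hC : IsContraction h A B α β C) : contraction h A B α β = C := by
  have hex : ∃ C, IsContraction h A B α β C := ⟨C, hC⟩
  rw [contraction, dif_pos hex]
  exact hex.choose_spec.unique hB hC

theorem goodMapping_zero : GoodMapping (0 : Ker d b) := by
  intro α
  refine ⟨0, by simpa using continuous_const, fun f g φ y Θ _ => ?_⟩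
  simp

theorem contraction_zero_left (hB : GoodMapping B) :
    contraction h (0 : Ker d a) B α β = 0 :=
  contraction_eq hB fun _ _ _ _ _ _ => rfl

theorem IsSymbol.eq_zero {Φ : Density d a} (hΦ : IsSymbol h (0 : Ker d b) α β f g Φ) : Φ = 0 :=
  hΦ.unique (isSymbol_iff.2 fun φ x x' => by simp)

theorem contraction_zero_right (A : Ker d a) :
    contraction h A (0 : Ker d b) α β = 0 := by
  refine contraction_eq goodMapping_zero fun f g Φ hΦ Θ _ => ?_
  simp [hΦ.eq_zero]

theorem IsContraction.smul_left {A : Ker d a} {C : Ker d n} (hC : IsContraction h A B α β C)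
    (c : ℂ) : IsContraction h (c • A) B α β (c • C) :=
  fun f g Φ hΦ Θ hΘ => congrArg (c • ·) (hC f g Φ hΦ Θ hΘ)

theorem IsContraction.smul_right {A : Ker d a} {C : Ker d n} (hC : IsContraction h A B α β C)
    (c : ℂ) : IsContraction h A (c • B) α β (c • C) := by
  intro f g Φ hΦ Θ hΘ
  rcases eq_or_ne c 0 with rfl | hc
  · have hΦ0 : Φ = 0 := IsSymbol.eq_zero (zero_smul ℂ B ▸ hΦ)
    rw [hΦ0]
    exact (zero_mul (C Θ)).trans (map_zero A).symm
  · have hΦ' : IsSymbol h B α β f g (c⁻¹ • Φ) := by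
      refine isSymbol_iff.2 fun φ x x' => ?_
      have hscaled := isSymbol_iff.1 hΦ φ x x'
      simp only [smul_apply, smul_eq_mul, mul_assoc, integral_const_mul] at hscaled ⊢
      rw [← hscaled, inv_mul_cancel_left₀ hc]
    rw [smul_apply, hC f g _ hΦ' Θ hΘ, map_smul, map_smul, smul_inv_smul₀ hc]

theorem isContraction_of_isSymbol {A : Ker d a} (C : Ker d n)
    (Ψ : 𝓢(X d (n + 1), ℂ) → 𝓢(X d (n + 1), ℂ) → Density d a)
    (hΨ : ∀ f g, IsSymbol h B α β f g (Ψ f g))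
    (hA : ∀ f g, C (tensor g f) = A (transpose (Ψ f g))) :
    IsContraction h A B α β C := by
  intro f g Φ hΦ Θ hΘ
  rw [hΦ.unique (hΨ f g), ← hA]
  congr 1
  ext ⟨x, x'⟩
  rw [hΘ, tensor_apply]

end Symbols

/-! ### Directional Laplacians -/

/-- The Laplacian in the variable `y ∈ ℝ^d` of `y ↦ f(x + ι y)`, at `y = 0`. -/
def lapAlong {V : Type*} [NormedAddCommGroup V] [NormedSpace ℝ V] (ι : E d →L[ℝ] V) :
    𝓢(V, ℂ) →L[ℂ] 𝓢(V, ℂ) :=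
  ∑ i : Fin d, LineDeriv.lineDerivOpCLM ℂ 𝓢(V, ℂ) (ι (EuclideanSpace.single i 1)) ∘L
    LineDeriv.lineDerivOpCLM ℂ 𝓢(V, ℂ) (ι (EuclideanSpace.single i 1))

theorem lineDerivOp_lineDerivOp_apply {V : Type*} [NormedAddCommGroup V] [NormedSpace ℝ V]
    (f : 𝓢(V, ℂ)) (x m : V) :
    ∂_{m} (∂_{m} f) x = deriv (deriv fun t : ℝ => f (x + t • m)) 0 := by
  have hderiv : (deriv fun t : ℝ => f (x + t • m)) = fun t : ℝ => (∂_{m} f) (x + t • m) := by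
    funext t
    rw [lineDerivOp_apply_eq_fderiv]
    have hline : HasDerivAt (fun t : ℝ => x + t • m) m t := by
      simpa using ((hasDerivAt_id t).smul_const m).const_add x
    exact (f.differentiableAt.hasFDerivAt.comp_hasDerivAt t hline).deriv
  rw [hderiv, lineDerivOp_apply]
  rfl

theorem lapAlong_apply {V : Type*} [NormedAddCommGroup V] [NormedSpace ℝ V] (ι : E d →L[ℝ] V)
    (f : 𝓢(V, ℂ)) (x : V) : lapAlong ι f x =
      ∑ i, deriv (deriv fun t : ℝ => f (x + ι (t • EuclideanSpace.single i 1))) 0 := by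
  simp only [lapAlong, sum_apply, map_smul]
  exact Finset.sum_congr rfl fun i _ => lineDerivOp_lineDerivOp_apply _ _ _

theorem lapAlong_apply_congr {V W : Type*} [NormedAddCommGroup V] [NormedSpace ℝ V]
    [NormedAddCommGroup W] [NormedSpace ℝ W] {ι : E d →L[ℝ] V} {ι' : E d →L[ℝ] W}
    {f : 𝓢(V, ℂ)} {g : 𝓢(W, ℂ)} {x : V} {x' : W} (c : ℂ)
    (h : ∀ y, f (x + ι y) = c * g (x' + ι' y)) : lapAlong ι f x = c * lapAlong ι' g x' := by
  simp only [lapAlong_apply, Finset.mul_sum, h]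
  refine Finset.sum_congr rfl fun i _ => ?_
  rw [← deriv_const_mul_field]
  congr 1
  funext t
  rw [← deriv_const_mul_field]

theorem lapAlong_pull {V W : Type*} [NormedAddCommGroup V] [NormedSpace ℝ V]
    [NormedAddCommGroup W] [NormedSpace ℝ W] (e : V ≃L[ℝ] W) (ι : E d →L[ℝ] V) (f : 𝓢(W, ℂ)) :
    lapAlong ι (pull e f) = pull e (lapAlong ((e : V →L[ℝ] W).comp ι) f) := by
  ext x
  simp only [compCLMOfContinuousLinearEquiv_apply, Function.comp_apply]
  rw [← one_mul (lapAlong ((e : V →L[ℝ] W).comp ι) f (e x))]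
  exact lapAlong_apply_congr 1 fun y => by simp

theorem integral_lapAlong_mul {V : Type*} [NormedAddCommGroup V] [NormedSpace ℝ V]
    [FiniteDimensional ℝ V] [MeasurableSpace V] [BorelSpace V] (μ : Measure V)
    [μ.IsAddHaarMeasure] (ι : E d →L[ℝ] V) (f g : 𝓢(V, ℂ)) :
    ∫ x, lapAlong ι f x * g x ∂μ = ∫ x, f x * lapAlong ι g x ∂μ := by
  have hint : ∀ f g : 𝓢(V, ℂ), Integrable (fun x => f x * g x) μ := fun f g =>
    (pairing (ContinuousLinearMap.mul ℂ ℂ) f g).integrable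
  simp only [lapAlong, sum_apply, Finset.sum_mul, Finset.mul_sum]
  rw [integral_finsetSum _ fun i _ => hint _ _, integral_finsetSum _ fun i _ => hint _ _]
  refine Finset.sum_congr rfl fun i _ => ?_
  set m := ι (EuclideanSpace.single i 1)
  change ∫ x, ∂_{m} (∂_{m} f) x * g x ∂μ = ∫ x, f x * ∂_{m} (∂_{m} g) x ∂μ
  rw [integral_mul_lineDerivOp_right_eq_neg_left, ← neg_eq_iff_eq_neg,
    ← integral_mul_lineDerivOp_right_eq_neg_left]

end

section

variable {d : ℕ}

/-! ### Contractions with diagonal operators -/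

/-- The diagonal embedding `u ↦ (u, …, u)`. -/
def constConf (d m : ℕ) : E d →L[ℝ] X d m :=
  ContinuousLinearMap.pi fun _ => ContinuousLinearMap.id ℝ (E d)

/-- The linear map `(v; w) ↦ (v_β, …, v_β, v_1, …; v_β, …, w_β, …, v_β, w_1, …)`, where the
variables `v_β` and `w_β` are omitted from the last groups and `w_β` stands at position `α`. If `A'`
is concentrated on the diagonal, then pulling `g ⊗ f` back under it turns `A' ∘_α^β A` into `A`. -/
def swapMap {a b n : ℕ} (h : a + b = n) (α : Fin (a + 1)) (β : Fin (b + 1)) :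
    (X d (b + 1) × X d (b + 1)) →L[ℝ] X d (n + 1) × X d (n + 1) :=
  let v : (X d (b + 1) × X d (b + 1)) →L[ℝ] E d × X d b :=
    ((insertEquiv (d := d) β).symm : X d (b + 1) →L[ℝ] E d × X d b).comp
      (ContinuousLinearMap.fst ℝ (X d (b + 1)) (X d (b + 1)))
  let w : (X d (b + 1) × X d (b + 1)) →L[ℝ] X d (b + 1) :=
    ContinuousLinearMap.snd ℝ (X d (b + 1)) (X d (b + 1))
  ((joinEquiv (d := d) h : (X d (a + 1) × X d b) →L[ℝ] X d (n + 1)).comp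
    (((constConf d (a + 1)).comp ((ContinuousLinearMap.fst ℝ (E d) (X d b)).comp v)).prod
      ((ContinuousLinearMap.snd ℝ (E d) (X d b)).comp v))).prod
  ((moveEquiv (d := d) h α β : (X d a × X d (b + 1)) →L[ℝ] X d (n + 1)).comp
    (((constConf d a).comp ((ContinuousLinearMap.fst ℝ (E d) (X d b)).comp v)).prod w))

theorem swapMap_apply {a b n : ℕ} (h : a + b = n) (α : Fin (a + 1)) (β : Fin (b + 1))
    (v w : X d (b + 1)) : swapMap h α β (v, w) =
      (joinEquiv h (fun _ => v β, β.removeNth v), moveEquiv h α β (fun _ => v β, w)) := rfl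

theorem exists_antilipschitz {V W : Type*} [NormedAddCommGroup V] [NormedSpace ℝ V]
    [FiniteDimensional ℝ V] [NormedAddCommGroup W] [NormedSpace ℝ W] (T : V →L[ℝ] W)
    (hT : Function.Injective T) : ∃ K, AntilipschitzWith K T := by
  obtain ⟨K, -, h⟩ := (T : V →ₗ[ℝ] W).exists_antilipschitzWith (LinearMap.ker_eq_bot.2 hT)
  exact ⟨K, h⟩

/-- Pullback of Schwartz functions under an injective linear map. -/
def restrict {V W : Type*} [NormedAddCommGroup V] [NormedSpace ℝ V]
    [FiniteDimensional ℝ V] [NormedAddCommGroup W] [NormedSpace ℝ W] (T : V →L[ℝ] W)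
    (hT : Function.Injective T) : 𝓢(W, ℂ) →L[ℂ] 𝓢(V, ℂ) :=
  compCLMOfAntilipschitz ℂ T.hasTemperateGrowth (exists_antilipschitz T hT).choose_spec

@[simp]
theorem restrict_apply {V W : Type*} [NormedAddCommGroup V] [NormedSpace ℝ V]
    [FiniteDimensional ℝ V] [NormedAddCommGroup W] [NormedSpace ℝ W] (T : V →L[ℝ] W)
    (hT : Function.Injective T) (f : 𝓢(W, ℂ)) (v : V) : restrict T hT f v = f (T v) := rfl

theorem swapMap_injective {a b n : ℕ} (h : a + b = n) (α : Fin (a + 1)) (β : Fin (b + 1)) :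
    Function.Injective (swapMap (d := d) h α β) := by
  rintro ⟨v, w⟩ ⟨v', w'⟩ hv
  rw [swapMap_apply, swapMap_apply, Prod.mk.injEq] at hv
  obtain ⟨hβ, hrest⟩ := Prod.mk.inj ((joinEquiv h).injective hv.1)
  have hvv' : (insertEquiv β).symm v = (insertEquiv β).symm v' :=
    Prod.ext (congrFun hβ 0) hrest
  obtain ⟨-, hww'⟩ := Prod.mk.inj ((moveEquiv h α β).injective hv.2)
  rw [(insertEquiv β).symm.injective hvv', hww']

/-- Pullback of density kernels under `swapMap`. -/
def swapDensity {a b n : ℕ} (h : a + b = n) (α : Fin (a + 1)) (β : Fin (b + 1)) :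
    Density d n →L[ℂ] Density d b :=
  restrict (swapMap h α β) (swapMap_injective h α β)

/-- Restriction of a function of `(y; x)`, with `a` and `a + 1` particles respectively, to the
configurations in which all these particles are at the same place. -/
def restrictDiag (d a : ℕ) : 𝓢(X d a × X d (a + 1), ℂ) →L[ℂ] 𝓢(E d, ℂ) :=
  restrict ((constConf d a).prod (constConf d (a + 1)))
    fun _ _ hu => congrFun (Prod.mk.inj hu).2 0

theorem restrictDiag_apply {a : ℕ} (f : 𝓢(X d a × X d (a + 1), ℂ)) (u : E d) :
    restrictDiag d a f u = f (fun _ => u, fun _ => u) := rfl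

section Diagonal

variable {a b n : ℕ} {h : a + b = n} {α : Fin (a + 1)} {β : Fin (b + 1)}

theorem swapDensity_tensor (f₁ : 𝓢(X d a, ℂ)) (f₂ : 𝓢(X d (b + 1), ℂ))
    (g₁ : 𝓢(X d (a + 1), ℂ)) (g₂ : 𝓢(X d b, ℂ)) :
    swapDensity h α β (tensor (pull (joinEquiv h).symm (tensor g₁ g₂))
      (pull (moveEquiv h α β).symm (tensor f₁ f₂))) =
      tensor (insertTensor β (restrictDiag d a (tensor f₁ g₁)) g₂) f₂ := by
  ext ⟨v, w⟩
  simp only [swapDensity, restrict_apply, swapMap_apply, tensor_apply, insertTensor_apply,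
    compCLMOfContinuousLinearEquiv_apply, Function.comp_apply,
    ContinuousLinearEquiv.symm_apply_apply, restrictDiag_apply]
  ring

variable {A : Ker d b} {T : 𝓢(X d (b + 1), ℂ) →ₗ[ℂ] 𝓢(X d b, ℂ) →ₗ[ℂ] 𝓢(E d, ℂ)}
  {D : 𝓢(E d, ℂ) →L[ℂ] 𝓢(E d, ℂ)} {D' : Density d b →L[ℂ] Density d b}

theorem integral_outSlice_inSlice
    (hTc : Continuous fun p : 𝓢(X d (b + 1), ℂ) × 𝓢(X d b, ℂ) => T p.1 p.2)
    (hT : ∀ F G φ, A (tensor (insertTensor β φ G) F) = ∫ u, T F G u * φ u)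
    (hD : ∀ φ ψ, ∫ u, D φ u * ψ u = ∫ u, φ u * D ψ u)
    (hD' : ∀ φ G F, D' (tensor (insertTensor β φ G) F) = tensor (insertTensor β (D φ) G) F)
    (f g : 𝓢(X d (n + 1), ℂ)) :
    ∫ u, D (T (outSlice h α β f fun _ => u) (inSlice h g fun _ => u)) u =
      A (D' (swapDensity h α β (tensor g f))) := by
  let C : Ker d n := A.comp (D'.comp (swapDensity h α β))
  let R : 𝓢(X d a × X d (b + 1), ℂ) →ₗ[ℂ] 𝓢(X d (a + 1) × X d b, ℂ) →ₗ[ℂ] ℂ :=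
    LinearMap.compr₂ ((tensor.compl₁₂ (pull (joinEquiv (d := d) h).symm).toLinearMap
      (pull (moveEquiv (d := d) h α β).symm).toLinearMap).flip) C.toLinearMap
  have hR : ∀ f g, R f g = A (D' (swapDensity h α β
    (tensor (pull (joinEquiv h).symm g) (pull (moveEquiv h α β).symm f)))) := fun _ _ => rfl
  have hslice := integral_bilin_slice_eq (B := T.compr₂ D.toLinearMap) (D.continuous.comp hTc)
    (constConf d a) (constConf d (a + 1)) volume R
    (fun f => C.continuous.comp
      ((tensorRight (pull (moveEquiv h α β).symm f)).continuous.comp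
        (pull (joinEquiv h).symm).continuous))
    (fun g => C.continuous.comp
      ((tensorLeft (pull (joinEquiv h).symm g)).continuous.comp
        (pull (moveEquiv h α β).symm).continuous))
    (fun f₁ f₂ g₁ g₂ => by
      rw [hR, swapDensity_tensor, hD', hT, ← hD]
      exact integral_congr_ae (.of_forall fun u => mul_comm _ _))
    (pull (moveEquiv h α β) f) (pull (joinEquiv h) g)
  rwa [hR, pull_symm_pull, pull_symm_pull] at hslice

theorem isContraction_diagonal {A' : Ker d a} (hA : GoodMapping A)
    (hD : ∀ φ ψ, ∫ u, D φ u * ψ u = ∫ u, φ u * D ψ u)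
    (hD' : ∀ φ G F, D' (tensor (insertTensor β φ G) F) = tensor (insertTensor β (D φ) G) F)
    (hA' : ∀ (Φ : Density d a) (s : E d → 𝓢(E d, ℂ)),
      (∀ u y, s u y = Φ (Function.update (fun _ => u) α y, fun _ => u)) →
      A' (transpose Φ) = ∫ u, D (s u) u) :
    IsContraction h A' A α β (A.comp (D'.comp (swapDensity h α β))) := by
  intro f g Φ hΦ Θ hΘ
  obtain ⟨T, hTc, hT⟩ := hA.exists_bilin β
  have hΘ' : Θ = tensor g f := by
    ext ⟨x, x'⟩
    rw [hΘ, tensor_apply]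
  rw [hA' Φ _ fun u y => (hΦ.apply_update hT _ _ _).symm,
    integral_outSlice_inSlice hTc hT hD hD' f g, hΘ']
  rfl

end Diagonal

end

section

variable {d : ℕ}

/-! ### The Laplacian and the collision operator on kernels -/

/-- The directions of the variable `x_α` of a kernel. -/
def leftDir {n : ℕ} (α : Fin (n + 1)) : E d →L[ℝ] X d (n + 1) × X d (n + 1) :=
  (ContinuousLinearMap.single ℝ (fun _ => E d) α).prod 0

/-- The directions of the variable `x'_α` of a kernel. -/
def rightDir {n : ℕ} (α : Fin (n + 1)) : E d →L[ℝ] X d (n + 1) × X d (n + 1) :=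
  (0 : E d →L[ℝ] X d (n + 1)).prod (ContinuousLinearMap.single ℝ (fun _ => E d) α)

theorem add_single_eq_update {n : ℕ} (x : X d (n + 1)) (α : Fin (n + 1)) (y : E d) :
    x + Pi.single α y = Function.update x α (x α + y) := by
  funext i
  rcases eq_or_ne i α with rfl | hi
  · simp
  · simp [hi]

theorem add_leftDir {n : ℕ} (x x' : X d (n + 1)) (α : Fin (n + 1)) (y : E d) :
    (x, x') + leftDir α y = (Function.update x α (x α + y), x') := by
  rw [← add_single_eq_update]
  exact Prod.ext rfl (add_zero x')

theorem add_rightDir {n : ℕ} (x x' : X d (n + 1)) (α : Fin (n + 1)) (y : E d) :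
    (x, x') + rightDir α y = (x, Function.update x' α (x' α + y)) := by
  rw [← add_single_eq_update]
  exact Prod.ext (add_zero x) rfl

theorem lapAlong_rightDir_transpose {n : ℕ} (γ : Density d n) (α : Fin (n + 1)) :
    lapAlong (rightDir α) (transpose γ) = transpose (lapAlong (leftDir α) γ) :=
  lapAlong_pull _ _ γ

theorem lapAlong_leftDir_transpose {n : ℕ} (γ : Density d n) (α : Fin (n + 1)) :
    lapAlong (leftDir α) (transpose γ) = transpose (lapAlong (rightDir α) γ) :=
  lapAlong_pull _ _ γ

/-- The linear map `x ↦ (x_1, …, x_{n+1}, e x)`. -/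
def snocMap {V : Type*} [NormedAddCommGroup V] [NormedSpace ℝ V] {n : ℕ}
    (p : V →L[ℝ] X d (n + 1)) (e : V →L[ℝ] E d) : V →L[ℝ] X d (n + 2) :=
  ContinuousLinearMap.pi (Fin.snoc (α := fun _ => V →L[ℝ] E d)
    (fun i => (ContinuousLinearMap.proj i).comp p) e)

theorem snocMap_apply {V : Type*} [NormedAddCommGroup V] [NormedSpace ℝ V] {n : ℕ}
    (p : V →L[ℝ] X d (n + 1)) (e : V →L[ℝ] E d) (v : V) :
    snocMap p e v = (Fin.snoc (p v) (e v) : X d (n + 2)) := by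
  funext i
  refine Fin.lastCases ?_ (fun j => ?_) i
  · simp [snocMap]
  · simp [snocMap]

/-- The linear map `(x; x') ↦ (x, e; x', e)`, where `e` is a linear function of `(x; x')`. -/
def collMap {n : ℕ} (e : X d (n + 1) × X d (n + 1) →L[ℝ] E d) :
    X d (n + 1) × X d (n + 1) →L[ℝ] X d (n + 2) × X d (n + 2) :=
  (snocMap (ContinuousLinearMap.fst ℝ _ _) e).prod (snocMap (ContinuousLinearMap.snd ℝ _ _) e)

theorem collMap_apply {n : ℕ} (e : X d (n + 1) × X d (n + 1) →L[ℝ] E d) (x x' : X d (n + 1)) :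
    collMap e (x, x') = ((Fin.snoc x (e (x, x')) : X d (n + 2)),
      (Fin.snoc x' (e (x, x')) : X d (n + 2))) :=
  Prod.ext (snocMap_apply _ _ _) (snocMap_apply _ _ _)

theorem collMap_injective {n : ℕ} (e : X d (n + 1) × X d (n + 1) →L[ℝ] E d) :
    Function.Injective (collMap e) := by
  rintro ⟨x, x'⟩ ⟨y, y'⟩ h
  rw [collMap_apply, collMap_apply, Prod.mk.injEq] at h
  rw [(Fin.snoc_inj.1 h.1).1, (Fin.snoc_inj.1 h.2).1]

/-- The variable `x_α`. -/
def leftVar {n : ℕ} (α : Fin (n + 1)) : X d (n + 1) × X d (n + 1) →L[ℝ] E d :=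
  (ContinuousLinearMap.proj α).comp (ContinuousLinearMap.fst ℝ _ _)

/-- The variable `x'_α`. -/
def rightVar {n : ℕ} (α : Fin (n + 1)) : X d (n + 1) × X d (n + 1) →L[ℝ] E d :=
  (ContinuousLinearMap.proj α).comp (ContinuousLinearMap.snd ℝ _ _)

/-- The map `γ ↦ γ(x, e; x', e)`; for `e = x_α` and `e = x'_α` it is `B^±_{α;n+2}`. -/
def coll {n : ℕ} (e : X d (n + 1) × X d (n + 1) →L[ℝ] E d) :
    Density d (n + 1) →L[ℂ] Density d n :=
  restrict (collMap e) (collMap_injective e)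

theorem coll_apply {n : ℕ} (e : X d (n + 1) × X d (n + 1) →L[ℝ] E d) (γ : Density d (n + 1))
    (x x' : X d (n + 1)) : coll e γ (x, x') = γ ((Fin.snoc x (e (x, x')) : X d (n + 2)),
      (Fin.snoc x' (e (x, x')) : X d (n + 2))) := by
  rw [coll, restrict_apply, collMap_apply]

theorem coll_rightVar_transpose {n : ℕ} (γ : Density d (n + 1)) (α : Fin (n + 1)) :
    coll (rightVar α) (transpose γ) = transpose (coll (leftVar α) γ) := by
  ext ⟨x, x'⟩
  change _ = coll (leftVar α) γ (x', x)
  rw [coll_apply, coll_apply]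
  rfl

end

section

variable {d : ℕ}

/-! ### The good mapping property of the Gross–Pitaevskii generator -/

theorem constConf_injective (m : ℕ) : Function.Injective (constConf d (m + 1)) :=
  fun _ _ h => congrFun h 0

theorem diagIntegral_apply {n : ℕ} (Θ : Density d n) :
    diagIntegral d n Θ = ∫ u, Θ (fun _ => u, fun _ => u) := rfl

theorem update_fin_one (v : X d (0 + 1)) (α : Fin (0 + 1)) (y : E d) :
    Function.update v α y = fun _ => y := by
  funext i
  obtain rfl : i = α := by omega
  exact Function.update_self (β := fun _ => E d) i y v

theorem rightDir_zero_single (i : Fin d) :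
    rightDir (0 : Fin (0 + 1)) (EuclideanSpace.single i 1) = inputDir d i :=
  Prod.ext rfl (update_fin_one 0 0 _)

theorem negLaplacian_apply (Θ : Density d 0) :
    negLaplacian d Θ =
      - ∫ u, lapAlong (rightDir (0 : Fin (0 + 1))) Θ (fun _ => u, fun _ => u) := by
  rw [← diagIntegral_apply, lapAlong, negLaplacian]
  simp only [neg_apply, sum_apply, map_sum, rightDir_zero_single]
  rfl

theorem add_rightDir_zero (u y : E d) :
    ((fun _ => u, fun _ => u) : X d (0 + 1) × X d (0 + 1)) + rightDir 0 y =
      (fun _ => u, fun _ => u + y) := by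
  rw [add_rightDir, update_fin_one]

theorem delta_apply (Θ : Density d 1) : delta d Θ = ∫ u, Θ (fun _ => u, fun _ => u) := rfl

theorem goodMapping_negLaplacian : GoodMapping (negLaplacian d) := by
  intro α
  let S : 𝓢(X d (0 + 1), ℂ) →L[ℂ] 𝓢(E d, ℂ) := restrict _ (constConf_injective 0)
  let T : 𝓢(X d (0 + 1), ℂ) →L[ℂ] 𝓢(E d, ℂ) := -(S.comp (lapAlong (constConf d (0 + 1))))
  refine ⟨tensor.compl₁₂ T.toLinearMap S.toLinearMap, ?_, fun f g φ y Θ hΘ => ?_⟩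
  · exact continuous_tensor.comp ((T.continuous.comp continuous_fst).prodMk
      (S.continuous.comp continuous_snd))
  · rw [negLaplacian_apply, ← integral_neg]
    refine integral_congr_ae (.of_forall fun u => ?_)
    have hlap : lapAlong (rightDir 0) Θ (fun _ => u, fun _ => u) =
        φ u * g (fun _ => y) * lapAlong (constConf d (0 + 1)) f fun _ => u := by
      refine lapAlong_apply_congr _ fun z => ?_
      rw [add_rightDir_zero, hΘ, update_fin_one]
      rfl
    change -_ = (-lapAlong (constConf d (0 + 1)) f (fun _ => u)) * g (fun _ => y) * φ u
    rw [hlap]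
    ring

/-- The linear map `(u, y) ↦ ((u, …, y, …, u), (u, …, u))`, with `y` at position `α`. -/
def exchangeMap {n : ℕ} (α : Fin (n + 1)) : (E d × E d) →L[ℝ] X d (n + 1) × X d (n + 1) :=
  (ContinuousLinearMap.pi fun i => if i = α then ContinuousLinearMap.snd ℝ (E d) (E d) else
    ContinuousLinearMap.fst ℝ (E d) (E d)).prod
    ((constConf d (n + 1)).comp (ContinuousLinearMap.fst ℝ (E d) (E d)))

theorem exchangeMap_apply {n : ℕ} (α : Fin (n + 1)) (u y : E d) :
    exchangeMap α (u, y) = (Function.update (fun _ => u) α y, fun _ => u) := by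
  refine Prod.ext ?_ rfl
  funext i
  rcases eq_or_ne i α with rfl | hi
  · simp [exchangeMap]
  · simp [exchangeMap, hi]

theorem exchangeMap_injective {n : ℕ} (α : Fin (n + 1)) :
    Function.Injective (exchangeMap (d := d) α) := by
  rintro ⟨u, y⟩ ⟨u', y'⟩ h
  rw [exchangeMap_apply, exchangeMap_apply, Prod.mk.injEq] at h
  have hy : y = y' := by simpa using congrFun h.1 α
  rw [hy, congrFun h.2 0]

theorem goodMapping_delta : GoodMapping (delta d) := by
  intro α
  let S : Density d 1 →L[ℂ] 𝓢(E d × E d, ℂ) := restrict _ (exchangeMap_injective α)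
  refine ⟨(LinearMap.flip tensor).compr₂ S.toLinearMap, ?_, fun f g φ y Θ hΘ => ?_⟩
  · exact S.continuous.comp (continuous_tensor.comp (continuous_snd.prodMk continuous_fst))
  · rw [delta_apply]
    refine integral_congr_ae (.of_forall fun u => ?_)
    change _ = tensor g f (exchangeMap α (u, y)) * φ u
    dsimp only
    rw [hΘ, exchangeMap_apply, tensor_apply]
    ring

theorem GoodMapping.smul {n : ℕ} {K : Ker d n} (hK : GoodMapping K) (c : ℂ) :
    GoodMapping (c • K) := by
  intro α
  obtain ⟨Φ, hΦ, h⟩ := hK α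
  refine ⟨c • Φ, hΦ.const_smul c, fun f g φ y Θ hΘ => ?_⟩
  change c • K Θ = _
  rw [h f g φ y Θ hΘ, ← integral_smul]
  refine integral_congr_ae (.of_forall fun u => ?_)
  simp [mul_assoc]

theorem GoodMapping.add {n : ℕ} {K K' : Ker d n} (hK : GoodMapping K) (hK' : GoodMapping K') :
    GoodMapping (K + K') := by
  intro α
  obtain ⟨Φ, hΦ, h⟩ := hK α
  obtain ⟨Φ', hΦ', h'⟩ := hK' α
  refine ⟨Φ + Φ', hΦ.add hΦ', fun f g φ y Θ hΘ => ?_⟩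
  have hint : ∀ F : 𝓢(E d × E d, ℂ), Integrable (fun u => F (u, y) * φ u) := fun F =>
    (pairing (ContinuousLinearMap.mul ℂ ℂ)
      (slice y (pull (ContinuousLinearEquiv.prodComm ℝ (E d) (E d)) F)) φ).integrable
  change K Θ + K' Θ = _
  rw [h f g φ y Θ hΘ, h' f g φ y Θ hΘ, ← integral_add (hint _) (hint _)]
  refine integral_congr_ae (.of_forall fun u => ?_)
  simp [add_mul]

/-! ### Contractions with the Gross–Pitaevskii generator -/

theorem join_zero_right {a : ℕ} (h : a + 0 = a) (x : X d (a + 1)) (z : X d 0) :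
    join h x z = x := by
  funext i
  exact Fin.append_left x z i

theorem join_one_right {a : ℕ} (h : a + 1 = a + 1) (x : X d (a + 1)) (z : X d 1) :
    join h x z = (Fin.snoc x (z 0) : X d (a + 2)) :=
  Fin.append_right_eq_snoc x z

theorem join_zero_left {b : ℕ} (h : 0 + b = b) (x : X d (0 + 1)) (z : X d b) :
    join h x z = (Fin.cons (x 0) z : X d (b + 1)) := by
  funext i
  simp only [join]
  rw [Fin.append_left_eq_cons]
  rfl

theorem join_one_left {b : ℕ} (h : 1 + b = b + 1) (x : X d (1 + 1)) (z : X d b) :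
    join h x z = (Fin.cons (x 0) (Fin.cons (x 1) z : X d (b + 1)) : X d (b + 2)) := by
  funext i
  refine Fin.cases ?_ (fun i => Fin.cases ?_ (fun j => ?_) i) i
  · exact Fin.append_left x z 0
  · exact Fin.append_left x z 1
  · simp only [join, Fin.cons_succ]
    rw [← Fin.append_right x z j]
    congr 1
    ext
    simp
    omega

theorem tensor_comm_eq_transpose {n : ℕ} (f g : 𝓢(X d (n + 1), ℂ)) :
    tensor g f = transpose (tensor f g) := by
  ext ⟨x, x'⟩
  exact mul_comm (g x) (f x')

theorem isContraction_negLaplacian_right {a : ℕ} (h : a + 0 = a) (A : Ker d a)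
    (α : Fin (a + 1)) (β : Fin (0 + 1)) :
    IsContraction h A (negLaplacian d) α β (-(A.comp (lapAlong (rightDir α)))) := by
  refine isContraction_of_isSymbol _ (fun f g => -lapAlong (leftDir α) (tensor f g))
    (fun f g => isSymbol_iff.2 fun φ x x' => ?_) fun f g => ?_
  · rw [negLaplacian_apply, ← integral_neg]
    refine integral_congr_ae (.of_forall fun u => ?_)
    have hlap : lapAlong (rightDir 0) (tensor (insertTensor β φ (inSlice h g x'))
        (outSlice h α β f x)) (fun _ => u, fun _ => u) =
        φ u * lapAlong (leftDir α) (tensor f g) (Function.update x α u, x') := by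
      refine lapAlong_apply_congr _ fun z => ?_
      rw [add_rightDir_zero, add_leftDir, tensor_apply, tensor_apply, insertTensor_apply,
        inSlice_apply, outSlice_apply, join_zero_right, join_zero_right, Function.update_self,
        Function.update_idem]
      ring
    change -_ = -lapAlong (leftDir α) (tensor f g) (Function.update x α u, x') * φ u
    rw [hlap]
    ring
  · change -A (lapAlong (rightDir α) (tensor g f)) = _
    rw [tensor_comm_eq_transpose, lapAlong_rightDir_transpose, map_neg, map_neg]

theorem isContraction_delta_right {a : ℕ} (h : a + 1 = a + 1) (A : Ker d a)
    (α : Fin (a + 1)) (β : Fin (1 + 1)) :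
    IsContraction h A (delta d) α β (A.comp (coll (rightVar α))) := by
  refine isContraction_of_isSymbol _ (fun f g => coll (leftVar α) (tensor f g))
    (fun f g => isSymbol_iff.2 fun φ x x' => ?_) fun f g => ?_
  · rw [delta_apply]
    refine integral_congr_ae (.of_forall fun u => ?_)
    have hvar : leftVar α (Function.update x α u, x') = u :=
      Function.update_self (β := fun _ => E d) α u x
    simp only [coll_apply, tensor_apply, insertTensor_apply, inSlice_apply, outSlice_apply,
      join_one_right, hvar, Fin.removeNth]
    ring
  · change A (coll (rightVar α) (tensor g f)) = _
    rw [tensor_comm_eq_transpose, coll_rightVar_transpose]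

theorem isContraction_negLaplacian_left {b : ℕ} (h : 0 + b = b) {A : Ker d b}
    (hA : GoodMapping A) (α : Fin (0 + 1)) (β : Fin (b + 1)) :
    IsContraction h (negLaplacian d) A α β
      (A.comp ((-lapAlong (leftDir β)).comp (swapDensity h α β))) := by
  refine isContraction_diagonal (D := -lapAlong (ContinuousLinearMap.id ℝ (E d))) hA
    (fun φ ψ => ?_) (fun φ G F => ?_) fun Φ s hs => ?_
  · simp only [neg_apply, neg_mul, mul_neg, integral_neg, integral_lapAlong_mul]
  · ext ⟨v, w⟩
    have hlap : lapAlong (leftDir β) (tensor (insertTensor β φ G) F) (v, w) =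
        G (β.removeNth v) * F w * lapAlong (ContinuousLinearMap.id ℝ (E d)) φ (v β) := by
      refine lapAlong_apply_congr _ fun y => ?_
      simp only [add_leftDir, tensor_apply, insertTensor_apply, Function.update_self,
        Fin.removeNth_update, ContinuousLinearMap.id_apply]
      ring
    change -lapAlong (leftDir β) _ (v, w) = -lapAlong _ φ (v β) * G (β.removeNth v) * F w
    rw [hlap]
    ring
  · rw [negLaplacian_apply, ← integral_neg]
    refine integral_congr_ae (.of_forall fun u => congrArg Neg.neg ?_)
    refine (lapAlong_apply_congr 1 fun z => ?_).trans (one_mul _)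
    rw [add_rightDir_zero, one_mul, hs, update_fin_one]
    rfl

theorem isContraction_delta_left {b : ℕ} (h : 1 + b = b + 1) {A : Ker d b} (hA : GoodMapping A)
    (α : Fin (1 + 1)) (β : Fin (b + 1)) :
    IsContraction h (delta d) A α β (A.comp (swapDensity h α β)) := by
  refine isContraction_diagonal (D := .id ℂ 𝓢(E d, ℂ)) (D' := .id ℂ (Density d b)) hA
    (fun _ _ => rfl) (fun _ _ _ => rfl) fun Φ s hs => ?_
  rw [delta_apply]
  refine integral_congr_ae (.of_forall fun u => ?_)
  change Φ (fun _ => u, fun _ => u) = s u u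
  rw [hs, Function.update_eq_self_iff.2 rfl]

end

section

variable {d : ℕ}

/-! ### Symmetric kernels -/

/-- Invariance of a kernel under permutations of each of its two groups of variables. -/
def IsSymmetric {n : ℕ} (γ : Density d n) : Prop :=
  ∀ π σ, permAct π σ γ = γ

theorem IsSymmetric.apply_comp {n : ℕ} {γ : Density d n} (hγ : IsSymmetric γ)
    {s s' : Fin (n + 1) → Fin (n + 1)} (hs : Function.Injective s) (hs' : Function.Injective s')
    (x x' : X d (n + 1)) : γ (x ∘ s, x' ∘ s') = γ (x, x') :=
  DFunLike.congr_fun (hγ (Equiv.ofBijective s (Finite.injective_iff_bijective.1 hs))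
    (Equiv.ofBijective s' (Finite.injective_iff_bijective.1 hs'))) (x, x')

theorem exists_cons_removeNth {b : ℕ} (β : Fin (b + 1)) : ∃ s : Fin (b + 1) → Fin (b + 1),
    Function.Injective s ∧ ∀ w : X d (b + 1),
      (Fin.cons (w β) (β.removeNth w) : X d (b + 1)) = w ∘ s := by
  refine ⟨Fin.cons β β.succAbove, Fin.cons_injective_iff.2 ⟨?_, Fin.succAbove_right_injective⟩,
    fun w => ?_⟩
  · rintro ⟨i, hi⟩
    exact Fin.succAbove_ne β i hi
  · funext i
    refine Fin.cases rfl (fun j => rfl) i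

theorem exists_cons_cons_removeNth {b : ℕ} (β : Fin (b + 1)) : ∃ s : Fin (b + 2) → Fin (b + 2),
    Function.Injective s ∧ ∀ (w : X d (b + 1)) (e : E d),
      (Fin.cons e (Fin.cons (w β) (β.removeNth w) : X d (b + 1)) : X d (b + 2)) =
        (Fin.snoc w e : X d (b + 2)) ∘ s := by
  obtain ⟨s, hs, h⟩ := exists_cons_removeNth (d := d) β
  refine ⟨Fin.cons (Fin.last _) (Fin.castSucc ∘ s),
    Fin.cons_injective_iff.2 ⟨?_, (Fin.castSucc_injective _).comp hs⟩, fun w e => ?_⟩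
  · rintro ⟨i, hi⟩
    exact (Fin.castSucc_lt_last _).ne hi
  · rw [h]
    funext i
    refine Fin.cases ?_ (fun j => ?_) i
    · simp
    · simp

theorem exists_cons_cons_removeNth_swap {b : ℕ} (β : Fin (b + 1)) : ∃ s : Fin (b + 2) → Fin (b + 2),
    Function.Injective s ∧ ∀ (w : X d (b + 1)) (e : E d),
      (Fin.cons (w β) (Fin.cons e (β.removeNth w) : X d (b + 1)) : X d (b + 2)) =
        (Fin.snoc w e : X d (b + 2)) ∘ s := by
  obtain ⟨s, hs, h⟩ := exists_cons_cons_removeNth (d := d) β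
  refine ⟨s ∘ Equiv.swap 0 1, hs.comp (Equiv.injective _), fun w e => ?_⟩
  rw [← Function.comp_assoc, ← h]
  funext i
  refine Fin.cases ?_ (fun i => Fin.cases ?_ (fun j => ?_) i) i
  · simp
  · rw [Function.comp_apply, Fin.succ_zero_eq_one, Equiv.swap_apply_right]
    rfl
  · rw [Function.comp_apply, Equiv.swap_apply_of_ne_of_ne]
    · rfl
    · simp [Fin.ext_iff]
    · simp [Fin.ext_iff]

theorem swapDensity_transpose_zero {b : ℕ} (h : 0 + b = b) (α : Fin (0 + 1)) (β : Fin (b + 1))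
    {γ : Density d b} (hγ : IsSymmetric γ) :
    swapDensity h α β (transpose γ) = transpose γ := by
  ext ⟨v, w⟩
  obtain ⟨s, hs, hs'⟩ := exists_cons_removeNth (d := d) β
  rw [swapDensity, restrict_apply, swapMap_apply]
  change γ (moveEquiv h α β (fun _ => v β, w), joinEquiv h (fun _ => v β, β.removeNth v)) =
    γ (w, v)
  rw [joinEquiv_apply, moveEquiv_apply, join_zero_left, join_zero_left]
  obtain rfl : α = 0 := by omega
  rw [Fin.insertNth_apply_same]
  dsimp only
  rw [hs', hs', hγ.apply_comp hs hs]

theorem swapDensity_transpose_one {b : ℕ} (h : 1 + b = b + 1) (α : Fin (1 + 1)) (β : Fin (b + 1))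
    {γ : Density d (b + 1)} (hγ : IsSymmetric γ) :
    swapDensity h α β (transpose γ) = transpose (coll (rightVar β) γ) := by
  ext ⟨v, w⟩
  obtain ⟨s, hs, hs'⟩ := exists_cons_cons_removeNth (d := d) β
  obtain ⟨t, ht, ht'⟩ := exists_cons_cons_removeNth_swap (d := d) β
  rw [swapDensity, restrict_apply, swapMap_apply]
  change γ (moveEquiv h α β (fun _ => v β, w), joinEquiv h (fun _ => v β, β.removeNth v)) =
    coll (rightVar β) γ (w, v)
  rw [joinEquiv_apply, moveEquiv_apply, join_one_left, join_one_left, coll_apply]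
  change _ = γ ((Fin.snoc w (v β) : X d (b + 2)), (Fin.snoc v (v β) : X d (b + 2)))
  dsimp only
  rw [hs' v (v β)]
  obtain rfl | rfl : α = 0 ∨ α = 1 := (Fin.exists_fin_two (p := fun i => α = i)).1 ⟨α, rfl⟩
  · change γ ((Fin.cons (w β) (Fin.cons (v β) (β.removeNth w) : X d (b + 1)) : X d (b + 2)), _) = _
    rw [ht', hγ.apply_comp ht hs]
  · change γ ((Fin.cons (v β) (Fin.cons (w β) (β.removeNth w) : X d (b + 1)) : X d (b + 2)), _) = _
    rw [hs', hγ.apply_comp hs hs]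

/-! ### The bracket with the Gross–Pitaevskii generator -/

/-- The kernel of the commutator `[Δ_{x_1} + ⋯ + Δ_{x_k}, γ]`. -/
def lapComm (d n : ℕ) : Density d n →L[ℂ] Density d n :=
  ∑ α : Fin (n + 1), (lapAlong (leftDir α) - lapAlong (rightDir α))

/-- The collision operator `γ ↦ ∑_j (B_j^+ - B_j^-) γ`. -/
def collComm (d n : ℕ) : Density d (n + 1) →L[ℂ] Density d n :=
  ∑ α : Fin (n + 1), (coll (leftVar α) - coll (rightVar α))

theorem oneBracket_smul_right {a b n : ℕ} {h : a + b = n} {A : Ker d a} {B : Ker d b}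
    {C C' : Fin (a + 1) → Fin (b + 1) → Ker d n} (hA : GoodMapping A) (hB : GoodMapping B)
    (hC : ∀ α β, IsContraction h A B α β (C α β))
    (hC' : ∀ α β, IsContraction ((Nat.add_comm b a).trans h) B A β α (C' α β)) (c : ℂ) :
    oneBracket h A (c • B) = c • ∑ α, ∑ β, (C α β - C' α β) := by
  simp only [oneBracket, contraction_eq (hB.smul c) ((hC _ _).smul_right c),
    contraction_eq hA ((hC' _ _).smul_left c), Finset.smul_sum, smul_sub]

theorem trace_oneBracket_negLaplacian {a : ℕ} (h : a + 0 = a) {A : Ker d a} (hA : GoodMapping A)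
    (c : ℂ) {γ : Density d a} (hγ : IsSymmetric γ) :
    trace (oneBracket h A (c • negLaplacian d)) γ = -c * trace A (lapComm d a γ) := by
  have hsummand : ∀ (α : Fin (a + 1)) (β : Fin (0 + 1)),
      -(A (lapAlong (rightDir α) (transpose γ))) -
          A (-lapAlong (leftDir α) (swapDensity ((Nat.add_comm 0 a).trans h) β α (transpose γ))) =
        -(A (transpose (lapAlong (leftDir α) γ)) - A (transpose (lapAlong (rightDir α) γ))) :=
    fun α β => by
      rw [swapDensity_transpose_zero _ _ _ hγ, lapAlong_rightDir_transpose,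
        lapAlong_leftDir_transpose, map_neg]
      ring
  rw [oneBracket_smul_right hA goodMapping_negLaplacian
    (isContraction_negLaplacian_right h A) fun α β => isContraction_negLaplacian_left _ hA β α]
  simp only [trace, lapComm, smul_apply, sum_apply, sub_apply, map_sum, map_sub]
  rw [smul_eq_mul, neg_mul_comm, ← Finset.sum_neg_distrib]
  refine congrArg (c * ·) (Finset.sum_congr rfl fun α _ => ?_)
  rw [Fin.sum_univ_castSucc, Fin.sum_univ_zero, zero_add]
  exact hsummand α _

theorem trace_oneBracket_delta {a : ℕ} (h : a + 1 = a + 1) {A : Ker d a} (hA : GoodMapping A)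
    (c : ℂ) {γ : Density d (a + 1)} (hγ : IsSymmetric γ) :
    trace (oneBracket h A (c • delta d)) γ = 2 * c * trace A (collComm d a γ) := by
  have hsummand : ∀ (α : Fin (a + 1)) (β : Fin (1 + 1)),
      A (coll (rightVar α) (transpose γ)) -
          A (swapDensity ((Nat.add_comm 1 a).trans h) β α (transpose γ)) =
        A (transpose (coll (leftVar α) γ)) - A (transpose (coll (rightVar α) γ)) := fun α β => by
    rw [swapDensity_transpose_one _ _ _ hγ, coll_rightVar_transpose]
  rw [oneBracket_smul_right hA goodMapping_delta (isContraction_delta_right h A)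
    fun α β => isContraction_delta_left _ hA β α]
  simp only [trace, collComm, smul_apply, sum_apply, sub_apply, map_sum, map_sub,
    ContinuousLinearMap.coe_comp, Function.comp_apply, hsummand, Finset.sum_const,
    Finset.card_univ, Fintype.card_fin, ← Finset.smul_sum]
  simp only [nsmul_eq_mul, smul_eq_mul]
  push_cast
  ring

theorem oneBracket_zero_right {a b n : ℕ} (h : a + b = n) {A : Ker d a} (hA : GoodMapping A) :
    oneBracket h A (0 : Ker d b) = 0 := by
  simp only [oneBracket, contraction_zero_right, contraction_zero_left hA, sub_self,
    Finset.sum_const_zero]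

theorem trace_symmetrize {n : ℕ} (C : Ker d n) {γ : Density d n} (hγ : IsSymmetric γ) :
    trace (symmetrize C) γ = trace C γ := by
  have hperm : ∀ π σ, C.comp (permAct π σ) (transpose γ) = C (transpose γ) := fun π σ =>
    congrArg (fun γ => C (transpose γ)) (hγ σ π)
  have hfactorial : ((n + 1).factorial : ℂ) ≠ 0 := Nat.cast_ne_zero.2 (Nat.factorial_ne_zero _)
  simp only [trace, symmetrize, smul_apply, sum_apply, hperm, Finset.sum_const, Finset.card_univ,
    Fintype.card_perm, Fintype.card_fin, nsmul_eq_mul, smul_eq_mul]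
  field_simp

/-- The hierarchy `-i W_GP`. -/
def gpObservable (d : ℕ) (κ : ℝ) : ∀ n, Ker d n := fun n => (-Complex.I) • gpGenerator d κ n

/-- The components of the Gross–Pitaevskii vector field. -/
def gpField (κ : ℝ) (Γ : ∀ n, Density d n) (n : ℕ) : Density d n :=
  Complex.I • lapComm d n (Γ n) - (2 * Complex.I * κ) • collComm d n (Γ (n + 1))

theorem trace_oneBracket_gpObservable_zero {κ : ℝ} {a : ℕ} (h : a + 0 = a) {A : Ker d a}
    (hA : GoodMapping A) {γ : Density d a} (hγ : IsSymmetric γ) :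
    trace (oneBracket h A (gpObservable d κ 0)) γ = Complex.I * trace A (lapComm d a γ) := by
  rw [gpObservable, gpGenerator, trace_oneBracket_negLaplacian h hA _ hγ, neg_neg]

theorem trace_oneBracket_gpObservable_one {κ : ℝ} {a : ℕ} (h : a + 1 = a + 1) {A : Ker d a}
    (hA : GoodMapping A) {γ : Density d (a + 1)} (hγ : IsSymmetric γ) :
    trace (oneBracket h A (gpObservable d κ 1)) γ =
      -(2 * Complex.I * κ) * trace A (collComm d a γ) := by
  rw [gpObservable, gpGenerator, smul_smul, trace_oneBracket_delta h hA _ hγ]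
  ring

theorem oneBracket_gpObservable_add_two {κ : ℝ} {a b n : ℕ} (h : a + b = n) (hb : 2 ≤ b)
    {A : Ker d a} (hA : GoodMapping A) : oneBracket h A (gpObservable d κ b) = 0 := by
  obtain ⟨b, rfl⟩ := Nat.exists_eq_add_of_le' hb
  have hzero : gpObservable d κ (b + 2) = 0 :=
    ContinuousLinearMap.ext fun _ => mul_zero (-Complex.I)
  rw [hzero, oneBracket_zero_right h hA]

theorem trace_gpField {κ : ℝ} (A : ∀ n, Ker d n) (Γ : ∀ n, Density d n) (n : ℕ) :
    trace (A n) (gpField κ Γ n) = Complex.I * trace (A n) (lapComm d n (Γ n)) +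
      -(2 * Complex.I * κ) * trace (A n) (collComm d n (Γ (n + 1))) := by
  simp only [trace, gpField, map_sub, map_smul, smul_eq_mul]
  ring

theorem trace_lieBracket_gpObservable_zero {κ : ℝ} {A : ∀ n, Ker d n}
    (hA : ∀ n, GoodMapping (A n)) {Γ : ∀ n, Density d n} (hΓ : ∀ n, IsSymmetric (Γ n)) :
    trace (lieBracket A (gpObservable d κ) 0) (Γ 0) =
      Complex.I * trace (A 0) (lapComm d 0 (Γ 0)) := by
  rw [lieBracket, trace_symmetrize _ (hΓ 0),
    Fin.sum_univ_castSucc, Fin.sum_univ_zero, zero_add]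
  exact trace_oneBracket_gpObservable_zero (Nat.add_zero 0) (hA 0) (hΓ 0)

theorem trace_lieBracket_gpObservable_succ {κ : ℝ} {A : ∀ n, Ker d n}
    (hA : ∀ n, GoodMapping (A n)) {Γ : ∀ n, Density d n} (hΓ : ∀ n, IsSymmetric (Γ n)) (n : ℕ) :
    trace (lieBracket A (gpObservable d κ) (n + 1)) (Γ (n + 1)) =
      Complex.I * trace (A (n + 1)) (lapComm d (n + 1) (Γ (n + 1))) +
      -(2 * Complex.I * κ) * trace (A n) (collComm d n (Γ (n + 1))) := by
  have hone : ∀ (b : ℕ) (h : n + 1 + b = n + 1), b = 0 →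
      trace (oneBracket h (A (n + 1)) (gpObservable d κ b)) (Γ (n + 1)) =
        Complex.I * trace (A (n + 1)) (lapComm d (n + 1) (Γ (n + 1))) := by
    rintro b h rfl
    exact trace_oneBracket_gpObservable_zero h (hA _) (hΓ _)
  have htwo : ∀ (b : ℕ) (h : n + b = n + 1), b = 1 →
      trace (oneBracket h (A n) (gpObservable d κ b)) (Γ (n + 1)) =
        -(2 * Complex.I * κ) * trace (A n) (collComm d n (Γ (n + 1))) := by
    rintro b h rfl
    exact trace_oneBracket_gpObservable_one h (hA _) (hΓ _)
  rw [lieBracket, trace_symmetrize _ (hΓ (n + 1)), trace, sum_apply, Fin.sum_univ_castSucc,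
    Fin.sum_univ_castSucc, Finset.sum_eq_zero, zero_add, add_comm]
  · congr 1
    · exact hone _ _ (by simp)
    · exact htwo _ _ (by simp)
  · intro i _
    rw [oneBracket_gpObservable_add_two _ ?_ (hA _)]
    · rfl
    · have := i.is_lt
      simp only [Fin.val_castSucc]
      omega

end

section

variable {d : ℕ}

/-! ### Traces of hierarchies -/

theorem hierTrace_eq_sum_of_trace {A : ∀ n, Ker d n} {Γ : ∀ n, Density d n} {N : ℕ}
    (hN : ∀ n, N ≤ n → trace (A n) (Γ n) = 0) :
    hierTrace A Γ = ∑ n ∈ Finset.range N, trace (A n) (Γ n) := by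
  refine finsum_eq_sum_of_support_subset _ fun n hn => ?_
  rw [Finset.coe_range, Set.mem_Iio]
  by_contra! h
  exact hn (hN n h)

theorem hierTrace_eq_sum {A : ∀ n, Ker d n} {N : ℕ} (hN : ∀ n, N ≤ n → A n = 0)
    (Γ : ∀ n, Density d n) : hierTrace A Γ = ∑ n ∈ Finset.range N, trace (A n) (Γ n) :=
  hierTrace_eq_sum_of_trace fun n hn => by
    rw [hN n hn]
    rfl

theorem IsObservable.exists_eq_zero {A : ∀ n, Ker d n} (hA : IsObservable A) :
    ∃ N, ∀ n, N ≤ n → A n = 0 := by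
  obtain ⟨N, hN⟩ := hA.1.bddAbove
  exact ⟨N + 1, fun n hn => not_not.1 fun h => hn.not_gt (Nat.lt_succ_of_le (hN h))⟩

theorem IsObservable.add {A B : ∀ n, Ker d n} (hA : IsObservable A) (hB : IsObservable B) :
    IsObservable (A + B) := by
  refine ⟨(hA.1.union hB.1).subset fun n hn => ?_, fun n => ⟨fun π σ Θ => ?_, fun Θ Θ' h => ?_,
    (hA.2 n).2.2.add (hB.2 n).2.2⟩⟩
  · by_contra h
    rw [Set.mem_union, not_or] at h
    exact hn ((congrArg₂ (· + ·) (not_not.1 h.1) (not_not.1 h.2)).trans (add_zero 0))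
  · change A n _ + B n _ = A n Θ + B n Θ
    rw [(hA.2 n).1, (hB.2 n).1]
  · change A n _ + B n _ = -starRingEnd ℂ (A n Θ + B n Θ)
    rw [(hA.2 n).2.1 Θ Θ' h, (hB.2 n).2.1 Θ Θ' h, map_add]
    ring

theorem IsObservable.smul {A : ∀ n, Ker d n} (hA : IsObservable A) (r : ℝ) :
    IsObservable ((r : ℂ) • A) := by
  refine ⟨hA.1.subset fun n hn h => hn ?_, fun n => ⟨fun π σ Θ => ?_, fun Θ Θ' h => ?_,
    (hA.2 n).2.2.smul r⟩⟩
  · change (r : ℂ) • A n = 0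
    rw [h]
    exact ContinuousLinearMap.ext fun _ => mul_zero (r : ℂ)
  · change (r : ℂ) * A n _ = r * A n Θ
    rw [(hA.2 n).1]
  · change (r : ℂ) * A n _ = -starRingEnd ℂ (r * A n Θ)
    rw [(hA.2 n).2.1 Θ Θ' h, map_mul, Complex.conj_ofReal]
    ring

theorem isObservable_zero : IsObservable (0 : ∀ n, Ker d n) :=
  ⟨by simp, fun _ => ⟨fun _ _ _ => rfl, fun _ _ _ => by simp, goodMapping_zero⟩⟩

theorem isObservable_single {n : ℕ} {K : Ker d n} (hbosonic : IsBosonicKer K)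
    (hskew : IsSkewAdjoint K) (hgood : GoodMapping K) :
    IsObservable (Pi.single n K : ∀ n, Ker d n) := by
  refine ⟨(Set.finite_singleton n).subset fun m hm => ?_, fun m => ?_⟩
  · by_contra h
    exact hm (Pi.single_eq_of_ne h _)
  · rcases eq_or_ne m n with rfl | h
    · rw [Pi.single_eq_same]
      exact ⟨hbosonic, hskew, hgood⟩
    · rw [Pi.single_eq_of_ne h]
      exact isObservable_zero.2 m

theorem hierTrace_zero_left (Γ : ∀ n, Density d n) : hierTrace (0 : ∀ n, Ker d n) Γ = 0 :=
  finsum_zero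

theorem hierTrace_add_left {A B : ∀ n, Ker d n} (hA : IsObservable A) (hB : IsObservable B)
    (Γ : ∀ n, Density d n) : hierTrace (A + B) Γ = hierTrace A Γ + hierTrace B Γ := by
  obtain ⟨N, hN⟩ := hA.exists_eq_zero
  obtain ⟨M, hM⟩ := hB.exists_eq_zero
  have hA0 : ∀ n, max N M ≤ n → A n = 0 := fun n hn => hN n (le_of_max_le_left hn)
  have hB0 : ∀ n, max N M ≤ n → B n = 0 := fun n hn => hM n (le_of_max_le_right hn)
  rw [hierTrace_eq_sum hA0, hierTrace_eq_sum hB0, hierTrace_eq_sum (N := max N M),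
    ← Finset.sum_add_distrib]
  · rfl
  · intro n hn
    rw [Pi.add_apply, hA0 n hn, hB0 n hn, add_zero]

theorem hierTrace_smul_left (c : ℂ) (A : ∀ n, Ker d n) (Γ : ∀ n, Density d n) :
    hierTrace (c • A) Γ = c * hierTrace A Γ := by
  rw [hierTrace, hierTrace, ← smul_eq_mul, smul_finsum]
  rfl

theorem hierTrace_single_left (n : ℕ) (K : Ker d n) (Γ : ∀ n, Density d n) :
    hierTrace (Pi.single n K) Γ = trace K (Γ n) := by
  rw [hierTrace, finsum_eq_single _ n]
  · rw [Pi.single_eq_same]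
  · intro m hm
    rw [Pi.single_eq_of_ne hm]
    rfl

theorem IsObservable.hierTrace_add {A : ∀ n, Ker d n} (hA : IsObservable A)
    (Γ Γ' : ∀ n, Density d n) : hierTrace A (Γ + Γ') = hierTrace A Γ + hierTrace A Γ' := by
  obtain ⟨N, hN⟩ := hA.exists_eq_zero
  simp only [hierTrace_eq_sum hN, ← Finset.sum_add_distrib, trace, Pi.add_apply, map_add]

theorem hierTrace_real_smul (A : ∀ n, Ker d n) (r : ℝ) (Γ : ∀ n, Density d n) :
    hierTrace A (r • Γ) = r * hierTrace A Γ := by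
  rw [hierTrace, hierTrace, ← smul_eq_mul, smul_finsum]
  refine finsum_congr fun n => ?_
  rw [Pi.smul_apply, trace, trace, ← Complex.coe_smul, map_smul, map_smul]

theorem hierTrace_single (A : ∀ n, Ker d n) (n : ℕ) (γ : Density d n) :
    hierTrace A (Pi.single n γ) = trace (A n) γ := by
  rw [hierTrace, finsum_eq_single _ n]
  · rw [Pi.single_eq_same]
  · intro m hm
    rw [Pi.single_eq_of_ne hm, trace, map_zero, map_zero]

/-! ### Hermitian kernels -/

/-- Self-adjointness of the operator with kernel `γ`. -/
def IsHermitian {n : ℕ} (γ : Density d n) : Prop :=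
  ∀ x x', γ (x, x') = starRingEnd ℂ (γ (x', x))

/-- The kernel `γ^*(x; x') = conj γ(x'; x)` of the adjoint operator. -/
def conjTranspose {n : ℕ} (γ : Density d n) : Density d n :=
  transpose (SchwartzMap.postcompCLM (𝕜 := ℝ) (Complex.conjCLE : ℂ →L[ℝ] ℂ) γ)

theorem conjTranspose_apply {n : ℕ} (γ : Density d n) (x x' : X d (n + 1)) :
    conjTranspose γ (x, x') = starRingEnd ℂ (γ (x', x)) := rfl

theorem permAct_apply {n : ℕ} (π σ : Equiv.Perm (Fin (n + 1))) (γ : Density d n)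
    (x x' : X d (n + 1)) : permAct π σ γ (x, x') = γ (x ∘ π, x' ∘ σ) := rfl

theorem IsSymmetric.conjTranspose {n : ℕ} {γ : Density d n} (hγ : IsSymmetric γ) :
    IsSymmetric (conjTranspose γ) := by
  intro π σ
  ext ⟨x, x'⟩
  rw [permAct_apply, conjTranspose_apply, conjTranspose_apply,
    hγ.apply_comp σ.injective π.injective]

theorem isSymmetric_sum_permAct {n : ℕ} (Θ : Density d n) :
    IsSymmetric (∑ π : Equiv.Perm (Fin (n + 1)), ∑ σ : Equiv.Perm (Fin (n + 1)),
      permAct π σ Θ) := by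
  intro π σ
  ext ⟨x, x'⟩
  rw [permAct_apply]
  simp only [sum_apply, permAct_apply]
  exact Fintype.sum_equiv (Equiv.mulLeft π) _ _ fun _ =>
    Fintype.sum_equiv (Equiv.mulLeft σ) _ _ fun _ => rfl

theorem IsBosonicKer.eq_zero {n : ℕ} {K : Ker d n} (hK : IsBosonicKer K)
    (h : ∀ γ, IsSymmetric γ → trace K γ = 0) : K = 0 := by
  ext Θ
  have hsum := h _ (isSymmetric_sum_permAct (transpose Θ))
  have hperm : ∀ π σ, K (transpose (permAct π σ (transpose Θ))) = K Θ := fun π σ => hK σ π Θ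
  change K Θ = 0
  simpa only [trace, map_sum, hperm, Finset.sum_const, Finset.card_univ, Fintype.card_perm,
    Fintype.card_fin, nsmul_eq_mul, mul_eq_zero, Nat.cast_eq_zero, Nat.factorial_ne_zero,
    false_or] using hsum

theorem IsSymmetric.trace_eq_zero {n : ℕ} {K : Ker d n}
    (h : ∀ γ, IsSymmetric γ → IsHermitian γ → trace K γ = 0) {γ : Density d n}
    (hγ : IsSymmetric γ) : trace K γ = 0 := by
  have hre : trace K (γ + GPHierarchy.conjTranspose γ) = 0 := by
    refine h _ (fun π σ => by rw [map_add, hγ, hγ.conjTranspose]) fun x x' => ?_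
    simp only [add_apply, conjTranspose_apply, map_add, Complex.conj_conj]
    ring
  have him : trace K (Complex.I • (γ - GPHierarchy.conjTranspose γ)) = 0 := by
    refine h _ (fun π σ => by rw [map_smul, map_sub, hγ, hγ.conjTranspose]) fun x x' => ?_
    simp only [smul_apply, sub_apply, conjTranspose_apply, map_sub, Complex.conj_conj,
      smul_eq_mul, map_mul, Complex.conj_I]
    ring
  simp only [trace, map_add] at hre
  simp only [trace, map_smul, map_sub, smul_eq_mul, mul_eq_zero, Complex.I_ne_zero,
    false_or] at him
  rw [trace]
  linear_combination (hre + him) / 2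

/-- The density matrix hierarchy whose only nonzero component is `γ`, in position `n`. -/
def singleHierarchy (n : ℕ) (γ : Density d n) (hsymm : IsSymmetric γ) (hherm : IsHermitian γ) :
    DensityHierarchy d :=
  ⟨Pi.single n γ, fun m => by
    rcases eq_or_ne m n with rfl | h
    · rw [Pi.single_eq_same]
      exact ⟨hsymm, hherm⟩
    · rw [Pi.single_eq_of_ne h]
      exact (DensityHierarchy d).zero_mem m⟩

theorem IsObservable.eq_zero {A : ∀ n, Ker d n} (hA : IsObservable A)
    (h : ∀ v : DensityHierarchy d, hierTrace A v.1 = 0) : A = 0 :=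
  funext fun n => (hA.2 n).1.eq_zero fun _ hγ => hγ.trace_eq_zero fun γ hsymm hherm =>
    (hierTrace_single A n γ).symm.trans (h (singleHierarchy n γ hsymm hherm))

/-! ### Trace functionals -/

theorem IsSkewAdjoint.conj_trace {n : ℕ} {K : Ker d n} (hK : IsSkewAdjoint K) {γ : Density d n}
    (hγ : IsHermitian γ) : starRingEnd ℂ (trace K γ) = -trace K γ :=
  (neg_eq_iff_eq_neg.2 (hK _ _ fun x x' => hγ x' x)).symm

theorem IsObservable.conj_hierTrace {A : ∀ n, Ker d n} (hA : IsObservable A)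
    (Γ : DensityHierarchy d) : starRingEnd ℂ (hierTrace A Γ.1) = -hierTrace A Γ.1 := by
  obtain ⟨N, hN⟩ := hA.exists_eq_zero
  rw [hierTrace_eq_sum hN, map_sum, ← Finset.sum_neg_distrib]
  exact Finset.sum_congr rfl fun n _ => (hA.2 n).2.1.conj_trace (Γ.2 n).2

/-- The functional `Γ ↦ i Tr (A · Γ)`; the real part makes it real-valued for every `A`, and is
harmless when `A` is an observable. -/
def traceFunctional (A : ∀ n, Ker d n) (Γ : DensityHierarchy d) : ℝ :=
  (Complex.I * hierTrace A Γ.1).re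

theorem IsObservable.ofReal_traceFunctional {A : ∀ n, Ker d n} (hA : IsObservable A)
    (Γ : DensityHierarchy d) : (traceFunctional A Γ : ℂ) = Complex.I * hierTrace A Γ.1 := by
  refine Complex.conj_eq_iff_re.1 ?_
  rw [map_mul, hA.conj_hierTrace, Complex.conj_I]
  ring

theorem IsObservable.traceFunctional_mem {A : ∀ n, Ker d n} (hA : IsObservable A) :
    traceFunctional A ∈ admissible d :=
  Algebra.subset_adjoin ⟨A, hA, hA.ofReal_traceFunctional⟩

theorem eq_traceFunctional {F : DensityHierarchy d → ℝ} {A : ∀ n, Ker d n}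
    (h : ∀ Γ : DensityHierarchy d, (F Γ : ℂ) = Complex.I * hierTrace A Γ.1) :
    F = traceFunctional A :=
  funext fun Γ => by rw [traceFunctional, ← h, Complex.ofReal_re]

end

section

variable {d : ℕ}

/-! ### The Gross–Pitaevskii observable -/

theorem lapAlong_conj_apply {V : Type*} [NormedAddCommGroup V] [NormedSpace ℝ V]
    {ι : E d →L[ℝ] V} {f g : 𝓢(V, ℂ)} (h : ∀ x, g x = starRingEnd ℂ (f x)) (x : V) :
    lapAlong ι g x = starRingEnd ℂ (lapAlong ι f x) := by
  have hderiv : ∀ φ : ℝ → ℂ,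
      (deriv fun t => starRingEnd ℂ (φ t)) = fun t => starRingEnd ℂ (deriv φ t) :=
    fun φ => funext fun t => deriv.star
  simp only [lapAlong_apply, map_sum, h, hderiv]

theorem negLaplacian_tensor (f g : 𝓢(X d (0 + 1), ℂ)) : negLaplacian d (tensor f g) =
    -∫ u, restrict _ (constConf_injective 0) f u *
      lapAlong (ContinuousLinearMap.id ℝ (E d)) (restrict _ (constConf_injective 0) g) u := by
  rw [negLaplacian_apply]
  refine congrArg Neg.neg (integral_congr_ae (.of_forall fun u => ?_))
  refine lapAlong_apply_congr (f fun _ => u) fun y => ?_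
  rw [add_rightDir_zero]
  rfl

theorem negLaplacian_transpose (Θ : Density d 0) :
    negLaplacian d (transpose Θ) = negLaplacian d Θ := by
  suffices hzero : (negLaplacian d).comp transpose - negLaplacian d = 0 from
    sub_eq_zero.1 (DFunLike.congr_fun hzero Θ)
  refine eq_zero_of_tensor _ fun f g => ?_
  change negLaplacian d (transpose (tensor f g)) - negLaplacian d (tensor f g) = 0
  rw [← tensor_comm_eq_transpose, negLaplacian_tensor, negLaplacian_tensor,
    ← integral_lapAlong_mul, sub_eq_zero]
  simp only [mul_comm]

theorem negLaplacian_conj {Θ Θ' : Density d 0}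
    (h : ∀ x x', Θ' (x, x') = starRingEnd ℂ (Θ (x', x))) :
    negLaplacian d Θ' = starRingEnd ℂ (negLaplacian d Θ) := by
  rw [← negLaplacian_transpose Θ, negLaplacian_apply, negLaplacian_apply, map_neg, ← integral_conj]
  refine congrArg Neg.neg (integral_congr_ae (.of_forall fun u => ?_))
  exact lapAlong_conj_apply (fun x => h x.1 x.2) _

theorem delta_conj {Θ Θ' : Density d 1} (h : ∀ x x', Θ' (x, x') = starRingEnd ℂ (Θ (x', x))) :
    delta d Θ' = starRingEnd ℂ (delta d Θ) := by
  rw [delta_apply, delta_apply, ← integral_conj]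
  exact integral_congr_ae (.of_forall fun u => h _ _)

theorem isBosonicKer_zero_index (K : Ker d 0) : IsBosonicKer K := by
  intro π σ Θ
  have hπ : ∀ π : Equiv.Perm (Fin (0 + 1)), ∀ x : X d (0 + 1), x ∘ π = x := fun π x =>
    funext fun i => congrArg x (by omega)
  congr 1
  ext ⟨x, x'⟩
  rw [permAct_apply, hπ, hπ]

theorem gpObservable_add_two (κ : ℝ) (n : ℕ) : gpObservable d κ (n + 2) = 0 :=
  ContinuousLinearMap.ext fun _ => mul_zero (-Complex.I)

theorem isObservable_gpObservable (κ : ℝ) : IsObservable (gpObservable d κ) := by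
  refine ⟨(Set.finite_Iio 2).subset fun n hn => ?_, fun n => ?_⟩
  · rw [Set.mem_Iio]
    by_contra! h
    obtain ⟨m, rfl⟩ := Nat.exists_eq_add_of_le' h
    exact hn (gpObservable_add_two κ m)
  · match n with
    | 0 =>
      refine ⟨isBosonicKer_zero_index _, fun Θ Θ' h => ?_, goodMapping_negLaplacian.smul _⟩
      change -Complex.I * negLaplacian d Θ' = -starRingEnd ℂ (-Complex.I * negLaplacian d Θ)
      rw [negLaplacian_conj h, map_mul, map_neg, Complex.conj_I]
      ring
    | 1 =>
      refine ⟨fun _ _ _ => rfl, fun Θ Θ' h => ?_, (goodMapping_delta.smul _).smul _⟩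
      change -Complex.I * (κ * delta d Θ') = -starRingEnd ℂ (-Complex.I * (κ * delta d Θ))
      rw [delta_conj h, map_mul, map_neg, Complex.conj_I, map_mul, Complex.conj_ofReal]
      ring
    | n + 2 =>
      rw [gpObservable_add_two]
      exact isObservable_zero.2 _

theorem hierTrace_gpObservable (κ : ℝ) (Γ : ∀ n, Density d n) :
    Complex.I * hierTrace (gpObservable d κ) Γ = hierTrace (gpGenerator d κ) Γ := by
  change Complex.I * hierTrace ((-Complex.I) • gpGenerator d κ) Γ = _
  rw [hierTrace_smul_left, ← mul_assoc, mul_neg, Complex.I_mul_I, neg_neg, one_mul]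

theorem hierTrace_gpGenerator (κ : ℝ) (Γ : ∀ n, Density d n) :
    hierTrace (gpGenerator d κ) Γ =
      trace (negLaplacian d) (Γ 0) + κ * trace (delta d) (Γ 1) := by
  rw [hierTrace_eq_sum (N := 2), Finset.sum_range_succ, Finset.sum_range_one]
  · rfl
  · intro n hn
    obtain ⟨m, rfl⟩ := Nat.exists_eq_add_of_le' hn
    rfl

theorem gpHamiltonian_eq_traceFunctional (κ : ℝ) :
    gpHamiltonian d κ = traceFunctional (gpObservable d κ) :=
  funext fun Γ => by
    rw [traceFunctional, hierTrace_gpObservable, hierTrace_gpGenerator]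
    rfl

theorem hierTrace_lieBracket_gpObservable {κ : ℝ} {A : ∀ n, Ker d n} (hA : IsObservable A)
    {Γ : ∀ n, Density d n} (hΓ : ∀ n, IsSymmetric (Γ n)) :
    hierTrace (lieBracket A (gpObservable d κ)) Γ = hierTrace A (gpField κ Γ) := by
  have hgood : ∀ n, GoodMapping (A n) := fun n => (hA.2 n).2.2
  obtain ⟨N, hN⟩ := hA.exists_eq_zero
  have htrace : ∀ n, N ≤ n → ∀ γ, trace (A n) γ = 0 := fun n hn γ => by
    rw [hN n hn]
    rfl
  rw [hierTrace_eq_sum_of_trace (Γ := gpField κ Γ) (N := N + 1)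
      fun n hn => htrace n (by omega) _,
    hierTrace_eq_sum_of_trace (N := N + 1), Finset.sum_range_succ']
  · simp only [trace_lieBracket_gpObservable_zero hgood hΓ,
      trace_lieBracket_gpObservable_succ hgood hΓ, trace_gpField, Finset.sum_add_distrib]
    rw [add_right_comm, ← Finset.sum_range_succ'
      (fun n => Complex.I * trace (A n) (lapComm d n (Γ n))), Finset.sum_range_succ
      (fun n => -(2 * Complex.I * κ) * trace (A n) (collComm d n (Γ (n + 1)))), htrace N le_rfl,
      mul_zero, add_zero]
  · intro n hn
    obtain ⟨m, rfl⟩ : ∃ m, n = m + 1 := ⟨n - 1, by omega⟩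
    rw [trace_lieBracket_gpObservable_succ hgood hΓ, htrace m (by omega), htrace (m + 1) (by omega),
      mul_zero, mul_zero, add_zero]

/-! ### Gradients -/

theorem IsObservable.hasLineDerivAt_traceFunctional {A : ∀ n, Ker d n} (hA : IsObservable A)
    (Γ v : DensityHierarchy d) :
    HasLineDerivAt ℝ (traceFunctional A) (traceFunctional A v) Γ v := by
  have haffine : (fun t : ℝ => traceFunctional A (Γ + t • v)) =
      fun t => traceFunctional A Γ + t * traceFunctional A v := by
    funext t
    apply Complex.ofReal_injective
    rw [Complex.ofReal_add, Complex.ofReal_mul]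
    simp only [hA.ofReal_traceFunctional]
    change _ * hierTrace A (Γ.1 + t • v.1) = _
    rw [hA.hierTrace_add, hierTrace_real_smul]
    ring
  rw [HasLineDerivAt, haffine]
  simpa only [one_mul, id] using
    ((hasDerivAt_id (0 : ℝ)).mul_const (traceFunctional A v)).const_add (traceFunctional A Γ)

theorem traceFunctional_zero (Γ : DensityHierarchy d) : traceFunctional 0 Γ = 0 := by
  rw [traceFunctional, hierTrace_zero_left, mul_zero, Complex.zero_re]

theorem traceFunctional_add {A B : ∀ n, Ker d n} (hA : IsObservable A) (hB : IsObservable B)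
    (Γ : DensityHierarchy d) :
    traceFunctional (A + B) Γ = traceFunctional A Γ + traceFunctional B Γ := by
  rw [traceFunctional, hierTrace_add_left hA hB, mul_add, Complex.add_re]
  rfl

theorem traceFunctional_smul (r : ℝ) (A : ∀ n, Ker d n) (Γ : DensityHierarchy d) :
    traceFunctional ((r : ℂ) • A) Γ = r * traceFunctional A Γ := by
  rw [traceFunctional, hierTrace_smul_left, mul_left_comm, Complex.re_ofReal_mul]
  rfl

theorem exists_hasLineDerivAt {F : DensityHierarchy d → ℝ} (hF : F ∈ admissible d)
    (Γ : DensityHierarchy d) : ∃ A : ∀ n, Ker d n, IsObservable A ∧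
      ∀ v, HasLineDerivAt ℝ F (traceFunctional A v) Γ v := by
  induction hF using Algebra.adjoin_induction with
  | mem F hF =>
    obtain ⟨A, hA, h⟩ := hF
    rw [eq_traceFunctional h]
    exact ⟨A, hA, hA.hasLineDerivAt_traceFunctional Γ⟩
  | algebraMap r =>
    refine ⟨0, isObservable_zero, fun v => ?_⟩
    rw [traceFunctional_zero]
    exact hasDerivAt_const _ _
  | add F G _ _ hF hG =>
    obtain ⟨A, hA, hFA⟩ := hF
    obtain ⟨B, hB, hGB⟩ := hG
    refine ⟨A + B, hA.add hB, fun v => ?_⟩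
    rw [traceFunctional_add hA hB]
    exact HasDerivAt.add (hFA v) (hGB v)
  | mul F G _ _ hF hG =>
    obtain ⟨A, hA, hFA⟩ := hF
    obtain ⟨B, hB, hGB⟩ := hG
    refine ⟨(G Γ : ℂ) • A + (F Γ : ℂ) • B, (hA.smul _).add (hB.smul _), fun v => ?_⟩
    have hmul := HasDerivAt.mul (hFA v) (hGB v)
    rw [zero_smul, add_zero] at hmul
    rw [traceFunctional_add (hA.smul _) (hB.smul _), traceFunctional_smul, traceFunctional_smul,
      mul_comm (G Γ)]
    exact hmul

theorem gradient_spec {F : DensityHierarchy d → ℝ} (hF : F ∈ admissible d)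
    (Γ : DensityHierarchy d) : IsObservable (gradient F Γ) ∧
      ∀ v, lineDeriv ℝ F Γ v = traceFunctional (gradient F Γ) v := by
  obtain ⟨A, hA, hFA⟩ := exists_hasLineDerivAt hF Γ
  have hex : ∃ A : ∀ n, Ker d n, IsObservable A ∧
      ∀ v : DensityHierarchy d, ((lineDeriv ℝ F Γ v : ℝ) : ℂ) = Complex.I * hierTrace A v.1 :=
    ⟨A, hA, fun v => by rw [(hFA v).lineDeriv, hA.ofReal_traceFunctional]⟩
  rw [gradient, dif_pos hex]
  exact ⟨hex.choose_spec.1, congrFun (eq_traceFunctional hex.choose_spec.2)⟩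

theorem IsObservable.eq_of_traceFunctional {A B : ∀ n, Ker d n} (hA : IsObservable A)
    (hB : IsObservable B) (h : ∀ v, traceFunctional A v = traceFunctional B v) : A = B := by
  have hsub : A + ((-1 : ℝ) : ℂ) • B = 0 := by
    refine (hA.add (hB.smul _)).eq_zero fun v => ?_
    have hI : Complex.I * hierTrace A v.1 = Complex.I * hierTrace B v.1 := by
      rw [← hA.ofReal_traceFunctional, h, hB.ofReal_traceFunctional]
    rw [hierTrace_add_left hA (hB.smul _), hierTrace_smul_left,
      mul_left_cancel₀ Complex.I_ne_zero hI]
    push_cast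
    ring
  rw [Complex.ofReal_neg, Complex.ofReal_one, neg_one_smul ℂ B, ← sub_eq_add_neg] at hsub
  exact sub_eq_zero.1 hsub

theorem gradient_traceFunctional {A : ∀ n, Ker d n} (hA : IsObservable A)
    (Γ : DensityHierarchy d) : gradient (traceFunctional A) Γ = A := by
  obtain ⟨hgrad, hderiv⟩ := gradient_spec hA.traceFunctional_mem Γ
  refine hgrad.eq_of_traceFunctional hA fun v => ?_
  rw [← hderiv, (hA.hasLineDerivAt_traceFunctional Γ v).lineDeriv]

end

section

variable {d : ℕ}

/-! ### Hilbert–Schmidt observables -/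

instance isAddHaarMeasure_volume_prod (a b : ℕ) :
    (volume : Measure (X d a × X d b)).IsAddHaarMeasure :=
  Measure.prod.instIsAddHaarMeasure _ _

/-- The kernel `i η` of a Hilbert–Schmidt operator, that is `Θ ↦ i ∫ η Θ`. -/
def schwartzKer {n : ℕ} (η : Density d n) : Ker d n :=
  Complex.I • (integralCLM ℂ (volume : Measure (X d (n + 1) × X d (n + 1)))).comp
    (pairing (ContinuousLinearMap.mul ℂ ℂ) η)

theorem schwartzKer_apply {n : ℕ} (η Θ : Density d n) :
    schwartzKer η Θ = Complex.I * ∫ z, η z * Θ z := rfl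

theorem measurePreserving_comp_perm {m : ℕ} (π : Equiv.Perm (Fin m)) :
    MeasurePreserving (fun x : X d m => x ∘ π) := by
  have hcongr : (fun x : X d m => x ∘ π) = MeasurableEquiv.piCongrLeft (fun _ => E d) π.symm := by
    funext x i
    obtain ⟨j, rfl⟩ := π.symm.surjective i
    rw [MeasurableEquiv.coe_piCongrLeft, Equiv.piCongrLeft_apply_apply, Function.comp_apply,
      Equiv.apply_symm_apply]
  rw [hcongr]
  exact volume_measurePreserving_piCongrLeft (fun _ => E d) π.symm

theorem isBosonicKer_schwartzKer {n : ℕ} {η : Density d n} (hη : IsSymmetric η) :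
    IsBosonicKer (schwartzKer η) := by
  intro π σ Θ
  rw [schwartzKer_apply, schwartzKer_apply]
  congr 1
  have hmp : MeasurePreserving (Prod.map (fun x : X d (n + 1) => x ∘ π)
      (fun x : X d (n + 1) => x ∘ σ)) :=
    (measurePreserving_comp_perm π).prod (measurePreserving_comp_perm σ)
  have hemb : MeasurableEmbedding (Prod.map (fun x : X d (n + 1) => x ∘ π)
      (fun x : X d (n + 1) => x ∘ σ)) :=
    ((relabel (d := d) π).prodCongr
      (relabel (d := d) σ)).toHomeomorph.toMeasurableEquiv.measurableEmbedding
  refine Eq.trans ?_ (hmp.integral_comp hemb fun z => η z * Θ z)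
  refine integral_congr_ae (.of_forall fun z => ?_)
  change η z * Θ (z.1 ∘ π, z.2 ∘ σ) = η (z.1 ∘ π, z.2 ∘ σ) * Θ (z.1 ∘ π, z.2 ∘ σ)
  rw [hη.apply_comp π.injective σ.injective]

theorem isSkewAdjoint_schwartzKer {n : ℕ} {η : Density d n} (hη : IsHermitian η) :
    IsSkewAdjoint (schwartzKer η) := by
  intro Θ Θ' h
  rw [schwartzKer_apply, schwartzKer_apply, map_mul, Complex.conj_I, neg_mul, neg_neg]
  congr 1
  rw [← integral_conj, Measure.volume_eq_prod, ← integral_prod_swap]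
  refine integral_congr_ae (.of_forall fun z => ?_)
  change η (z.2, z.1) * Θ' (z.2, z.1) = starRingEnd ℂ (η (z.1, z.2) * Θ (z.1, z.2))
  rw [hη z.2 z.1, h, map_mul]

/-- The linear map `((p, w), (u, y)) ↦ ((v, w), (v', w))`, where `v` and `v'` arise from `p` by
insertion of `u` and of `y` at position `α`. -/
def insertPairMap {n : ℕ} (α : Fin (n + 1)) : ((X d n × X d (n + 1)) × (E d × E d)) →L[ℝ]
    (X d (n + 1) × X d (n + 1)) × (X d (n + 1) × X d (n + 1)) :=
  let pw : ((X d n × X d (n + 1)) × (E d × E d)) →L[ℝ] X d n × X d (n + 1) :=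
    ContinuousLinearMap.fst ℝ _ _
  let uy : ((X d n × X d (n + 1)) × (E d × E d)) →L[ℝ] E d × E d :=
    ContinuousLinearMap.snd ℝ _ _
  let p := (ContinuousLinearMap.fst ℝ (X d n) (X d (n + 1))).comp pw
  let w := (ContinuousLinearMap.snd ℝ (X d n) (X d (n + 1))).comp pw
  let ins : (E d × X d n) →L[ℝ] X d (n + 1) := insertEquiv (d := d) α
  ((ins.comp (((ContinuousLinearMap.fst ℝ (E d) (E d)).comp uy).prod p)).prod w).prod
    ((ins.comp (((ContinuousLinearMap.snd ℝ (E d) (E d)).comp uy).prod p)).prod w)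

theorem insertPairMap_apply {n : ℕ} (α : Fin (n + 1)) (p : X d n) (w : X d (n + 1)) (u y : E d) :
    insertPairMap α ((p, w), (u, y)) =
      ((insertEquiv α (u, p), w), (insertEquiv α (y, p), w)) := rfl

theorem insertPairMap_injective {n : ℕ} (α : Fin (n + 1)) :
    Function.Injective (insertPairMap (d := d) α) := by
  rintro ⟨⟨p, w⟩, u, y⟩ ⟨⟨p', w'⟩, u', y'⟩ h
  rw [insertPairMap_apply, insertPairMap_apply] at h
  simp only [Prod.mk.injEq, EmbeddingLike.apply_eq_iff_eq] at h
  obtain ⟨⟨⟨rfl, rfl⟩, rfl⟩, ⟨rfl, -⟩, -⟩ := h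
  rfl

/-- Splitting off the particle `α` of the first group of variables. -/
def splitEquiv {n : ℕ} (α : Fin (n + 1)) :
    (X d (n + 1) × X d (n + 1)) ≃L[ℝ] E d × (X d n × X d (n + 1)) :=
  ((insertEquiv (d := d) α).symm.prodCongr (ContinuousLinearEquiv.refl ℝ (X d (n + 1)))).trans
    (ContinuousLinearEquiv.prodAssoc ℝ (E d) (X d n) (X d (n + 1)))

theorem measurePreserving_splitEquiv {n : ℕ} (α : Fin (n + 1)) :
    MeasurePreserving (splitEquiv (d := d) α) := by
  have hinsert : MeasurePreserving (insertEquiv (d := d) α).symm :=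
    volume_preserving_piFinSuccAbove (fun _ => E d) α
  exact (volume_preserving_prodAssoc (α₁ := E d) (β₁ := X d n) (γ₁ := X d (n + 1))).comp
    (hinsert.prod (MeasurePreserving.id volume))

theorem integral_eq_integral_integral_insert {n : ℕ} (α : Fin (n + 1)) (F : Density d n) :
    ∫ z, F z = ∫ u : E d, ∫ z : X d n × X d (n + 1), F (insertEquiv α (u, z.1), z.2) := by
  have hsplit : ∫ z, F z = ∫ z, pull (splitEquiv α).symm F z := by
    rw [← (measurePreserving_splitEquiv (d := d) α).integral_comp
      (splitEquiv (d := d) α).toHomeomorph.toMeasurableEquiv.measurableEmbedding]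
    refine integral_congr_ae (.of_forall fun z => ?_)
    simp only [compCLMOfContinuousLinearEquiv_apply, Function.comp_apply,
      ContinuousLinearEquiv.symm_apply_apply]
  rw [hsplit, Measure.volume_eq_prod, integral_prod]
  · rfl
  · have := Measure.prod.instIsAddHaarMeasure (volume : Measure (E d))
      (volume : Measure (X d n × X d (n + 1)))
    exact SchwartzMap.integrable _

theorem goodMapping_schwartzKer {n : ℕ} (η : Density d n) : GoodMapping (schwartzKer η) := by
  intro α
  let S : 𝓢((X d (n + 1) × X d (n + 1)) × (X d (n + 1) × X d (n + 1)), ℂ) →L[ℂ] 𝓢(E d × E d, ℂ) :=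
    Complex.I • (partialIntegral (volume : Measure (X d n × X d (n + 1)))).comp
      (restrict _ (insertPairMap_injective α))
  let T : Density d n →L[ℂ] 𝓢(E d × E d, ℂ) := S.comp (tensorLeft η)
  refine ⟨(LinearMap.flip tensor).compr₂ T.toLinearMap, ?_, fun f g φ y Θ hΘ => ?_⟩
  · exact T.continuous.comp (continuous_tensor.comp (continuous_snd.prodMk continuous_fst))
  · rw [schwartzKer_apply]
    change Complex.I * ∫ z, pairing (ContinuousLinearMap.mul ℂ ℂ) η Θ z = _
    rw [integral_eq_integral_integral_insert α, ← integral_const_mul]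
    refine integral_congr_ae (.of_forall fun u => ?_)
    change Complex.I * ∫ z : X d n × X d (n + 1), η (insertEquiv α (u, z.1), z.2) *
        Θ (insertEquiv α (u, z.1), z.2) =
      (Complex.I * ∫ z : X d n × X d (n + 1), η (insertEquiv α (u, z.1), z.2) *
        (g (insertEquiv α (y, z.1)) * f z.2)) * φ u
    rw [mul_assoc, ← integral_mul_const]
    congr 1
    refine integral_congr_ae (.of_forall fun z => ?_)
    dsimp only
    rw [hΘ, insertEquiv_apply, insertEquiv_apply, Fin.insertNth_apply_same, Fin.update_insertNth]
    ring

theorem trace_schwartzKer_self {n : ℕ} {η : Density d n} (hη : IsHermitian η) :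
    trace (schwartzKer η) η = Complex.I * ((∫ z, ‖η z‖ ^ 2 : ℝ) : ℂ) := by
  rw [trace, schwartzKer_apply, ← integral_complex_ofReal]
  refine congrArg (Complex.I * ·) (integral_congr_ae (.of_forall fun ⟨x, x'⟩ => ?_))
  change η (x, x') * η (x', x) = _
  rw [hη x' x, Complex.mul_conj, Complex.normSq_eq_norm_sq]

theorem eq_zero_of_integral_norm_sq {n : ℕ} {η : Density d n} (h : ∫ z, ‖η z‖ ^ 2 = 0) :
    η = 0 := by
  have hcont : Continuous fun z => ‖η z‖ ^ 2 := by fun_prop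
  have hint : Integrable fun z => ‖η z‖ ^ 2 := by
    refine (pairing (ContinuousLinearMap.mul ℂ ℂ) η η).integrable.norm.congr
      (.of_forall fun z => ?_)
    change ‖η z * η z‖ = ‖η z‖ ^ 2
    rw [norm_mul, sq]
  have hzero := (Continuous.ae_eq_iff_eq volume hcont continuous_const).1
    ((integral_eq_zero_iff_of_nonneg (fun z => by positivity) hint).1 h)
  ext z
  exact norm_eq_zero.1 ((pow_eq_zero_iff two_ne_zero).1 (congrFun hzero z))

theorem eq_zero_of_trace_schwartzKer {n : ℕ} {η : Density d n} (hη : IsHermitian η)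
    (h : trace (schwartzKer η) η = 0) : η = 0 := by
  rw [trace_schwartzKer_self hη, mul_eq_zero, or_iff_right Complex.I_ne_zero,
    Complex.ofReal_eq_zero] at h
  exact eq_zero_of_integral_norm_sq h

theorem eq_of_traceFunctional_eq {Γ Γ' : DensityHierarchy d}
    (h : ∀ A : ∀ n, Ker d n, IsObservable A → traceFunctional A Γ = traceFunctional A Γ') :
    Γ = Γ' := by
  rw [← sub_eq_zero]
  refine Subtype.ext (funext fun n => ?_)
  obtain ⟨hsymm, hherm⟩ := (Γ - Γ').2 n
  refine eq_zero_of_trace_schwartzKer hherm ?_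
  have hA := isObservable_single (isBosonicKer_schwartzKer hsymm)
    (isSkewAdjoint_schwartzKer hherm) (goodMapping_schwartzKer ((Γ - Γ').1 n))
  have htrace := congrArg Complex.ofReal (h _ hA)
  rw [hA.ofReal_traceFunctional, hA.ofReal_traceFunctional, hierTrace_single_left,
    hierTrace_single_left, mul_right_inj' Complex.I_ne_zero] at htrace
  change trace _ (Γ.1 n - Γ'.1 n) = 0
  rw [trace, map_sub, map_sub]
  exact sub_eq_zero.2 htrace

end

section

variable {d : ℕ}

/-! ### The Gross–Pitaevskii vector field -/

open Laplacian in
theorem laplacian_eq_lapAlong (s : 𝓢(E d, ℂ)) (y : E d) :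
    (Δ (s : E d → ℂ)) y = lapAlong (ContinuousLinearMap.id ℝ (E d)) s y := by
  rw [← laplacian_apply, laplacian_eq_sum (EuclideanSpace.basisFun (Fin d) ℝ), lapAlong]
  simp only [sum_apply, EuclideanSpace.basisFun_apply]
  rfl

open Laplacian in
theorem laplacian_update {n : ℕ} (G : 𝓢(X d (n + 1), ℂ)) (α : Fin (n + 1)) (x : X d (n + 1)) :
    (Δ fun y : E d => G (Function.update x α y)) (x α) =
      lapAlong (ContinuousLinearMap.single ℝ (fun _ => E d) α) G x := by
  let s : 𝓢(E d, ℂ) := slice (α.removeNth x)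
    (pull ((ContinuousLinearEquiv.prodComm ℝ (X d n) (E d)).trans (insertEquiv α)) G)
  have hs : ∀ y, G (Function.update x α y) = s y := fun y => by
    rw [← Fin.insertNth_removeNth]
    rfl
  rw [funext hs, laplacian_eq_lapAlong]
  refine (lapAlong_apply_congr 1 fun y => ?_).trans (one_mul _)
  rw [one_mul, ← hs, ← add_single_eq_update]
  rfl

theorem lapAlong_leftDir_apply {n : ℕ} (γ : Density d n) (α : Fin (n + 1)) (x x' : X d (n + 1)) :
    lapAlong (leftDir α) γ (x, x') =
      lapAlong (ContinuousLinearMap.single ℝ (fun _ => E d) α) (slice x' (transpose γ)) x := by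
  refine (lapAlong_apply_congr 1 fun y => ?_).trans (one_mul _)
  rw [add_leftDir, one_mul, ← add_single_eq_update]
  rfl

theorem lapAlong_rightDir_apply {n : ℕ} (γ : Density d n) (α : Fin (n + 1)) (x x' : X d (n + 1)) :
    lapAlong (rightDir α) γ (x, x') =
      lapAlong (ContinuousLinearMap.single ℝ (fun _ => E d) α) (slice x γ) x' := by
  refine (lapAlong_apply_congr 1 fun y => ?_).trans (one_mul _)
  rw [add_rightDir, one_mul, ← add_single_eq_update]
  rfl

theorem lapComm_apply {n : ℕ} (γ : Density d n) (x x' : X d (n + 1)) :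
    lapComm d n γ (x, x') = laplaceCommutator γ x x' := by
  simp only [lapComm, sum_apply, sub_apply, lapAlong_leftDir_apply, lapAlong_rightDir_apply,
    ← laplacian_update]
  rfl

theorem collComm_apply {n : ℕ} (γ : Density d (n + 1)) (x x' : X d (n + 1)) :
    collComm d n γ (x, x') = collision γ x x' := by
  simp only [collComm, collision, sum_apply, sub_apply, coll_apply]
  rfl

theorem gpField_apply (κ : ℝ) (Γ : ∀ n, Density d n) (n : ℕ) (x x' : X d (n + 1)) :
    gpField κ Γ n (x, x') = Complex.I * laplaceCommutator (Γ n) x x' -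
      2 * Complex.I * κ * collision (Γ (n + 1)) x x' := by
  rw [← lapComm_apply, ← collComm_apply]
  rfl

theorem IsSymmetric.lapAlong_leftDir_comp {n : ℕ} {γ : Density d n} (hγ : IsSymmetric γ)
    (π σ : Equiv.Perm (Fin (n + 1))) (α : Fin (n + 1)) (x x' : X d (n + 1)) :
    lapAlong (leftDir α) γ (x ∘ π, x' ∘ σ) = lapAlong (leftDir (π α)) γ (x, x') := by
  refine (lapAlong_apply_congr 1 fun y => ?_).trans (one_mul _)
  have hupdate : Function.update (x ∘ π) α (x (π α) + y) =
      Function.update x (π α) (x (π α) + y) ∘ π := by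
    rw [Function.update_comp_equiv, Equiv.symm_apply_apply]
  rw [add_leftDir, add_leftDir, one_mul, Function.comp_apply, hupdate,
    hγ.apply_comp π.injective σ.injective]

theorem IsSymmetric.lapAlong_rightDir_comp {n : ℕ} {γ : Density d n} (hγ : IsSymmetric γ)
    (π σ : Equiv.Perm (Fin (n + 1))) (α : Fin (n + 1)) (x x' : X d (n + 1)) :
    lapAlong (rightDir α) γ (x ∘ π, x' ∘ σ) = lapAlong (rightDir (σ α)) γ (x, x') := by
  refine (lapAlong_apply_congr 1 fun y => ?_).trans (one_mul _)
  have hupdate : Function.update (x' ∘ σ) α (x' (σ α) + y) =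
      Function.update x' (σ α) (x' (σ α) + y) ∘ σ := by
    rw [Function.update_comp_equiv, Equiv.symm_apply_apply]
  rw [add_rightDir, add_rightDir, one_mul, Function.comp_apply, hupdate,
    hγ.apply_comp π.injective σ.injective]

theorem IsSymmetric.lapComm {n : ℕ} {γ : Density d n} (hγ : IsSymmetric γ) :
    IsSymmetric (lapComm d n γ) := by
  intro π σ
  ext ⟨x, x'⟩
  rw [permAct_apply]
  simp only [GPHierarchy.lapComm, sum_apply, sub_apply, Finset.sum_sub_distrib]
  congr 1
  · exact Fintype.sum_equiv π _ _ fun α => hγ.lapAlong_leftDir_comp π σ α x x'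
  · exact Fintype.sum_equiv σ _ _ fun α => hγ.lapAlong_rightDir_comp π σ α x x'

theorem exists_snoc_comp {n : ℕ} (π : Equiv.Perm (Fin (n + 1))) :
    ∃ s : Fin (n + 2) → Fin (n + 2), Function.Injective s ∧ ∀ (x : X d (n + 1)) (e : E d),
      (Fin.snoc (x ∘ π) e : X d (n + 2)) = (Fin.snoc x e : X d (n + 2)) ∘ s := by
  refine ⟨Fin.snoc (Fin.castSucc ∘ π) (Fin.last _), Fin.snoc_injective_iff.2
    ⟨(Fin.castSucc_injective _).comp π.injective, ?_⟩, fun x e => ?_⟩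
  · rintro ⟨i, hi⟩
    exact (Fin.castSucc_lt_last _).ne hi
  · funext i
    refine Fin.lastCases ?_ (fun j => ?_) i
    · simp
    · simp

theorem IsSymmetric.collComm {n : ℕ} {γ : Density d (n + 1)} (hγ : IsSymmetric γ) :
    IsSymmetric (collComm d n γ) := by
  intro π σ
  ext ⟨x, x'⟩
  obtain ⟨s, hs, hs'⟩ := exists_snoc_comp (d := d) π
  obtain ⟨t, ht, ht'⟩ := exists_snoc_comp (d := d) σ
  rw [permAct_apply]
  simp only [GPHierarchy.collComm, sum_apply, sub_apply, Finset.sum_sub_distrib, coll_apply, hs',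
    ht', hγ.apply_comp hs ht]
  congr 1
  · exact Fintype.sum_equiv π _ _ fun α => rfl
  · exact Fintype.sum_equiv σ _ _ fun α => rfl

theorem IsHermitian.conj_lapComm {n : ℕ} {γ : Density d n} (hγ : IsHermitian γ)
    (x x' : X d (n + 1)) :
    starRingEnd ℂ (lapComm d n γ (x', x)) = -lapComm d n γ (x, x') := by
  have htranspose : ∀ z, transpose γ z = starRingEnd ℂ (γ z) := fun z => hγ z.2 z.1
  simp only [lapComm, sum_apply, sub_apply, map_sum, map_sub, ← Finset.sum_neg_distrib, neg_sub,
    ← lapAlong_conj_apply htranspose, lapAlong_rightDir_transpose, lapAlong_leftDir_transpose]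
  rfl

theorem IsHermitian.conj_collComm {n : ℕ} {γ : Density d (n + 1)} (hγ : IsHermitian γ)
    (x x' : X d (n + 1)) :
    starRingEnd ℂ (collComm d n γ (x', x)) = -collComm d n γ (x, x') := by
  simp only [collComm, sum_apply, sub_apply, map_sum, map_sub, ← Finset.sum_neg_distrib, neg_sub,
    coll_apply]
  simp only [← hγ (Fin.snoc x _) (Fin.snoc x' _)]
  rfl

theorem gpField_mem (κ : ℝ) (Γ : DensityHierarchy d) : gpField κ Γ.1 ∈ DensityHierarchy d := by
  intro n
  refine ⟨fun π σ => ?_, fun x x' => ?_⟩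
  · rw [gpField, map_sub, map_smul, map_smul, IsSymmetric.lapComm (Γ.2 n).1,
      IsSymmetric.collComm (Γ.2 (n + 1)).1]
  · simp only [gpField, sub_apply, smul_apply, smul_eq_mul, map_sub, map_mul,
      IsHermitian.conj_lapComm (Γ.2 n).2, IsHermitian.conj_collComm (Γ.2 (n + 1)).2,
      Complex.conj_I, Complex.conj_ofReal, map_ofNat]
    ring

/-- The Gross–Pitaevskii vector field on the space of density matrix hierarchies; it is linear in
the hierarchy. -/
def gpVectorField (d : ℕ) (κ : ℝ) : DensityHierarchy d →L[ℝ] DensityHierarchy d where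
  toFun Γ := ⟨gpField κ Γ.1, gpField_mem κ Γ⟩
  map_add' Γ Γ' := by
    refine Subtype.ext (funext fun n => ?_)
    change gpField κ (Γ.1 + Γ'.1) n = gpField κ Γ.1 n + gpField κ Γ'.1 n
    simp only [gpField, Pi.add_apply, map_add, smul_add]
    abel
  map_smul' r Γ := by
    refine Subtype.ext (funext fun n => ?_)
    change gpField κ (r • Γ.1) n = r • gpField κ Γ.1 n
    simp only [gpField, Pi.smul_apply, ← Complex.coe_smul, map_smul, smul_sub, smul_smul,
      mul_comm]
  cont := by
    refine Continuous.subtype_mk (continuous_pi fun n => ?_) _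
    have hcomponent : ∀ n, Continuous fun Γ : DensityHierarchy d => Γ.1 n := fun n =>
      (continuous_apply n).comp continuous_subtype_val
    exact (((lapComm d n).continuous.comp (hcomponent n)).const_smul Complex.I).sub
      (((collComm d n).continuous.comp (hcomponent (n + 1))).const_smul (2 * Complex.I * κ))

theorem gpVectorField_val (κ : ℝ) (Γ : DensityHierarchy d) :
    (gpVectorField d κ Γ).1 = gpField κ Γ.1 := rfl

theorem gateauxSmooth_clm {V W : Type*} [AddCommGroup V] [Module ℝ V] [TopologicalSpace V]
    [AddCommGroup W] [Module ℝ W] [TopologicalSpace W] (T : V →L[ℝ] W) : GateauxSmooth T := by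
  refine ⟨fun r x v => match r, v with
    | 0, _ => T x
    | 1, v => T (v 0)
    | _ + 2, _ => 0, fun x v => rfl, fun r => ?_, fun r x v w => ?_⟩
  · match r with
    | 0 => exact T.continuous.comp continuous_fst
    | 1 => exact T.continuous.comp ((continuous_apply 0).comp continuous_snd)
    | _ + 2 => exact continuous_const
  · match r, v with
    | 0, v =>
      refine tendsto_const_nhds.congr' ?_
      filter_upwards [self_mem_nhdsWithin] with t ht
      change T w = t⁻¹ • (T (x + t • w) - T x)
      rw [map_add, map_smul, add_sub_cancel_left, inv_smul_smul₀ ht]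
    | 1, v =>
      refine tendsto_const_nhds.congr fun t => ?_
      change 0 = t⁻¹ • (T (v 0) - T (v 0))
      rw [sub_self, smul_zero]
    | r + 2, v =>
      refine tendsto_const_nhds.congr fun t => ?_
      change (0 : W) = t⁻¹ • (0 - 0)
      rw [sub_self, smul_zero]

end

section

variable {d : ℕ}

/-! ### The Hamiltonian vector field and the Gross–Pitaevskii hierarchy -/

theorem ofReal_gpHamiltonian (κ : ℝ) (Γ : DensityHierarchy d) :
    (gpHamiltonian d κ Γ : ℂ) = hierTrace (gpGenerator d κ) Γ.1 := by
  rw [gpHamiltonian_eq_traceFunctional, (isObservable_gpObservable κ).ofReal_traceFunctional,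
    hierTrace_gpObservable]

theorem gpHamiltonian_mem_admissible (κ : ℝ) : gpHamiltonian d κ ∈ admissible d := by
  rw [gpHamiltonian_eq_traceFunctional]
  exact (isObservable_gpObservable κ).traceFunctional_mem

theorem poissonBracket_gpHamiltonian {κ : ℝ} {F : DensityHierarchy d → ℝ} (hF : F ∈ admissible d)
    (Γ : DensityHierarchy d) : poissonBracket F (gpHamiltonian d κ) Γ =
      ((lineDeriv ℝ F Γ (gpVectorField d κ Γ) : ℝ) : ℂ) := by
  obtain ⟨hgrad, hderiv⟩ := gradient_spec hF Γ
  rw [hderiv, hgrad.ofReal_traceFunctional, poissonBracket, gpHamiltonian_eq_traceFunctional,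
    gradient_traceFunctional (isObservable_gpObservable κ),
    hierTrace_lieBracket_gpObservable hgrad fun n => (Γ.2 n).1, gpVectorField_val]

theorem isHamiltonianVectorField_gpVectorField (κ : ℝ) :
    IsHamiltonianVectorField (gpHamiltonian d κ) (gpVectorField d κ) :=
  ⟨gateauxSmooth_clm _, fun _ hF Γ => (poissonBracket_gpHamiltonian hF Γ).symm⟩

theorem IsHamiltonianVectorField.unique {H : DensityHierarchy d → ℝ}
    {Y Z : DensityHierarchy d → DensityHierarchy d} (hY : IsHamiltonianVectorField H Y)
    (hZ : IsHamiltonianVectorField H Z) : Y = Z := by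
  funext Γ
  refine eq_of_traceFunctional_eq fun A hA => ?_
  have hderiv := (hY.2 _ hA.traceFunctional_mem Γ).trans (hZ.2 _ hA.traceFunctional_mem Γ).symm
  rw [(hA.hasLineDerivAt_traceFunctional Γ _).lineDeriv,
    (hA.hasLineDerivAt_traceFunctional Γ _).lineDeriv] at hderiv
  exact Complex.ofReal_injective hderiv

/-- Evaluation of a component of a hierarchy at a point; continuity of this map reduces the
topological notion of a derivative to derivatives of complex-valued functions. -/
def evalComponent (n : ℕ) (x x' : X d (n + 1)) : DensityHierarchy d →L[ℝ] ℂ where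
  toFun Γ := Γ.1 n (x, x')
  map_add' _ _ := rfl
  map_smul' _ _ := rfl
  cont := ((continuous_eval_const (x, x')).comp
    (toBoundedContinuousFunctionCLM ℂ (X d (n + 1) × X d (n + 1)) ℂ).continuous).comp
    ((continuous_apply n).comp continuous_subtype_val)

theorem HasCurveDeriv.hasDerivWithinAt {Γ : ℝ → DensityHierarchy d} {Γ' : DensityHierarchy d}
    {I : Set ℝ} {t : ℝ} (h : HasCurveDeriv Γ Γ' I t) (n : ℕ) (x x' : X d (n + 1)) :
    HasDerivWithinAt (fun s => (Γ s).1 n (x, x')) (Γ'.1 n (x, x')) I t := by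
  rw [hasDerivWithinAt_iff_tendsto_slope]
  refine (((evalComponent n x x').continuous.tendsto Γ').comp h).congr fun s => ?_
  change evalComponent n x x' ((s - t)⁻¹ • (Γ s - Γ t)) = _
  rw [map_smul, map_sub]
  rfl

theorem SmoothCurveOn.exists_hasCurveDeriv {V : Type*} [AddCommGroup V] [Module ℝ V]
    [TopologicalSpace V] {Γ : ℝ → V} {I : Set ℝ} (h : SmoothCurveOn Γ I) {t : ℝ} (ht : t ∈ I) :
    ∃ Γ', HasCurveDeriv Γ Γ' I t := by
  obtain ⟨D, hD, h⟩ := h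
  refine ⟨D 1 t, (h 0 t ht).congr' ?_⟩
  filter_upwards [self_mem_nhdsWithin] with s hs
  rw [slope, slope, hD s hs.1, hD t ht]

theorem I_mul_gpVectorField_apply (κ : ℝ) (Γ : DensityHierarchy d) (n : ℕ)
    (x x' : X d (n + 1)) : Complex.I * (gpVectorField d κ Γ).1 n (x, x') =
      -laplaceCommutator (Γ.1 n) x x' + 2 * κ * collision (Γ.1 (n + 1)) x x' := by
  rw [gpVectorField_val, gpField_apply]
  linear_combination (laplaceCommutator (Γ.1 n) x x' -
    2 * κ * collision (Γ.1 (n + 1)) x x') * Complex.I_mul_I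

theorem solvesGP_iff {κ : ℝ} {I : Set ℝ} (hI : UniqueDiffOn ℝ I) {Γ : ℝ → DensityHierarchy d}
    (hΓ : ∀ t ∈ I, ∃ Γ', HasCurveDeriv Γ Γ' I t) :
    SolvesGP κ I Γ ↔ ∀ t ∈ I, HasCurveDeriv Γ (gpVectorField d κ (Γ t)) I t := by
  refine forall₂_congr fun t ht => ⟨fun h => ?_, fun h n x x' => ?_⟩
  · obtain ⟨Γ', hΓ'⟩ := hΓ t ht
    suffices hfield : Γ' = gpVectorField d κ (Γ t) from hfield ▸ hΓ'
    refine Subtype.ext (funext fun n => ?_)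
    ext ⟨x, x'⟩
    have hderiv := (hΓ'.hasDerivWithinAt n x x').const_mul Complex.I
    have hGP := h n x x'
    rw [← I_mul_gpVectorField_apply] at hGP
    exact mul_left_cancel₀ Complex.I_ne_zero ((hI t ht).eq_deriv _ hderiv hGP)
  · rw [← I_mul_gpVectorField_apply]
    exact (h.hasDerivWithinAt n x x').const_mul Complex.I

end

end GPHierarchy

end

theorem theorem2p2_general (d : ℕ) (κ : ℝ) :
    (∀ Γ : GPHierarchy.DensityHierarchy d,
      (GPHierarchy.gpHamiltonian d κ Γ : ℂ) =
        GPHierarchy.hierTrace (GPHierarchy.gpGenerator d κ) Γ.1) ∧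
    GPHierarchy.gpHamiltonian d κ ∈ GPHierarchy.admissible d ∧
    ∃ Y : GPHierarchy.DensityHierarchy d → GPHierarchy.DensityHierarchy d,
      GPHierarchy.IsHamiltonianVectorField (GPHierarchy.gpHamiltonian d κ) Y ∧
      (∀ Z, GPHierarchy.IsHamiltonianVectorField (GPHierarchy.gpHamiltonian d κ) Z → Z = Y) ∧
      ∀ I : Set ℝ, UniqueDiffOn ℝ I → ∀ Γ : ℝ → GPHierarchy.DensityHierarchy d,
        (∀ t ∈ I, ∃ Γ', GPHierarchy.HasCurveDeriv Γ Γ' I t) →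
        (GPHierarchy.SolvesGP κ I Γ ↔ ∀ t ∈ I, GPHierarchy.HasCurveDeriv Γ (Y (Γ t)) I t) :=
  have hham := GPHierarchy.isHamiltonianVectorField_gpVectorField κ
  ⟨GPHierarchy.ofReal_gpHamiltonian κ, GPHierarchy.gpHamiltonian_mem_admissible κ,
    GPHierarchy.gpVectorField d κ, hham, fun _ hZ => hZ.unique hham,
    fun _ hI _ hΓ => GPHierarchy.solvesGP_iff hI hΓ⟩

theorem theorem2p2 (d : ℕ) (hd : 1 ≤ d) (κ : ℝ) (hκ : κ = 1 ∨ κ = -1) :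
    (∀ Γ : GPHierarchy.DensityHierarchy d,
      (GPHierarchy.gpHamiltonian d κ Γ : ℂ) =
        GPHierarchy.hierTrace (GPHierarchy.gpGenerator d κ) Γ.1) ∧
    GPHierarchy.gpHamiltonian d κ ∈ GPHierarchy.admissible d ∧
    ∃ Y : GPHierarchy.DensityHierarchy d → GPHierarchy.DensityHierarchy d,
      GPHierarchy.IsHamiltonianVectorField (GPHierarchy.gpHamiltonian d κ) Y ∧
      (∀ Z, GPHierarchy.IsHamiltonianVectorField (GPHierarchy.gpHamiltonian d κ) Z → Z = Y) ∧
      ∀ (a b : ℝ), a < b → ∀ Γ : ℝ → GPHierarchy.DensityHierarchy d,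
        GPHierarchy.SmoothCurveOn Γ (Set.Icc a b) →
        (GPHierarchy.SolvesGP κ (Set.Icc a b) Γ ↔
          ∀ t ∈ Set.Icc a b, GPHierarchy.HasCurveDeriv Γ (Y (Γ t)) (Set.Icc a b) t) := by
  obtain ⟨hreal, hmem, Y, hY, hunique, hsolves⟩ := theorem2p2_general d κ
  exact ⟨hreal, hmem, Y, hY, hunique, fun _ _ hab Γ hΓ =>
    hsolves _ (uniqueDiffOn_Icc hab) Γ fun _ ht => hΓ.exists_hasCurveDeriv ht⟩
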